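/- **Setting.** Let $n\ge 2$ and let $\Omega\subset\mathbb R^n$ be bounded and open. Let $\mathcal N$ be the set of functions $\Phi:[0,\infty)\to[0,\infty)$ of class $C^1([0,\infty))\cap C^2((0,\infty))$ that are increasing and convex, with $\Phi(0)=0$, $\Phi(t)\to\infty$ as $t\to\infty$, $\Phi(t)/t\to0$ as $t\to0^+$ and $\Phi(t)/t\to\infty$ as $t\to\infty$, and such that $\frac1{s(\Phi)}\le\frac{\Phi''(t)t}{\Phi'(t)}\le s(\Phi)$ for all $t>0$, for some number $s(\Phi)\ge1$ (an index of $\Phi$). Let $G,H_a,H_b\in\mathcal N$. Let $\omega_a,\omega_b:[0,\infty)\to[0,\infty)$ be concave and vanish at $0$. For a modulus $\sigma$ put $[f]_{\sigma}=\sup_{x\ne y\in\Omega}|f(x)-f(y)|/\sigma(|x-y|)$ and $\|f\|_{C^\sigma(\Omega)}=\|f\|_{L^\infty(\Omega)}+[f]_\sigma$ (with $0/0=0$), and write $[f]_{0,\gamma}$ when $\sigma(t)=t^\gamma$. Let $a,b\ge0$ be uniformly continuous on $\Omega$ with $\|a\|_{C^{\omega_a}(\Omega)},\|b\|_{C^{\omega_b}(\Omega)}<\infty$.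 Set $$\Psi(x,t)=G(t)+a(x)H_a(t)+b(x)H_b(t),\qquad \Lambda(s,t)=\frac{\omega_a(s)}{1+\omega_a(s)}\frac{H_a(t)}{G(t)}+\frac{\omega_b(s)}{1+\omega_b(s)}\frac{H_b(t)}{G(t)}.$$ Write $u\in W^{1,\Psi}(\Omega)$ if $u$ has a distributional gradient $Du$ and $\int_\Omega\Psi(x,|u|)\,dx+\int_\Omega\Psi(x,|Du|)\,dx<\infty$. Let $F:\Omega\times\mathbb R\times\mathbb R^n\to\mathbb R$ be a Carathéodory function with $\nu\Psi(x,|z|)\le F(x,y,z)\le L\Psi(x,|z|)$ for all $x,y,z$, where $0<\nu\le L$, and let $\mathcal F(v,A)=\int_AF(x,v,Dv)\,dx$. A function $u\in W^{1,1}_{\rm loc}(\Omega)$ is a local minimizer of $\mathcal F$ if $\Psi(x,|Du|)\in L^1(\Omega)$ and $\mathcal F(u,\operatorname{supp}(u-v))\le\mathcal F(v,\operatorname{supp}(u-v))$ for all $v\in W^{1,1}_{\rm loc}(\Omega)$ with $\operatorname{supp}(u-v)\Subset\Omega$. Let $u$ be a local minimizer of $\mathcal F$, and assume one of: 1. $u\in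 W^{1,\Psi}(\Omega)$ and $\lambda_1:=\sup_{t>0}\Lambda(t,G^{-1}(t^{-n}))<\infty$; 2. $u\in W^{1,\Psi}(\Omega)\cap L^\infty(\Omega)$ and $\lambda_2:=\sup_{t>0}\Lambda(t,1/t)<\infty$; 3. $u\in W^{1,\Psi}(\Omega)\cap C^{0,\gamma}(\Omega)$ for some $\gamma\in(0,1)$ and $\lambda_3:=\sup_{t>0}\Lambda(t^{1/(1-\gamma)},1/t)<\infty$. Let `data` denote $n,s(G),s(H_a),s(H_b),\nu,L,\|a\|_{C^{\omega_a}(\Omega)},\|b\|_{C^{\omega_b}(\Omega)},\omega_a(1),\omega_b(1)$ together with, respectively, (1) $\lambda_1,\|\Psi(x,|Du|)\|_{L^1(\Omega)},\|u\|_{L^1(\Omega)}$; (2) $\lambda_2,\|u\|_{L^\infty(\Omega)}$; (3) $\gamma,\lambda_3,[u]_{0,\gamma}$. **Theorem 5.9 (higher integrability).** There are $\delta\in(0,1)$ and $c\ge1$, depending only on `data`, such that $$\Big(\frac{1}{|B_{R/2}|}\int_{B_{R/2}}[\Psi(x,|Du|)]^{1+\delta}\,dx\Big)^{\frac1{1+\delta}}\le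 c\,\frac{1}{|B_R|}\int_{B_R}\Psi(x,|Du|)\,dx$$ for every ball $B_R\Subset\Omega$ with $R\le1$ (with $B_{R/2}$ concentric). In particular, for every open $\Omega_0\Subset\Omega$ we have $\Psi(x,|Du|)\in L^{1+\delta}(\Omega_0)$ and $$\|\Psi(x,|Du|)\|_{L^{1+\delta}(\Omega_0)}\le C\,\|\Psi(x,|Du|)\|_{L^1(\Omega)},$$ where $C\ge1$ depends only on `data` and $\operatorname{dist}(\Omega_0,\partial\Omega)$. In case 1 one also has $\|\Psi(x,|Du|)\|_{L^{1+\delta}(\Omega_0)}\le C$ with such a $C$. -/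

import Mathlib

open MeasureTheory Set Filter Topology
open scoped ENNReal

noncomputable section

namespace OrliczMultiPhase

/-- `G ∈ 𝒩` with index `s`: an `x`-independent Young function on `[0, ∞)`, of class
`C¹([0, ∞)) ∩ C²((0, ∞))`, with `1/s ≤ G''(t) t / G'(t) ≤ s` for all `t > 0`.
Only the values of `G` on `[0, ∞)` matter.  (The lower bound forces `G'(t) ≠ 0`.) -/
structure IsNFunction (G : ℝ → ℝ) (s : ℝ) : Prop where
  monotone : MonotoneOn G (Ici 0)
  convex : ConvexOn ℝ (Ici 0) G
  zero : G 0 = 0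
  tendsto_atTop : Tendsto G atTop atTop
  slope_zero : Tendsto (fun t => G t / t) (𝓝[>] 0) (𝓝 0)
  slope_atTop : Tendsto (fun t => G t / t) atTop atTop
  contDiff_one : ContDiffOn ℝ 1 G (Ici 0)
  contDiff_two : ContDiffOn ℝ 2 G (Ioi 0)
  one_le_index : 1 ≤ s
  index_lower : ∀ t : ℝ, 0 < t → 1 / s ≤ deriv (deriv G) t * t / deriv G t
  index_upper : ∀ t : ℝ, 0 < t → deriv (deriv G) t * t / deriv G t ≤ s

/-- The seminorm `[f]_{σ;Ω} = sup_{x ≠ y} |f x - f y| / σ(|x - y|)`, with values in `[0, ∞]`.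
Here `0 / 0 = 0` and `r / 0 = ∞` for `r > 0`, so the diagonal contributes nothing. -/
def modulusSeminorm {n : ℕ} (Ω : Set (EuclideanSpace ℝ (Fin n))) (σ : ℝ → ℝ)
    (f : EuclideanSpace ℝ (Fin n) → ℝ) : ℝ≥0∞ :=
  ⨆ x ∈ Ω, ⨆ y ∈ Ω, ENNReal.ofReal |f x - f y| / ENNReal.ofReal (σ (dist x y))

/-- The norm `‖f‖_{C^σ(Ω)} = ‖f‖_{L^∞(Ω)} + [f]_{σ;Ω}`. -/
def modulusNorm {n : ℕ} (Ω : Set (EuclideanSpace ℝ (Fin n))) (σ : ℝ → ℝ)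
    (f : EuclideanSpace ℝ (Fin n) → ℝ) : ℝ≥0∞ :=
  eLpNorm f ∞ (volume.restrict Ω) + modulusSeminorm Ω σ f

/-- A concave function `σ : [0, ∞) → [0, ∞)` vanishing at the origin. -/
structure IsConcaveModulus (σ : ℝ → ℝ) : Prop where
  concave : ConcaveOn ℝ (Ici 0) σ
  nonneg : ∀ t : ℝ, 0 ≤ t → 0 ≤ σ t
  zero : σ 0 = 0

/-- The ambient objects: a bounded open set `Ω ⊆ ℝⁿ`, functions `G, H_a, H_b ∈ 𝒩` with chosen
indices, concave moduli `ω_a, ω_b`, and coefficients `0 ≤ a ∈ C^{ω_a}(Ω)`,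
`0 ≤ b ∈ C^{ω_b}(Ω)`.  Coefficients only matter on `Ω`. -/
structure Setting (n : ℕ) where
  Ω : Set (EuclideanSpace ℝ (Fin n))
  G : ℝ → ℝ
  Ha : ℝ → ℝ
  Hb : ℝ → ℝ
  sG : ℝ
  sHa : ℝ
  sHb : ℝ
  ωa : ℝ → ℝ
  ωb : ℝ → ℝ
  a : EuclideanSpace ℝ (Fin n) → ℝ
  b : EuclideanSpace ℝ (Fin n) → ℝ
  isOpen : IsOpen Ω
  isBounded : Bornology.IsBounded Ω
  hG : IsNFunction G sG
  hHa : IsNFunction Ha sHa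
  hHb : IsNFunction Hb sHb
  hωa : IsConcaveModulus ωa
  hωb : IsConcaveModulus ωb
  a_nonneg : ∀ x ∈ Ω, 0 ≤ a x
  b_nonneg : ∀ x ∈ Ω, 0 ≤ b x
  a_uniformContinuous : UniformContinuousOn a Ω
  b_uniformContinuous : UniformContinuousOn b Ω
  a_norm_finite : modulusNorm Ω ωa a < ∞
  b_norm_finite : modulusNorm Ω ωb b < ∞

namespace Setting

variable {n : ℕ} (S : Setting n)

/-- `Ψ(x, t) = G(t) + a(x) H_a(t) + b(x) H_b(t)`. -/
def Psi (x : EuclideanSpace ℝ (Fin n)) (t : ℝ) : ℝ :=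
  S.G t + S.a x * S.Ha t + S.b x * S.Hb t

/-- `Λ(s, t) = ω_a(s)/(1 + ω_a(s)) · H_a(t)/G(t) + ω_b(s)/(1 + ω_b(s)) · H_b(t)/G(t)`. -/
def Lam (s t : ℝ) : ℝ :=
  S.ωa s / (1 + S.ωa s) * (S.Ha t / S.G t) + S.ωb s / (1 + S.ωb s) * (S.Hb t / S.G t)

/-- The inverse of the bijection `G : [0, ∞) → [0, ∞)`. -/
def Ginv : ℝ → ℝ := Function.invFunOn S.G (Ici 0)

/-- `λ₁ = sup_{t > 0} Λ(t, G⁻¹(t⁻ⁿ))`. -/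
def lam₁ : ℝ≥0∞ := ⨆ t ∈ Ioi (0 : ℝ), ENNReal.ofReal (S.Lam t (S.Ginv ((t ^ n)⁻¹)))

/-- `λ₂ = sup_{t > 0} Λ(t, 1/t)`. -/
def lam₂ : ℝ≥0∞ := ⨆ t ∈ Ioi (0 : ℝ), ENNReal.ofReal (S.Lam t (1 / t))

/-- `λ₃ = sup_{t > 0} Λ(t^{1/(1-γ)}, 1/t)`. -/
def lam₃ (γ : ℝ) : ℝ≥0∞ :=
  ⨆ t ∈ Ioi (0 : ℝ), ENNReal.ofReal (S.Lam (t ^ (1 / (1 - γ))) (1 / t))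

end Setting

/-- `v ∈ W^{1,1}_loc(Ω)` with distributional gradient `Dv`. -/
structure HasWeakGradient {n : ℕ} (Ω : Set (EuclideanSpace ℝ (Fin n)))
    (v : EuclideanSpace ℝ (Fin n) → ℝ)
    (Dv : EuclideanSpace ℝ (Fin n) → EuclideanSpace ℝ (Fin n)) : Prop where
  locallyIntegrable : LocallyIntegrableOn v Ω volume
  grad_locallyIntegrable : LocallyIntegrableOn Dv Ω volume
  integral_eq : ∀ φ : EuclideanSpace ℝ (Fin n) → ℝ,
    ContDiff ℝ ((⊤ : ℕ∞) : WithTop ℕ∞) φ → HasCompactSupport φ → tsupport φ ⊆ Ω →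
    ∀ w : EuclideanSpace ℝ (Fin n),
      ∫ x in Ω, v x * fderiv ℝ φ x w = -∫ x in Ω, φ x * inner ℝ (Dv x) w

namespace Setting

variable {n : ℕ} (S : Setting n)

/-- `v ∈ W^{1,Ψ}(Ω)` with distributional gradient `Dv`.  As `Ψ` satisfies the `Δ₂` condition, the
Musielak-Orlicz space is the class of measurable functions with finite modular. -/
structure MemW1Psi (v : EuclideanSpace ℝ (Fin n) → ℝ)
    (Dv : EuclideanSpace ℝ (Fin n) → EuclideanSpace ℝ (Fin n)) : Prop where
  hasWeakGradient : HasWeakGradient S.Ω v Dv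
  modular_finite : ∫⁻ x in S.Ω, ENNReal.ofReal (S.Psi x |v x|) < ∞
  grad_modular_finite : ∫⁻ x in S.Ω, ENNReal.ofReal (S.Psi x ‖Dv x‖) < ∞

/-- `F : Ω × ℝ × ℝⁿ → ℝ` is a Carathéodory function with
`ν Ψ(x, |z|) ≤ F(x, y, z) ≤ L Ψ(x, |z|)`, where `0 < ν ≤ L`. -/
structure IsIntegrand (ν L : ℝ)
    (F : EuclideanSpace ℝ (Fin n) → ℝ → EuclideanSpace ℝ (Fin n) → ℝ) : Prop where
  ν_pos : 0 < ν
  ν_le_L : ν ≤ L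
  measurable : ∀ y z, AEMeasurable (fun x => F x y z) (volume.restrict S.Ω)
  continuous : ∀ᵐ x ∂(volume.restrict S.Ω),
    Continuous fun p : ℝ × EuclideanSpace ℝ (Fin n) => F x p.1 p.2
  lower : ∀ x ∈ S.Ω, ∀ y z, ν * S.Psi x ‖z‖ ≤ F x y z
  upper : ∀ x ∈ S.Ω, ∀ y z, F x y z ≤ L * S.Psi x ‖z‖

end Setting

/-- `𝓕(v, A) = ∫_A F(x, v, Dv) dx ∈ [0, ∞]` for a nonnegative integrand. -/
def functional {n : ℕ} (F : EuclideanSpace ℝ (Fin n) → ℝ → EuclideanSpace ℝ (Fin n) → ℝ)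
    (v : EuclideanSpace ℝ (Fin n) → ℝ)
    (Dv : EuclideanSpace ℝ (Fin n) → EuclideanSpace ℝ (Fin n))
    (A : Set (EuclideanSpace ℝ (Fin n))) : ℝ≥0∞ :=
  ∫⁻ x in A, ENNReal.ofReal (F x (v x) (Dv x))

/-- The support of the difference `u - v` of two functions on `Ω`.  (Every `v` whose difference
with `u` has essential support `K` has a representative for which this closure is `K`.) -/
def diffSupport {n : ℕ} (Ω : Set (EuclideanSpace ℝ (Fin n)))
    (u v : EuclideanSpace ℝ (Fin n) → ℝ) : Set (EuclideanSpace ℝ (Fin n)) :=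
  closure {x | x ∈ Ω ∧ u x ≠ v x}

/-- `u`, with distributional gradient `Du`, is a local minimizer of `𝓕`. -/
structure Setting.IsLocalMinimizer {n : ℕ} (S : Setting n)
    (F : EuclideanSpace ℝ (Fin n) → ℝ → EuclideanSpace ℝ (Fin n) → ℝ)
    (u : EuclideanSpace ℝ (Fin n) → ℝ)
    (Du : EuclideanSpace ℝ (Fin n) → EuclideanSpace ℝ (Fin n)) : Prop where
  hasWeakGradient : HasWeakGradient S.Ω u Du
  energy_finite : ∫⁻ x in S.Ω, ENNReal.ofReal (S.Psi x ‖Du x‖) < ∞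
  minimal : ∀ (v : EuclideanSpace ℝ (Fin n) → ℝ)
    (Dv : EuclideanSpace ℝ (Fin n) → EuclideanSpace ℝ (Fin n)),
    HasWeakGradient S.Ω v Dv →
    IsCompact (diffSupport S.Ω u v) → diffSupport S.Ω u v ⊆ S.Ω →
    functional F u Du (diffSupport S.Ω u v) ≤ functional F v Dv (diffSupport S.Ω u v)

/-- The three alternative sets of a priori assumptions on the minimizer. -/
inductive Regime where
  | sobolev
  | bounded
  | holder (γ : ℝ)

/-- The assumption itself: `u ∈ W^{1,Ψ}(Ω)` together with, respectively,
`λ₁ < ∞`; `u ∈ L^∞(Ω)` and `λ₂ < ∞`; `u ∈ C^{0,γ}(Ω)`, `γ ∈ (0,1)`, and `λ₃ < ∞`. -/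
def Setting.Assumption {n : ℕ} (S : Setting n) (u : EuclideanSpace ℝ (Fin n) → ℝ)
    (Du : EuclideanSpace ℝ (Fin n) → EuclideanSpace ℝ (Fin n)) : Regime → Prop
  | .sobolev => S.MemW1Psi u Du ∧ S.lam₁ < ∞
  | .bounded => S.MemW1Psi u Du ∧ MemLp u ∞ (volume.restrict S.Ω) ∧ S.lam₂ < ∞
  | .holder γ => S.MemW1Psi u Du ∧ 0 < γ ∧ γ < 1 ∧
      modulusSeminorm S.Ω (fun t => t ^ γ) u < ∞ ∧ S.lam₃ γ < ∞

/-- The parameters common to the three regimes (the dimension is kept separate). -/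
structure BaseData where
  sG : ℝ
  sHa : ℝ
  sHb : ℝ
  ν : ℝ
  L : ℝ
  normA : ℝ
  normB : ℝ
  ωa_one : ℝ
  ωb_one : ℝ

/-- The data of the problem in each regime. -/
inductive Data where
  | sobolev (base : BaseData) (lam₁ normPsi normU : ℝ)
  | bounded (base : BaseData) (lam₂ supU : ℝ)
  | holder (base : BaseData) (γ lam₃ seminormU : ℝ)

/-- `s(G), s(H_a), s(H_b), ν, L, ‖a‖_{C^{ω_a}(Ω)}, ‖b‖_{C^{ω_b}(Ω)}, ω_a(1), ω_b(1)`. -/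
def Setting.baseData {n : ℕ} (S : Setting n) (ν L : ℝ) : BaseData where
  sG := S.sG
  sHa := S.sHa
  sHb := S.sHb
  ν := ν
  L := L
  normA := (modulusNorm S.Ω S.ωa S.a).toReal
  normB := (modulusNorm S.Ω S.ωb S.b).toReal
  ωa_one := S.ωa 1
  ωb_one := S.ωb 1

/-- The actual data: the base data together with, respectively, `λ₁`, `‖Ψ(x,|Du|)‖_{L¹(Ω)}`,
`‖u‖_{L¹(Ω)}`; `λ₂`, `‖u‖_{L^∞(Ω)}`; `γ`, `λ₃`, `[u]_{0,γ;Ω}`. -/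
def Setting.data {n : ℕ} (S : Setting n) (ν L : ℝ) (u : EuclideanSpace ℝ (Fin n) → ℝ)
    (Du : EuclideanSpace ℝ (Fin n) → EuclideanSpace ℝ (Fin n)) : Regime → Data
  | .sobolev => .sobolev (S.baseData ν L) S.lam₁.toReal
      (∫⁻ x in S.Ω, ENNReal.ofReal (S.Psi x ‖Du x‖)).toReal
      (eLpNorm u 1 (volume.restrict S.Ω)).toReal
  | .bounded => .bounded (S.baseData ν L) S.lam₂.toReal
      (eLpNorm u ∞ (volume.restrict S.Ω)).toReal
  | .holder γ => .holder (S.baseData ν L) γ (S.lam₃ γ).toReal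
      (modulusSeminorm S.Ω (fun t => t ^ γ) u).toReal

/-- `dist(A, B)`, the infimum of the distances between points of `A` and points of `B`. -/
def setDist {n : ℕ} (A B : Set (EuclideanSpace ℝ (Fin n))) : ℝ :=
  (⨅ x ∈ A, Metric.infEDist x B).toReal

end OrliczMultiPhase

end

open OrliczMultiPhase

/-! The theorem is a self-improvement of Gehring type: a reverse Hölder inequality for `Ψ(x, |Du|)`
on all small balls, with exponents `1` and some `θ < 1`, forces integrability with an exponent
larger than `1`. Everything before Gehring's lemma serves to prove that inequality with constants
read off from the data.

Minimality against `u - η (u - k)` and hole filling give the Caccioppoli inequality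
(`exists_caccioppoli`): the energy on a ball is controlled by the integral of `Ψ(x, |u - k| / r)` on
a larger one. The right side needs a Sobolev–Poincaré inequality, which is available for a single
Young function but not for `Ψ(x, ·)`. So `Ψ` is compared with the function `A` obtained by freezing
`a` and `b` at their minima over the ball; then `A ≤ Ψ` there, and with `U = |u - k| / r` the error
is a multiple of `ω_a(r) H_a(U) + ω_b(r) H_b(U)`.

The bound on `Λ`, used at a scale `t` tied to `U`, turns this error into a multiple of `(1 + r / t)
G(U)` (`ae_Psi_le_frozenPsi`). In case 1, `t = G(U)^(-1/n)`, which leaves a term `r G(U)^(1 + 1/n)`.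
In case 2, `t = 1 / U`, and `r / t = |u - k|` is bounded. In case 3, `t = U^(-1/(1-γ))`, and Hölder
continuity bounds `r / t`.

The Sobolev–Poincaré inequality for `A` (`exists_sobolev_poincare`) follows from the Riesz potential
estimate for `u - k`, Jensen's inequality for `A^θ` and integrability of powers of the kernel. It is
applied with two exponents, one for `A` and one for `A^(1 + 1/n)`; in the second, the surplus power
is paid by the `1/n`-th power of the total energy, so only case 1 has the energy in its data. This
yields `exists_reverseHolder`.

Gehring's lemma (`exists_gehring`) weights the function by a power of the distance to the boundary
of the ball, proves a super-level estimate by stopping radii and Vitali covering, and integrates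
over the levels. The estimate on `Ω₀` comes from averaging the ball estimate over all centres. -/

/-! ### Young functions: from the index condition to power growth. -/

/-- Two-sided power growth of a Young function of index `s`. -/
structure PowerGrowth (A : ℝ → ℝ) (s : ℝ) : Prop where
  one_le : 1 ≤ s
  mono : MonotoneOn A (Ici 0)
  cont : ContinuousOn A (Ici 0)
  zero : A 0 = 0
  pos : ∀ t, 0 < t → 0 < A t
  lower : ∀ l t, 1 ≤ l → 0 ≤ t → l ^ (1 + 1 / s) * A t ≤ A (l * t)
  upper : ∀ l t, 1 ≤ l → 0 ≤ t → A (l * t) ≤ l ^ (1 + s) * A t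

namespace OrliczMultiPhase.IsNFunction

variable {G : ℝ → ℝ} {s : ℝ} (h : IsNFunction G s)
include h

lemma hasDerivAt {t : ℝ} (ht : 0 < t) : HasDerivAt G (deriv G t) t := by
  have := (h.contDiff_two.contDiffAt (Ioi_mem_nhds ht)).differentiableAt (by norm_num)
  exact this.hasDerivAt

lemma hasDerivAt_deriv {t : ℝ} (ht : 0 < t) : HasDerivAt (deriv G) (deriv (deriv G) t) t := by
  have h1 : ContDiffOn ℝ 1 (deriv G) (Ioi 0) :=
    ((contDiffOn_succ_iff_deriv_of_isOpen (n := 1) isOpen_Ioi).1 (by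
      simpa [one_add_one_eq_two] using h.contDiff_two)).2.2
  exact ((h1.contDiffAt (Ioi_mem_nhds ht)).differentiableAt (by norm_num)).hasDerivAt

lemma nonneg {t : ℝ} (ht : 0 ≤ t) : 0 ≤ G t := by
  have := h.monotone (mem_Ici.2 le_rfl) (mem_Ici.2 ht) ht
  rwa [h.zero] at this

lemma deriv_pos {t : ℝ} (ht : 0 < t) : 0 < deriv G t := by
  have h0 : 0 ≤ deriv G t := by
    rw [← derivWithin_of_isOpen isOpen_Ioi (mem_Ioi.2 ht)]
    exact (h.monotone.mono Ioi_subset_Ici_self).derivWithin_nonneg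
  have h1 := h.index_lower t ht
  have h2 : 0 < 1 / s := by have := h.one_le_index; positivity
  rcases h0.lt_or_eq with h3 | h3
  · exact h3
  -- If `G'(t) = 0`, the quotient in the index condition is `0` by the convention for division,
  -- contradicting the positive lower bound `1 / s`.
  · rw [← h3, div_zero] at h1; linarith

lemma lower_deriv {t : ℝ} (ht : 0 < t) : deriv G t / s ≤ deriv (deriv G) t * t := by
  have h1 := h.index_lower t ht
  rw [le_div_iff₀ (h.deriv_pos ht)] at h1
  calc _ = 1 / s * deriv G t := by ring
    _ ≤ _ := h1

lemma upper_deriv {t : ℝ} (ht : 0 < t) : deriv (deriv G) t * t ≤ s * deriv G t := by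
  have h1 := h.index_upper t ht
  rwa [div_le_iff₀ (h.deriv_pos ht)] at h1

lemma continuousOn : ContinuousOn G (Ici 0) := h.contDiff_one.continuousOn

lemma tendsto_zero : Tendsto G (𝓝[>] 0) (𝓝 0) := by
  have := (h.continuousOn 0 self_mem_Ici).mono_left (nhdsWithin_mono 0 Ioi_subset_Ici_self)
  rwa [h.zero] at this

/-- By convexity the tangent slope at `t` is at most the chord slope on `[t, 2t]`. This forces
`G'(t) t → 0` at the origin, the boundary value needed to integrate the index condition from `0`. -/
lemma deriv_mul_le {t : ℝ} (ht : 0 < t) : deriv G t * t ≤ G (2 * t) := by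
  have h1 : deriv G t ≤ slope G t (2 * t) :=
    h.convex.le_slope_of_hasDerivAt (mem_Ici.2 ht.le) (mem_Ici.2 (by linarith)) (by linarith)
      (h.hasDerivAt ht)
  rw [slope_def_field, le_div_iff₀ (by linarith)] at h1
  have := h.nonneg ht.le
  nlinarith

lemma tendsto_deriv_mul : Tendsto (fun t => deriv G t * t) (𝓝[>] 0) (𝓝 0) := by
  have h1 : Tendsto (fun t => G (2 * t)) (𝓝[>] 0) (𝓝 0) := by
    refine h.tendsto_zero.comp ?_
    refine tendsto_nhdsWithin_iff.2 ⟨?_, ?_⟩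
    · have : Tendsto (fun t : ℝ => 2 * t) (𝓝 0) (𝓝 (2 * 0)) := (continuous_const.mul continuous_id).tendsto 0
      rw [mul_zero] at this
      exact this.mono_left nhdsWithin_le_nhds
    · filter_upwards [self_mem_nhdsWithin] with t ht
      exact mul_pos two_pos (mem_Ioi.1 ht)
  refine squeeze_zero' ?_ ?_ h1
  · filter_upwards [self_mem_nhdsWithin] with t ht
    exact mul_nonneg (h.deriv_pos ht).le (le_of_lt ht)
  · filter_upwards [self_mem_nhdsWithin] with t ht
    exact h.deriv_mul_le ht

omit h in
lemma nonneg_of_deriv_nonneg {f f' : ℝ → ℝ} (hf : ∀ t, 0 < t → HasDerivAt f (f' t) t)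
    (hf' : ∀ t, 0 < t → 0 ≤ f' t) (h0 : Tendsto f (𝓝[>] 0) (𝓝 0)) {t : ℝ} (ht : 0 < t) :
    0 ≤ f t := by
  have hm : MonotoneOn f (Ioi 0) := by
    refine monotoneOn_of_deriv_nonneg (convex_Ioi 0)
      (fun x hx => (hf x hx).continuousAt.continuousWithinAt) ?_ ?_
    · intro x hx
      rw [interior_Ioi] at hx
      exact (hf x hx).differentiableAt.differentiableWithinAt
    · intro x hx
      rw [interior_Ioi] at hx
      rw [(hf x hx).deriv]; exact hf' x hx
  refine le_of_tendsto h0 ?_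
  filter_upwards [Ioo_mem_nhdsGT ht] with x hx
  exact hm hx.1 ht hx.2.le

/-- The difference of the two sides vanishes at `0+` and has derivative `t G'' - G' / s`, which the
index condition makes nonnegative. `upper_log` is the mirror image. -/
lemma lower_log {t : ℝ} (ht : 0 < t) : (1 + 1 / s) * G t ≤ deriv G t * t := by
  have key : 0 ≤ deriv G t * t - (1 + 1 / s) * G t := by
    refine nonneg_of_deriv_nonneg (f := fun t => deriv G t * t - (1 + 1 / s) * G t)
      (f' := fun t => (deriv (deriv G) t * t + deriv G t * 1) - (1 + 1 / s) * deriv G t) ?_ ?_ ?_ ht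
    · intro t ht
      exact ((h.hasDerivAt_deriv ht).mul (hasDerivAt_id t)).sub ((h.hasDerivAt ht).const_mul _)
    · intro t ht
      have := h.lower_deriv ht
      have e : deriv G t / s = 1 / s * deriv G t := by ring
      rw [e] at this
      nlinarith
    · have := h.tendsto_deriv_mul.sub (h.tendsto_zero.const_mul (1 + 1 / s))
      simpa using this
  linarith

lemma upper_log {t : ℝ} (ht : 0 < t) : deriv G t * t ≤ (1 + s) * G t := by
  have key : 0 ≤ (1 + s) * G t - deriv G t * t := by
    refine nonneg_of_deriv_nonneg (f := fun t => (1 + s) * G t - deriv G t * t)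
      (f' := fun t => (1 + s) * deriv G t - (deriv (deriv G) t * t + deriv G t * 1)) ?_ ?_ ?_ ht
    · intro t ht
      exact ((h.hasDerivAt ht).const_mul _).sub ((h.hasDerivAt_deriv ht).mul (hasDerivAt_id t))
    · intro t ht
      have := h.upper_deriv ht
      nlinarith
    · have := (h.tendsto_zero.const_mul (1 + s)).sub h.tendsto_deriv_mul
      simpa using this
  linarith

/-- The bounds on `t G' / G` say that `l ↦ G(l t) l^(-(1 + 1/s))` is nondecreasing and `l ↦ G(l t)
l^(-(1 + s))` is nonincreasing; each is compared with its value at `l = 1`. -/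
lemma powerGrowth : PowerGrowth G s where
  one_le := h.one_le_index
  mono := h.monotone
  cont := h.continuousOn
  zero := h.zero
  pos := by
    intro t ht
    have := h.upper_log ht
    have h1 := mul_pos (h.deriv_pos ht) ht
    have h2 := h.one_le_index
    by_contra hc
    nlinarith
  lower := by
    intro l t hl ht
    rcases ht.eq_or_lt with rfl | ht
    · simp [h.zero]
    have hm : MonotoneOn (fun l => G (l * t) * l ^ (-(1 + 1 / s))) (Ioi 0) := by
      have hd : ∀ l, 0 < l → HasDerivAt (fun l => G (l * t) * l ^ (-(1 + 1 / s)))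
          ((deriv G (l * t) * t) * l ^ (-(1 + 1 / s)) +
            G (l * t) * (-(1 + 1 / s) * l ^ (-(1 + 1 / s) - 1))) l := by
        intro l hl
        refine HasDerivAt.mul ?_ (Real.hasDerivAt_rpow_const (Or.inl hl.ne'))
        have := (h.hasDerivAt (mul_pos hl ht)).comp l ((hasDerivAt_id l).mul_const t)
        simpa [Function.comp_def] using this
      refine monotoneOn_of_deriv_nonneg (convex_Ioi 0)
        (fun x hx => (hd x hx).continuousAt.continuousWithinAt) ?_ ?_
      · intro x hx
        rw [interior_Ioi] at hx
        exact (hd x hx).differentiableAt.differentiableWithinAt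
      · intro x hx
        rw [interior_Ioi] at hx
        rw [(hd x hx).deriv, Real.rpow_sub_one (ne_of_gt hx)]
        have h1 := h.lower_log (mul_pos hx ht)
        have h2 : 0 ≤ x ^ (-(1 + 1 / s)) / x := by
          have : 0 < x := hx
          positivity
        have e : deriv G (x * t) * t * x ^ (-(1 + 1 / s)) + G (x * t) * (-(1 + 1 / s) *
          (x ^ (-(1 + 1 / s)) / x)) = (deriv G (x * t) * (x * t) - (1 + 1 / s) * G (x * t)) *
            (x ^ (-(1 + 1 / s)) / x) := by
          have : x ≠ 0 := ne_of_gt hx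
          field_simp
          ring
        rw [e]
        exact mul_nonneg (by linarith) h2
    have := hm (mem_Ioi.2 one_pos) (mem_Ioi.2 (by linarith)) hl
    simp only [one_mul, Real.one_rpow, mul_one] at this
    have hl0 : 0 < l := by linarith
    rw [Real.rpow_neg hl0.le, ← div_eq_mul_inv, le_div_iff₀ (by positivity)] at this
    linarith
  upper := by
    intro l t hl ht
    rcases ht.eq_or_lt with rfl | ht
    · simp [h.zero]
    have hm : AntitoneOn (fun l => G (l * t) * l ^ (-(1 + s))) (Ioi 0) := by
      have hd : ∀ l, 0 < l → HasDerivAt (fun l => G (l * t) * l ^ (-(1 + s)))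
          ((deriv G (l * t) * t) * l ^ (-(1 + s)) +
            G (l * t) * (-(1 + s) * l ^ (-(1 + s) - 1))) l := by
        intro l hl
        refine HasDerivAt.mul ?_ (Real.hasDerivAt_rpow_const (Or.inl hl.ne'))
        have := (h.hasDerivAt (mul_pos hl ht)).comp l ((hasDerivAt_id l).mul_const t)
        simpa [Function.comp_def] using this
      refine antitoneOn_of_deriv_nonpos (convex_Ioi 0)
        (fun x hx => (hd x hx).continuousAt.continuousWithinAt) ?_ ?_
      · intro x hx
        rw [interior_Ioi] at hx
        exact (hd x hx).differentiableAt.differentiableWithinAt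
      · intro x hx
        rw [interior_Ioi] at hx
        rw [(hd x hx).deriv, Real.rpow_sub_one (ne_of_gt hx)]
        have h1 := h.upper_log (mul_pos hx ht)
        have h2 : 0 ≤ x ^ (-(1 + s)) / x := by
          have : 0 < x := hx
          positivity
        have e : deriv G (x * t) * t * x ^ (-(1 + s)) + G (x * t) * (-(1 + s) *
          (x ^ (-(1 + s)) / x)) = -(((1 + s) * G (x * t) - deriv G (x * t) * (x * t)) *
            (x ^ (-(1 + s)) / x)) := by
          have : x ≠ 0 := ne_of_gt hx
          field_simp
          ring
        rw [e]
        exact neg_nonpos.2 (mul_nonneg (by linarith) h2)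
    have := hm (mem_Ioi.2 one_pos) (mem_Ioi.2 (by linarith)) hl
    simp only [one_mul, Real.one_rpow, mul_one] at this
    have hl0 : 0 < l := by linarith
    rw [Real.rpow_neg hl0.le, ← div_eq_mul_inv, div_le_iff₀ (by positivity)] at this
    linarith

end OrliczMultiPhase.IsNFunction

namespace PowerGrowth

variable {A : ℝ → ℝ} {s : ℝ}

lemma nonneg (h : PowerGrowth A s) {t : ℝ} (ht : 0 ≤ t) : 0 ≤ A t := by
  rcases ht.eq_or_lt with rfl | ht
  · exact h.zero.ge
  · exact (h.pos t ht).le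

lemma le_of_le (h : PowerGrowth A s) {t r : ℝ} (ht : 0 ≤ t) (htr : t ≤ r) : A t ≤ A r :=
  h.mono (mem_Ici.2 ht) (mem_Ici.2 (ht.trans htr)) htr

lemma of_le (h : PowerGrowth A s) {s' : ℝ} (hs : s ≤ s') : PowerGrowth A s' where
  one_le := h.one_le.trans hs
  mono := h.mono
  cont := h.cont
  zero := h.zero
  pos := h.pos
  lower := fun l t hl ht => by
    refine le_trans ?_ (h.lower l t hl ht)
    have := h.one_le
    have : 1 / s' ≤ 1 / s := one_div_le_one_div_of_le (by linarith) hs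
    exact mul_le_mul_of_nonneg_right (Real.rpow_le_rpow_of_exponent_le hl (by linarith))
      (h.nonneg ht)
  upper := fun l t hl ht => by
    refine (h.upper l t hl ht).trans ?_
    exact mul_le_mul_of_nonneg_right (Real.rpow_le_rpow_of_exponent_le hl (by linarith))
      (h.nonneg ht)

/-- Growth bounds with a common index survive nonnegative combinations. Hence constants for `Ψ(x,
·)` and its frozen versions do not depend on the values of the coefficients. -/
lemma add_const_mul (h : PowerGrowth A s) {B : ℝ → ℝ} (hB : PowerGrowth B s) {c : ℝ}
    (hc : 0 ≤ c) : PowerGrowth (fun t => A t + c * B t) s where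
  one_le := h.one_le
  mono := fun x hx y hy hxy => add_le_add (h.mono hx hy hxy)
    (mul_le_mul_of_nonneg_left (hB.mono hx hy hxy) hc)
  cont := h.cont.add (continuousOn_const.mul hB.cont)
  zero := by simp [h.zero, hB.zero]
  pos := fun t ht => add_pos_of_pos_of_nonneg (h.pos t ht) (mul_nonneg hc (hB.nonneg ht.le))
  lower := fun l t hl ht => by
    have h1 := h.lower l t hl ht
    have h2 := mul_le_mul_of_nonneg_left (hB.lower l t hl ht) hc
    linarith
  upper := fun l t hl ht => by
    have h1 := h.upper l t hl ht
    have h2 := mul_le_mul_of_nonneg_left (hB.upper l t hl ht) hc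
    linarith

lemma add_le (h : PowerGrowth A s) {t r : ℝ} (ht : 0 ≤ t) (hr : 0 ≤ r) :
    A (t + r) ≤ 2 ^ (1 + s) * (A t + A r) := by
  have key : A (t + r) ≤ 2 ^ (1 + s) * A (max t r) := by
    refine le_trans ?_ (h.upper 2 (max t r) one_le_two (le_max_of_le_left ht))
    exact h.le_of_le (by positivity) (by linarith [le_max_left t r, le_max_right t r])
  refine key.trans ?_
  gcongr
  rcases max_cases t r with h1 | h1
  · rw [h1.1]; linarith [h.nonneg hr]
  · rw [h1.1]; linarith [h.nonneg ht]

end PowerGrowth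

namespace OrliczMultiPhase.Setting

variable {n : ℕ} (S : Setting n)

/-- A common index for the three Young functions. -/
noncomputable def index : ℝ := max S.sG (max S.sHa S.sHb)

/-- The `x`-independent Young function `G + α H_a + β H_b`. -/
noncomputable def frozenPsi (α β t : ℝ) : ℝ := S.G t + α * S.Ha t + β * S.Hb t

lemma powerGrowth_frozenPsi {α β : ℝ} (hα : 0 ≤ α) (hβ : 0 ≤ β) :
    PowerGrowth (S.frozenPsi α β) S.index := by
  have h1 := S.hG.powerGrowth.of_le (le_max_left S.sG (max S.sHa S.sHb))
  have h2 := S.hHa.powerGrowth.of_le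
    ((le_max_left S.sHa S.sHb).trans (le_max_right S.sG (max S.sHa S.sHb)))
  have h3 := S.hHb.powerGrowth.of_le
    ((le_max_right S.sHa S.sHb).trans (le_max_right S.sG (max S.sHa S.sHb)))
  exact (h1.add_const_mul h2 hα).add_const_mul h3 hβ

lemma powerGrowth_Psi {x : EuclideanSpace ℝ (Fin n)} (hx : x ∈ S.Ω) :
    PowerGrowth (S.Psi x) S.index :=
  S.powerGrowth_frozenPsi (S.a_nonneg x hx) (S.b_nonneg x hx)

end OrliczMultiPhase.Setting

/-! ### Jensen's inequality without convexity. -/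

/-- A Jensen-type inequality for functions with nondecreasing slope. -/
lemma jensen_of_slope_mono {α : Type*} [MeasurableSpace α] {μ : Measure α} {M c m : ℝ}
    (hM : 0 < M) (hμ : μ univ ≤ ENNReal.ofReal M) {φ : ℝ → ℝ}
    (hzero : φ 0 = 0) (hpos : ∀ t, 0 < t → 0 < φ t)
    (hslope : ∀ l t, 1 ≤ l → 0 ≤ t → l * φ t ≤ φ (l * t)) {f : α → ℝ} (hf : ∀ x, 0 ≤ f x)
    (hm : 0 ≤ m) (hc : 0 < c)
    (h : ENNReal.ofReal m ≤ ENNReal.ofReal c * ∫⁻ x, ENNReal.ofReal (f x) ∂μ) :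
    ENNReal.ofReal (M * φ (m / (2 * c * M))) ≤ ∫⁻ x, ENNReal.ofReal (φ (f x)) ∂μ := by
  rcases hm.eq_or_lt with rfl | hm
  · simp [hzero]
  have hnn : ∀ t, 0 ≤ t → 0 ≤ φ t := fun t ht => by
    rcases ht.eq_or_lt with rfl | ht
    · exact hzero.ge
    · exact (hpos t ht).le
  -- At this level `c * s * M = m / 2`: the part of `f` below `s` accounts for at most half of `m`
  -- and is absorbed. Above `s`, monotone slope gives `f ≤ (s / φ s) φ(f)`.
  set s := m / (2 * c * M) with hs
  have hs0 : 0 < s := by positivity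
  have hφs := hpos s hs0
  have hpt : ∀ x, f x ≤ s + s / φ s * φ (f x) := by
    intro x
    rcases le_total (f x) s with h1 | h1
    · have := hnn _ (hf x)
      have : 0 ≤ s / φ s * φ (f x) := by positivity
      linarith
    · have h2 := hslope (f x / s) s ((one_le_div hs0).2 h1) hs0.le
      rw [div_mul_cancel₀ _ hs0.ne'] at h2
      have : f x ≤ s / φ s * φ (f x) := by
        rw [div_mul_eq_mul_div, le_div_iff₀ hφs]
        rw [div_mul_eq_mul_div, div_le_iff₀ hs0] at h2
        linarith
      linarith
  set I := ∫⁻ x, ENNReal.ofReal (φ (f x)) ∂μ with hI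
  by_cases hItop : I = ∞
  · rw [hItop]; exact le_top
  have h1 : ∫⁻ x, ENNReal.ofReal (f x) ∂μ ≤
      ENNReal.ofReal s * ENNReal.ofReal M + ENNReal.ofReal (s / φ s) * I := by
    calc ∫⁻ x, ENNReal.ofReal (f x) ∂μ
        ≤ ∫⁻ x, (ENNReal.ofReal s + ENNReal.ofReal (s / φ s) * ENNReal.ofReal (φ (f x))) ∂μ := by
          refine lintegral_mono fun x => ?_
          rw [← ENNReal.ofReal_mul (by positivity), ← ENNReal.ofReal_add hs0.le
            (mul_nonneg (by positivity) (hnn _ (hf x)))]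
          exact ENNReal.ofReal_le_ofReal (hpt x)
      _ = ENNReal.ofReal s * μ univ + ENNReal.ofReal (s / φ s) * I := by
          rw [lintegral_add_left measurable_const, lintegral_const,
            lintegral_const_mul' _ _ ENNReal.ofReal_ne_top]
      _ ≤ _ := by gcongr
  have h2 := h.trans (mul_le_mul_right h1 _)
  lift I to NNReal using hItop with J hJ
  have h3 : m ≤ c * (s * M + s / φ s * J) := by
    rw [← ENNReal.ofReal_coe_nnreal, ← ENNReal.ofReal_mul hs0.le,
      ← ENNReal.ofReal_mul (by positivity), ← ENNReal.ofReal_add (by positivity) (by positivity),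
      ← ENNReal.ofReal_mul hc.le] at h2
    exact (ENNReal.ofReal_le_ofReal_iff (by positivity)).1 h2
  rw [← ENNReal.ofReal_coe_nnreal]
  refine ENNReal.ofReal_le_ofReal ?_
  have e : m = 2 * (c * (s * M)) := by rw [hs]; field_simp
  have h4 : c * (s * M) ≤ c * (s / φ s * J) := by linarith
  have h5 := le_of_mul_le_mul_left h4 hc
  rw [mul_comm (s / φ s), ← mul_div_assoc, le_div_iff₀ hφs] at h5
  have h6 : s * (M * φ s) ≤ s * J := by linarith
  exact le_of_mul_le_mul_left h6 hs0

namespace PowerGrowth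

variable {A : ℝ → ℝ} {s : ℝ}

/-- `A^θ` need not be convex, but `θ (1 + 1/s) ≥ 1` makes its slope nondecreasing, which is enough.
The upper growth bound then replaces the argument `m / (2cM)` by `m`. -/
lemma jensen (h : PowerGrowth A s) {α : Type*} [MeasurableSpace α] {μ : Measure α}
    {M c m θ : ℝ} (hM : 1 ≤ M) (hμ : μ univ ≤ ENNReal.ofReal M) (hc : 1 ≤ c)
    (hθ : 1 ≤ θ * (1 + 1 / s)) (hθ1 : θ ≤ 1) {f : α → ℝ} (hf : ∀ x, 0 ≤ f x) (hm : 0 ≤ m)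
    (hmf : ENNReal.ofReal m ≤ ENNReal.ofReal c * ∫⁻ x, ENNReal.ofReal (f x) ∂μ) :
    ENNReal.ofReal (A m ^ θ) ≤
      ENNReal.ofReal ((2 * c * M) ^ (1 + s)) * ∫⁻ x, ENNReal.ofReal (A (f x) ^ θ) ∂μ := by
  have hs := h.one_le
  have hθ0 : 0 < θ := by
    have : 0 < 1 + 1 / s := by positivity
    by_contra hc
    nlinarith
  have key := jensen_of_slope_mono (φ := fun t => A t ^ θ) (by linarith) hμ
    (by simp [h.zero, hθ0.ne']) (fun t ht => Real.rpow_pos_of_pos (h.pos t ht) _)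
    (by
      intro l t hl ht
      have h1 := h.lower l t hl ht
      have h2 : (l ^ (1 + 1 / s) * A t) ^ θ ≤ A (l * t) ^ θ :=
        Real.rpow_le_rpow (mul_nonneg (by positivity) (h.nonneg ht)) h1 hθ0.le
      refine le_trans ?_ h2
      rw [Real.mul_rpow (by positivity) (h.nonneg ht), ← Real.rpow_mul (by linarith)]
      refine mul_le_mul_of_nonneg_right ?_ (Real.rpow_nonneg (h.nonneg ht) _)
      exact Real.self_le_rpow_of_one_le hl (by linarith)) hf hm (by linarith) hmf
  have hl : 1 ≤ 2 * c * M := by nlinarith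
  have h1 : A m ^ θ ≤ (2 * c * M) ^ (1 + s) * (M * A (m / (2 * c * M)) ^ θ) := by
    have h2 := h.upper (2 * c * M) (m / (2 * c * M)) hl (by positivity)
    rw [mul_div_cancel₀ _ (by positivity)] at h2
    have h3 := Real.rpow_le_rpow (h.nonneg hm) h2 hθ0.le
    have hA := h.nonneg (t := m / (2 * c * M)) (by positivity)
    rw [Real.mul_rpow (by positivity) hA, ← Real.rpow_mul (by linarith)] at h3
    have h4 : (2 * c * M) ^ ((1 + s) * θ) ≤ (2 * c * M) ^ (1 + s) :=
      Real.rpow_le_rpow_of_exponent_le hl (by nlinarith)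
    have h5 : 0 ≤ A (m / (2 * c * M)) ^ θ := Real.rpow_nonneg hA _
    have h6 : A (m / (2 * c * M)) ^ θ ≤ M * A (m / (2 * c * M)) ^ θ := by nlinarith
    calc _ ≤ _ := h3
      _ ≤ _ := mul_le_mul h4 h6 h5 (by positivity)
  calc _ ≤ _ := ENNReal.ofReal_le_ofReal h1
    _ = _ := ENNReal.ofReal_mul (by positivity)
    _ ≤ _ := mul_le_mul_right key _

end PowerGrowth

/-! ### Integrals of the Riesz kernels. -/

/-- The volume of the unit ball of `ℝⁿ`. -/
noncomputable def unitBallVolume (n : ℕ) : ℝ :=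
  volume.real (Metric.ball (0 : EuclideanSpace ℝ (Fin n)) 1)

section Riesz

variable {n : ℕ}

lemma unitBallVolume_pos : 0 < unitBallVolume n :=
  ENNReal.toReal_pos (Metric.measure_ball_pos _ _ one_pos).ne' measure_ball_lt_top.ne

lemma volume_closedBall_eq (x : EuclideanSpace ℝ (Fin n)) {r : ℝ} (hr : 0 ≤ r) :
    volume (Metric.closedBall x r) = ENNReal.ofReal (r ^ n * unitBallVolume n) := by
  rw [Measure.addHaar_closedBall volume x hr, finrank_euclideanSpace_fin,
    ENNReal.ofReal_mul (by positivity), unitBallVolume, measureReal_def,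
    ENNReal.ofReal_toReal measure_ball_lt_top.ne]

lemma volume_ball_eq (x : EuclideanSpace ℝ (Fin n)) {r : ℝ} (hr : 0 < r) :
    volume (Metric.ball x r) = ENNReal.ofReal (r ^ n * unitBallVolume n) := by
  rw [Measure.addHaar_ball_of_pos volume x hr, finrank_euclideanSpace_fin,
    ENNReal.ofReal_mul (by positivity), unitBallVolume, measureReal_def,
    ENNReal.ofReal_toReal measure_ball_lt_top.ne]

/-- The Riesz-type kernel `|x|^{-β}`. -/
noncomputable def powerKernel (β : ℝ) (x : EuclideanSpace ℝ (Fin n)) : ℝ≥0∞ :=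
  ENNReal.ofReal (‖x‖ ^ (-β))

lemma measurable_powerKernel (β : ℝ) : Measurable (powerKernel (n := n) β) :=
  ENNReal.measurable_ofReal.comp (measurable_norm.pow_const _)

lemma powerKernel_neg (β : ℝ) (x : EuclideanSpace ℝ (Fin n)) :
    powerKernel β (-x) = powerKernel β x := by simp [powerKernel]

lemma powerKernel_le {β ρ : ℝ} (hβ : 0 ≤ β) (hρ : 0 < ρ) {x : EuclideanSpace ℝ (Fin n)}
    (hx : ρ ≤ ‖x‖) : powerKernel β x ≤ ENNReal.ofReal (ρ ^ (-β)) :=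
  ENNReal.ofReal_le_ofReal (Real.rpow_le_rpow_of_nonpos hρ hx (by linarith))

/-- On the dyadic annulus of radii about `ρ / 2^k` the kernel is essentially constant, and the
contributions form a geometric series of ratio `2^(-(n - β)) < 1`. -/
lemma exists_lintegral_powerKernel_center_le (hn : 1 ≤ n) {β : ℝ} (hβ : 0 ≤ β) (hβn : β < n) :
    ∃ C : ℝ, 0 ≤ C ∧ ∀ (y : EuclideanSpace ℝ (Fin n)) (ρ : ℝ), 0 < ρ →
      ∫⁻ x in Metric.closedBall y ρ, powerKernel β (x - y) ≤ ENNReal.ofReal (C * ρ ^ (n - β)) := by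
  have : Nonempty (Fin n) := ⟨⟨0, hn⟩⟩
  set q : ℝ := (1 / 2) ^ ((n : ℝ) - β) with hq
  have hq0 : 0 < q := by positivity
  have hq1 : q < 1 := Real.rpow_lt_one (by norm_num) (by norm_num) (by linarith)
  have hV := unitBallVolume_pos (n := n)
  refine ⟨2 ^ β * unitBallVolume n * (1 - q)⁻¹,
    mul_nonneg (by positivity) (inv_nonneg.2 (by linarith)), fun y ρ hρ => ?_⟩
  set A : ℕ → Set (EuclideanSpace ℝ (Fin n)) := fun k =>
    Metric.closedBall y (ρ * (1 / 2) ^ k) \ Metric.closedBall y (ρ * (1 / 2) ^ (k + 1)) with hA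
  have hsub : Metric.closedBall y ρ ⊆ {y} ∪ ⋃ k, A k := by
    intro x hx
    by_cases hxy : x = y
    · exact Or.inl hxy
    right
    have hd : 0 < dist x y := dist_pos.2 hxy
    have hex : ∃ k : ℕ, ρ * (1 / 2) ^ k < dist x y := by
      obtain ⟨k, hk⟩ := exists_pow_lt_of_lt_one (div_pos hd hρ) (by norm_num : (1 / 2 : ℝ) < 1)
      exact ⟨k, by rwa [lt_div_iff₀ hρ, mul_comm] at hk⟩
    classical
    have h1 := Nat.find_spec hex
    have h2 : Nat.find hex ≠ 0 := by
      intro h0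
      rw [h0] at h1
      simp only [pow_zero, mul_one] at h1
      exact absurd (Metric.mem_closedBall.1 hx) (not_le.2 h1)
    obtain ⟨k, hk⟩ := Nat.exists_eq_succ_of_ne_zero h2
    have h3 := Nat.find_min hex (m := k) (by omega)
    rw [hk] at h1
    refine mem_iUnion.2 ⟨k, ?_, ?_⟩
    · exact Metric.mem_closedBall.2 (not_lt.1 h3)
    · exact fun hc => absurd (Metric.mem_closedBall.1 hc) (not_le.2 h1)
  have hterm : ∀ k, ∫⁻ x in A k, powerKernel β (x - y) ≤
      ENNReal.ofReal (2 ^ β * unitBallVolume n * ρ ^ (n - β) * q ^ k) := by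
    intro k
    have hr : 0 < ρ * (1 / 2) ^ (k + 1) := by positivity
    calc ∫⁻ x in A k, powerKernel β (x - y)
        ≤ ∫⁻ x in A k, ENNReal.ofReal ((ρ * (1 / 2) ^ (k + 1)) ^ (-β)) := by
          refine setLIntegral_mono measurable_const fun x hx => powerKernel_le hβ hr ?_
          have := hx.2
          rw [Metric.mem_closedBall, not_le, dist_eq_norm] at this
          exact this.le
      _ = ENNReal.ofReal ((ρ * (1 / 2) ^ (k + 1)) ^ (-β)) * volume (A k) := setLIntegral_const _ _
      _ ≤ ENNReal.ofReal ((ρ * (1 / 2) ^ (k + 1)) ^ (-β)) *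
          ENNReal.ofReal ((ρ * (1 / 2) ^ k) ^ n * unitBallVolume n) := by
          rw [← volume_closedBall_eq y (by positivity)]
          exact mul_le_mul_right (measure_mono sdiff_subset) _
      _ = _ := by
          rw [← ENNReal.ofReal_mul (by positivity)]
          congr 1
          have e1 : (ρ * (1 / 2) ^ (k + 1)) ^ (-β) = 2 ^ β * (ρ * (1 / 2) ^ k) ^ (-β) := by
            rw [pow_succ, ← mul_assoc, Real.mul_rpow (by positivity) (by norm_num), mul_comm]
            congr 1
            rw [one_div, Real.inv_rpow (by norm_num), Real.rpow_neg (by norm_num), inv_inv]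
          have e2 : (ρ * (1 / 2) ^ k) ^ (-β) * (ρ * (1 / 2) ^ k) ^ n = ρ ^ (n - β) * q ^ k := by
            rw [← Real.rpow_natCast (ρ * (1 / 2) ^ k) n, ← Real.rpow_add (by positivity),
              Real.mul_rpow hρ.le (by positivity), hq, ← Real.rpow_natCast, ← Real.rpow_natCast,
              ← Real.rpow_mul (by norm_num), ← Real.rpow_mul (by norm_num)]
            congr 2 <;> ring
          rw [e1]
          linear_combination (2 ^ β * unitBallVolume n) * e2
  have hsum : ∑' k : ℕ, ENNReal.ofReal (2 ^ β * unitBallVolume n * ρ ^ (n - β) * q ^ k) =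
      ENNReal.ofReal (2 ^ β * unitBallVolume n * (1 - q)⁻¹ * ρ ^ (n - β)) := by
    rw [← ENNReal.ofReal_tsum_of_nonneg (fun k => by positivity)
      ((summable_geometric_of_lt_one hq0.le hq1).mul_left _), tsum_mul_left,
      tsum_geometric_of_lt_one hq0.le hq1]
    congr 1; ring
  calc ∫⁻ x in Metric.closedBall y ρ, powerKernel β (x - y)
      ≤ ∫⁻ x in {y} ∪ ⋃ k, A k, powerKernel β (x - y) := lintegral_mono_set hsub
    _ ≤ (∫⁻ x in {y}, powerKernel β (x - y)) + ∫⁻ x in ⋃ k, A k, powerKernel β (x - y) :=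
        lintegral_union_le _ _ _
    _ = ∫⁻ x in ⋃ k, A k, powerKernel β (x - y) := by
        rw [Measure.restrict_singleton, measure_singleton]; simp
    _ ≤ ∑' k, ∫⁻ x in A k, powerKernel β (x - y) := lintegral_iUnion_le _ _
    _ ≤ _ := (ENNReal.tsum_le_tsum hterm).trans hsum.le

/-- The pole `y` is arbitrary: within distance `ρ` of `y` the centred estimate applies, and
elsewhere the kernel is at most `ρ^(-β)`. -/
lemma exists_lintegral_powerKernel_le (hn : 1 ≤ n) {β : ℝ} (hβ : 0 ≤ β) (hβn : β < n) :
    ∃ C : ℝ, 1 ≤ C ∧ ∀ (x₀ y : EuclideanSpace ℝ (Fin n)) (ρ : ℝ), 0 < ρ →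
      ∫⁻ x in Metric.closedBall x₀ ρ, powerKernel β (x - y) ≤
        ENNReal.ofReal (C * ρ ^ (n - β)) := by
  obtain ⟨C, hC, h⟩ := exists_lintegral_powerKernel_center_le hn hβ hβn
  have hV := unitBallVolume_pos (n := n)
  refine ⟨1 + C + unitBallVolume n, by linarith, fun x₀ y ρ hρ => ?_⟩
  calc ∫⁻ x in Metric.closedBall x₀ ρ, powerKernel β (x - y)
      ≤ ∫⁻ x in Metric.closedBall y ρ ∪ (Metric.closedBall x₀ ρ \ Metric.closedBall y ρ),
          powerKernel β (x - y) := lintegral_mono_set (by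
            intro x hx; by_cases h : x ∈ Metric.closedBall y ρ
            · exact Or.inl h
            · exact Or.inr ⟨hx, h⟩)
    _ ≤ _ := lintegral_union_le _ _ _
    _ ≤ ENNReal.ofReal (C * ρ ^ (n - β)) + ∫⁻ x in Metric.closedBall x₀ ρ \ Metric.closedBall y ρ,
          ENNReal.ofReal (ρ ^ (-β)) := by
        refine add_le_add (h y ρ hρ) ?_
        refine setLIntegral_mono measurable_const fun x hx => powerKernel_le hβ hρ ?_
        have := hx.2
        rw [Metric.mem_closedBall, not_le, dist_eq_norm] at this
        exact this.le
    _ ≤ ENNReal.ofReal (C * ρ ^ (n - β)) +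
          ENNReal.ofReal (ρ ^ (-β)) * ENNReal.ofReal (ρ ^ n * unitBallVolume n) := by
        rw [setLIntegral_const, ← volume_closedBall_eq x₀ hρ.le]
        gcongr
        exact sdiff_subset
    _ ≤ _ := by
        rw [← ENNReal.ofReal_mul (by positivity), ← ENNReal.ofReal_add (by positivity) (by positivity)]
        refine ENNReal.ofReal_le_ofReal ?_
        have e : ρ ^ (-β) * ρ ^ n = ρ ^ (n - β) := by
          rw [← Real.rpow_natCast ρ n, ← Real.rpow_add hρ]; congr 1; ring
        have : 0 < ρ ^ ((n : ℝ) - β) := by positivity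
        nlinarith

/-- The mean of the kernel over a translated ball is controlled by its value. -/
lemma exists_lintegral_powerKernel_translate_le (hn : 1 ≤ n) {β : ℝ} (hβ : 0 ≤ β) (hβn : β < n) :
    ∃ C : ℝ, 1 ≤ C ∧ ∀ (x : EuclideanSpace ℝ (Fin n)) (ρ : ℝ), 0 < ρ → x ≠ 0 →
      ∫⁻ z in Metric.closedBall x ρ, powerKernel β z ≤
        ENNReal.ofReal (C * ρ ^ n) * powerKernel β x := by
  obtain ⟨C, hC, h⟩ := exists_lintegral_powerKernel_le hn hβ hβn
  have hV := unitBallVolume_pos (n := n)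
  have h2 : (0 : ℝ) < 2 ^ β := by positivity
  have hC2 : 1 ≤ C * 2 ^ β := by
    nlinarith [Real.one_le_rpow (one_le_two (α := ℝ)) hβ]
  refine ⟨C * 2 ^ β + unitBallVolume n * 2 ^ β, by nlinarith, fun x ρ hρ hx => ?_⟩
  have hx0 : 0 < ‖x‖ := norm_pos_iff.2 hx
  rw [powerKernel, ← ENNReal.ofReal_mul (by positivity)]
  -- If the origin is near the ball, the total mass `ρ^(n - β)` is already comparable to `ρ^n
  -- (2ρ)^(-β)`; if it is far, `‖z‖ ≥ ‖x‖ / 2` on the whole ball.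
  rcases le_total ‖x‖ (2 * ρ) with hxρ | hxρ
  · have := h x 0 ρ hρ
    simp only [sub_zero] at this
    refine this.trans (ENNReal.ofReal_le_ofReal ?_)
    have e : ρ ^ ((n : ℝ) - β) = 2 ^ β * ρ ^ n * (2 * ρ) ^ (-β) := by
      rw [Real.mul_rpow (by norm_num) hρ.le, Real.rpow_sub hρ, Real.rpow_neg hρ.le,
        Real.rpow_neg (by norm_num), Real.rpow_natCast]
      field_simp
    have e2 : (2 * ρ) ^ (-β) ≤ ‖x‖ ^ (-β) :=
      Real.rpow_le_rpow_of_nonpos hx0 hxρ (by linarith)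
    rw [e]
    have : 0 ≤ ‖x‖ ^ (-β) := by positivity
    calc C * (2 ^ β * ρ ^ n * (2 * ρ) ^ (-β)) ≤ C * (2 ^ β * ρ ^ n * ‖x‖ ^ (-β)) := by gcongr
      _ ≤ _ := by
        have : 0 ≤ unitBallVolume n * 2 ^ β * ρ ^ n * ‖x‖ ^ (-β) := by positivity
        nlinarith
  · calc ∫⁻ z in Metric.closedBall x ρ, powerKernel β z
        ≤ ∫⁻ z in Metric.closedBall x ρ, ENNReal.ofReal ((‖x‖ / 2) ^ (-β)) := by
          refine setLIntegral_mono measurable_const fun z hz => powerKernel_le hβ (by positivity) ?_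
          have h1 := Metric.mem_closedBall.1 hz
          rw [dist_comm, dist_eq_norm] at h1
          have := norm_sub_norm_le x z
          linarith
      _ = ENNReal.ofReal ((‖x‖ / 2) ^ (-β) * (ρ ^ n * unitBallVolume n)) := by
          rw [setLIntegral_const, volume_closedBall_eq x hρ.le, ← ENNReal.ofReal_mul (by positivity)]
      _ ≤ _ := by
          refine ENNReal.ofReal_le_ofReal ?_
          have e : (‖x‖ / 2) ^ (-β) = 2 ^ β * ‖x‖ ^ (-β) := by
            rw [Real.div_rpow hx0.le (by norm_num), Real.rpow_neg (by norm_num : (0:ℝ) ≤ 2)]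
            field_simp
          rw [e]
          have : 0 ≤ C * 2 ^ β * ρ ^ n * ‖x‖ ^ (-β) := by positivity
          nlinarith

end Riesz

/-! ### The potential estimate for `C¹` functions. -/

section ClassicalPotential

variable {n : ℕ}

lemma lintegral_comp_add_smul_sub {f : EuclideanSpace ℝ (Fin n) → ℝ≥0∞} (hf : Measurable f)
    (x : EuclideanSpace ℝ (Fin n)) {t : ℝ} (ht : 0 < t) :
    ∫⁻ y, f (x + t • (y - x)) = ENNReal.ofReal ((t ^ n)⁻¹) * ∫⁻ z, f z := by
  calc ∫⁻ y, f (x + t • (y - x)) = ∫⁻ y, f (x + t • y) :=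
        lintegral_sub_right_eq_self (μ := volume) (fun y => f (x + t • y)) x
    _ = ∫⁻ z, f (x + z) ∂(Measure.map (t • ·) volume) := by
        exact (lintegral_map (f := fun z => f (x + z)) (hf.comp (measurable_const_add x))
          (measurable_const_smul t)).symm
    _ = ENNReal.ofReal ((t ^ n)⁻¹) * ∫⁻ z, f (x + z) := by
        rw [Measure.map_addHaar_smul volume ht.ne', lintegral_smul_measure,
          finrank_euclideanSpace_fin, abs_of_pos (by positivity), smul_eq_mul]
    _ = _ := by rw [lintegral_add_left_eq_self (μ := volume) f x]

lemma lintegral_Ici_rpow_neg_le (hn : 1 ≤ n) {a : ℝ} (ha : 0 < a) :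
    ∫⁻ t in Ici a, ENNReal.ofReal ((t ^ (n + 1))⁻¹) ≤ ENNReal.ofReal ((a ^ n)⁻¹) := by
  have hn' : (1 : ℝ) ≤ n := by exact_mod_cast hn
  have e : ∀ t : ℝ, (t ^ (n + 1))⁻¹ = t ^ (-((n : ℝ) + 1)) ∨ t ≤ 0 := by
    intro t
    rcases le_or_gt t 0 with h | h
    · exact Or.inr h
    · left
      rw [Real.rpow_neg h.le]
      norm_cast
  rw [restrict_Ioi_eq_restrict_Ici.symm]
  have h1 : ∫⁻ t in Ioi a, ENNReal.ofReal ((t ^ (n + 1))⁻¹) =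
      ∫⁻ t in Ioi a, ENNReal.ofReal (t ^ (-((n : ℝ) + 1))) := by
    refine setLIntegral_congr_fun measurableSet_Ioi fun t ht => ?_
    rcases e t with h | h
    · rw [h]
    · exact absurd (ha.trans ht) (not_lt.2 h)
  rw [h1, ← ofReal_integral_eq_lintegral_ofReal
    (integrableOn_Ioi_rpow_of_lt (by linarith) ha)
    ((ae_restrict_iff' measurableSet_Ioi).2 (Eventually.of_forall fun t ht =>
      Real.rpow_nonneg (ha.trans ht).le _)),
    integral_Ioi_rpow_of_lt (by linarith) ha]
  refine ENNReal.ofReal_le_ofReal ?_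
  have e2 : a ^ (-((n : ℝ) + 1) + 1) = (a ^ n)⁻¹ := by
    rw [show -((n : ℝ) + 1) + 1 = -(n : ℝ) by ring, Real.rpow_neg ha.le, Real.rpow_natCast]
  rw [e2, show -((n : ℝ) + 1) + 1 = -(n : ℝ) by ring, neg_div_neg_eq]
  exact div_le_self (by positivity) hn'

lemma enorm_sub_le_lintegral_fderiv {w : EuclideanSpace ℝ (Fin n) → ℝ} (hw : ContDiff ℝ 1 w)
    (x y : EuclideanSpace ℝ (Fin n)) :
    ‖w x - w y‖ₑ ≤ ∫⁻ t in Ioc (0 : ℝ) 1, ‖fderiv ℝ w (x + t • (y - x))‖ₑ * ‖y - x‖ₑ := by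
  have hd : ∀ t : ℝ, HasDerivAt (fun t : ℝ => w (x + t • (y - x)))
      (fderiv ℝ w (x + t • (y - x)) (y - x)) t := by
    intro t
    have h1 : HasDerivAt (fun t : ℝ => x + t • (y - x)) (y - x) t := by
      simpa using ((hasDerivAt_id t).smul_const (y - x)).const_add x
    exact ((hw.differentiable (by norm_num)) _).hasFDerivAt.comp_hasDerivAt t h1
  have hcont : Continuous fun t : ℝ => fderiv ℝ w (x + t • (y - x)) (y - x) := by
    have := hw.continuous_fderiv (by norm_num)
    fun_prop
  have h2 := intervalIntegral.integral_eq_sub_of_hasDerivAt (a := 0) (b := 1)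
    (fun t _ => hd t) (hcont.intervalIntegrable _ _)
  simp only [one_smul, zero_smul, add_zero, add_sub_cancel] at h2
  rw [enorm_sub_rev, ← h2, intervalIntegral.integral_of_le zero_le_one]
  refine (enorm_integral_le_lintegral_enorm _).trans (lintegral_mono fun t => ?_)
  exact ContinuousLinearMap.le_opENorm _ _

/-- The Riesz potential estimate for oscillations of a `C¹` function on a ball. -/
lemma lintegral_enorm_sub_le_of_contDiff (hn : 1 ≤ n) {w : EuclideanSpace ℝ (Fin n) → ℝ}
    (hw : ContDiff ℝ 1 w) {x₀ x : EuclideanSpace ℝ (Fin n)} {R : ℝ} (hR : 0 < R)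
    (hx : x ∈ Metric.closedBall x₀ R) :
    ∫⁻ y in Metric.closedBall x₀ R, ‖w x - w y‖ₑ ≤ ENNReal.ofReal ((2 * R) ^ n) *
      ∫⁻ z in Metric.closedBall x₀ R, ‖fderiv ℝ w z‖ₑ * powerKernel (n - 1) (x - z) := by
  have hDw : Continuous (fderiv ℝ w) := hw.continuous_fderiv (by norm_num)
  set B := Metric.closedBall x₀ R with hB
  set g : EuclideanSpace ℝ (Fin n) → ℝ≥0∞ :=
    B.indicator (fun z => ‖fderiv ℝ w z‖ₑ * ‖z - x‖ₑ) with hg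
  have hgm : Measurable g := by
    refine Measurable.indicator ?_ Metric.isClosed_closedBall.measurableSet
    exact (hDw.enorm.measurable).mul ((continuous_id.sub continuous_const).enorm.measurable)
  set T : Set (ℝ × EuclideanSpace ℝ (Fin n)) := {p | ‖p.2 - x‖ ≤ 2 * R * p.1} with hT
  have hTm : MeasurableSet T := by
    refine IsClosed.measurableSet (isClosed_le ?_ ?_) <;> fun_prop
  -- With `z = x + t (y - x)` one has `|y - x| = |z - x| / t`, the origin of the factor `1 / t`; `T`
  -- records the constraint `|z - x| ≤ 2 R t`, inherited from `|y - x| ≤ 2R`.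
  set k : ℝ → EuclideanSpace ℝ (Fin n) → ℝ≥0∞ := fun t z =>
    g z * T.indicator (fun p => ENNReal.ofReal (p.1⁻¹)) (t, z) with hk
  have hkm : Measurable (Function.uncurry k) := by
    have h1 : Measurable fun p : ℝ × EuclideanSpace ℝ (Fin n) => ENNReal.ofReal (p.1⁻¹) :=
      ENNReal.measurable_ofReal.comp (measurable_fst.inv)
    have h2 : Measurable fun p : ℝ × EuclideanSpace ℝ (Fin n) =>
        g p.2 * T.indicator (fun p => ENNReal.ofReal (p.1⁻¹)) p :=
      (hgm.comp measurable_snd).mul (h1.indicator hTm)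
    exact h2
  have hkt : ∀ t, Measurable (k t) := fun t => hkm.of_uncurry_left
  -- the integrand after the change of variables
  have hpt : ∀ t ∈ Ioc (0 : ℝ) 1, ∀ y ∈ B,
      ‖fderiv ℝ w (x + t • (y - x))‖ₑ * ‖y - x‖ₑ ≤ k t (x + t • (y - x)) := by
    intro t ht y hy
    have hz : x + t • (y - x) ∈ B :=
      (convex_closedBall x₀ R).add_smul_sub_mem hx hy ⟨ht.1.le, ht.2⟩
    have hyx : ‖y - x‖ ≤ 2 * R := by
      rw [← dist_eq_norm]
      have h1 := Metric.mem_closedBall.1 hx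
      have h2 := Metric.mem_closedBall.1 hy
      linarith [dist_triangle_right y x x₀]
    have hTmem : (t, x + t • (y - x)) ∈ T := by
      simp only [hT, mem_ofPred_eq, add_sub_cancel_left, norm_smul, Real.norm_eq_abs,
        abs_of_pos ht.1]
      nlinarith [ht.1]
    simp only [hk, hg, indicator_of_mem hz, indicator_of_mem hTmem, add_sub_cancel_left]
    rw [mul_assoc, enorm_smul, mul_comm (‖t‖ₑ), mul_assoc, Real.enorm_eq_ofReal ht.1.le,
      ← ENNReal.ofReal_mul ht.1.le, mul_inv_cancel₀ ht.1.ne', ENNReal.ofReal_one, mul_one]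
  -- integration in `t`
  have hin : ∀ z, ∫⁻ t in Ioc (0 : ℝ) 1, ENNReal.ofReal ((t ^ n)⁻¹) * k t z ≤
      B.indicator (fun z => ENNReal.ofReal ((2 * R) ^ n) *
        (‖fderiv ℝ w z‖ₑ * powerKernel (n - 1) (x - z))) z := by
    intro z
    by_cases hz : z ∈ B
    swap
    · simp [hk, hg, hz]
    rw [indicator_of_mem hz]
    by_cases hzx : z = x
    · have : ∀ t, k t z = 0 := fun t => by simp [hk, hg, hzx]
      simp [this]
    have hd : 0 < ‖z - x‖ := norm_pos_iff.2 (sub_ne_zero.2 hzx)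
    -- The least admissible `t`. Integrating `t^(-n-1)` from `a` gives at most `a^(-n) = (2R)^n |x -
    -- z|^(-n)`, and the factor `|z - x|` inside `g` lowers the exponent to `n - 1`.
    set a := ‖z - x‖ / (2 * R) with ha
    have ha0 : 0 < a := by positivity
    calc ∫⁻ t in Ioc (0 : ℝ) 1, ENNReal.ofReal ((t ^ n)⁻¹) * k t z
        ≤ ∫⁻ t in Ioc (0 : ℝ) 1, (Ici a).indicator
            (fun t => g z * ENNReal.ofReal ((t ^ (n + 1))⁻¹)) t := by
          refine setLIntegral_mono' measurableSet_Ioc fun t ht => ?_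
          by_cases hta : a ≤ t
          · rw [indicator_of_mem (mem_Ici.2 hta)]
            have hTm : (t, z) ∈ T := by
              simp only [hT, mem_ofPred_eq]
              rw [ha, div_le_iff₀ (by positivity)] at hta
              linarith
            simp only [hk, indicator_of_mem hTm]
            rw [mul_left_comm, ← ENNReal.ofReal_mul (by have := ht.1; positivity), pow_succ,
              mul_inv]
          · have hTm : (t, z) ∉ T := by
              simp only [hT, mem_ofPred_eq]
              rw [ha, div_le_iff₀ (by positivity)] at hta
              linarith
            simp [hk, hTm]
      _ ≤ ∫⁻ t, (Ici a).indicator (fun t => g z * ENNReal.ofReal ((t ^ (n + 1))⁻¹)) t :=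
          setLIntegral_le_lintegral _ _
      _ = g z * ∫⁻ t in Ici a, ENNReal.ofReal ((t ^ (n + 1))⁻¹) := by
          rw [lintegral_indicator measurableSet_Ici, lintegral_const_mul]
          exact ENNReal.measurable_ofReal.comp (measurable_id.pow_const _).inv
      _ ≤ g z * ENNReal.ofReal ((a ^ n)⁻¹) := by
          gcongr; exact lintegral_Ici_rpow_neg_le hn ha0
      _ = _ := by
          rw [hg, indicator_of_mem hz, mul_left_comm, mul_assoc]
          congr 1
          rw [powerKernel, ← ofReal_norm (z - x), ← ENNReal.ofReal_mul (norm_nonneg _),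
            ← ENNReal.ofReal_mul (by positivity), norm_sub_rev x z]
          congr 1
          rw [ha, div_pow, inv_div, neg_sub, Real.rpow_sub hd, Real.rpow_one, Real.rpow_natCast]
          ring
  calc ∫⁻ y in B, ‖w x - w y‖ₑ
      ≤ ∫⁻ y in B, ∫⁻ t in Ioc (0 : ℝ) 1, ‖fderiv ℝ w (x + t • (y - x))‖ₑ * ‖y - x‖ₑ :=
        lintegral_mono fun y => enorm_sub_le_lintegral_fderiv hw x y
    _ = ∫⁻ t in Ioc (0 : ℝ) 1, ∫⁻ y in B, ‖fderiv ℝ w (x + t • (y - x))‖ₑ * ‖y - x‖ₑ := by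
        refine lintegral_lintegral_swap (Continuous.measurable ?_).aemeasurable
        have : Continuous fun p : EuclideanSpace ℝ (Fin n) × ℝ =>
            ‖fderiv ℝ w (x + p.2 • (p.1 - x))‖ * ‖p.1 - x‖ := by fun_prop
        have h2 := ENNReal.continuous_ofReal.comp this
        refine h2.congr fun p => ?_
        simp only [Function.comp_apply, Function.uncurry, ENNReal.ofReal_mul (norm_nonneg _),
          ofReal_norm]
    _ ≤ ∫⁻ t in Ioc (0 : ℝ) 1, ENNReal.ofReal ((t ^ n)⁻¹) * ∫⁻ z, k t z := by
        refine setLIntegral_mono' measurableSet_Ioc fun t ht => ?_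
        rw [← lintegral_comp_add_smul_sub (hkt t) x ht.1]
        calc _ ≤ ∫⁻ y in B, k t (x + t • (y - x)) :=
              setLIntegral_mono' Metric.isClosed_closedBall.measurableSet (hpt t ht)
          _ ≤ _ := setLIntegral_le_lintegral _ _
    _ = ∫⁻ t in Ioc (0 : ℝ) 1, ∫⁻ z, ENNReal.ofReal ((t ^ n)⁻¹) * k t z := by
        congr 1; ext t; rw [lintegral_const_mul _ (hkt t)]
    _ = ∫⁻ z, ∫⁻ t in Ioc (0 : ℝ) 1, ENNReal.ofReal ((t ^ n)⁻¹) * k t z := by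
        refine lintegral_lintegral_swap (Measurable.aemeasurable ?_)
        exact (ENNReal.measurable_ofReal.comp (measurable_fst.pow_const _).inv).mul hkm
    _ ≤ ∫⁻ z, B.indicator (fun z => ENNReal.ofReal ((2 * R) ^ n) *
        (‖fderiv ℝ w z‖ₑ * powerKernel (n - 1) (x - z))) z := lintegral_mono hin
    _ = _ := by
        rw [lintegral_indicator Metric.isClosed_closedBall.measurableSet, lintegral_const_mul]
        exact hDw.enorm.measurable.mul
          ((measurable_powerKernel _).comp (measurable_const.sub measurable_id))

end ClassicalPotential

/-! ### The potential estimate for weakly differentiable functions. -/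

section WeakPotential

open scoped Convolution

variable {n : ℕ} {Ω : Set (EuclideanSpace ℝ (Fin n))} {u : EuclideanSpace ℝ (Fin n) → ℝ}
  {Du : EuclideanSpace ℝ (Fin n) → EuclideanSpace ℝ (Fin n)}

/-- The gradient of a mollification is controlled by averages of the weak gradient. -/
lemma enorm_fderiv_mollification_le (h : HasWeakGradient Ω u Du)
    {x₀ z : EuclideanSpace ℝ (Fin n)} {R' : ℝ} (hsub : Metric.closedBall x₀ R' ⊆ Ω)
    (φ : ContDiffBump (0 : EuclideanSpace ℝ (Fin n))) (hφ : φ.rOut ≤ 2 * φ.rIn)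
    (hz : Metric.closedBall z φ.rOut ⊆ Metric.closedBall x₀ R') :
    ‖fderiv ℝ (φ.normed volume ⋆[ContinuousLinearMap.lsmul ℝ ℝ, volume]
        ((Metric.closedBall x₀ R').indicator u)) z‖ₑ ≤
      ENNReal.ofReal (2 ^ n / (φ.rOut ^ n * unitBallVolume n)) *
        ∫⁻ y in Metric.closedBall z φ.rOut, ‖Du y‖ₑ := by
  set B := Metric.closedBall x₀ R' with hB
  set ε := φ.rOut with hε
  set f := φ.normed volume with hf
  have hfs : ContDiff ℝ ((⊤ : ℕ∞) : WithTop ℕ∞) f := φ.contDiff_normed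
  have hfc : HasCompactSupport f := φ.hasCompactSupport_normed
  have hBm : MeasurableSet B := Metric.isClosed_closedBall.measurableSet
  have hui : Integrable (B.indicator u) volume :=
    (integrable_indicator_iff hBm).2
      (h.locallyIntegrable.integrableOn_compact_subset hsub (isCompact_closedBall _ _))
  have hz0 : ∀ y, f (z - y) ≠ 0 → y ∈ Metric.closedBall z ε := by
    intro y hy
    have : z - y ∈ Function.support f := hy
    rw [hf, φ.support_normed_eq, mem_ball_zero_iff, ← dist_eq_norm, dist_comm] at this
    exact Metric.mem_closedBall.2 this.le
  have hts : tsupport f = Metric.closedBall 0 ε := φ.tsupport_normed_eq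
  have hz1 : ∀ y, fderiv ℝ f (z - y) ≠ 0 → y ∈ Metric.closedBall z ε := by
    intro y hy
    have : z - y ∈ tsupport f := support_fderiv_subset ℝ hy
    rw [hts, mem_closedBall_zero_iff, ← dist_eq_norm, dist_comm] at this
    exact Metric.mem_closedBall.2 this
  -- the derivative of the convolution
  have hder := hfc.hasFDerivAt_convolution_left (ContinuousLinearMap.lsmul ℝ ℝ)
    (hfs.of_le (by norm_cast)) hui.locallyIntegrable z
  rw [hder.fderiv]
  refine ContinuousLinearMap.opENorm_le_bound _ fun v => ?_
  -- Truncating `u` to the ball is harmless at `z`: the mollifier centred at `z` lives inside that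
  -- ball, so the integral may be taken over `Ω` with `u` itself.
  have hval : ((fderiv ℝ f) ⋆[(ContinuousLinearMap.lsmul ℝ ℝ).precompL
      (EuclideanSpace ℝ (Fin n)), volume] (B.indicator u)) z v =
      ∫ y in Ω, u y * fderiv ℝ f (z - y) v := by
    rw [convolution_eq_swap]
    have hint : Integrable (fun t => ((ContinuousLinearMap.lsmul ℝ ℝ).precompL
        (EuclideanSpace ℝ (Fin n)) (fderiv ℝ f (z - t))) (B.indicator u t)) volume :=
      ((hfc.fderiv ℝ).convolutionExists_left _ (hfs.continuous_fderiv (by simp))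
        hui.locallyIntegrable z).integrable_swap
    rw [ContinuousLinearMap.integral_apply hint, ← setIntegral_eq_integral_of_forall_compl_eq_zero
      (s := Ω)]
    · refine integral_congr_ae (Eventually.of_forall fun y => ?_)
      simp only [ContinuousLinearMap.precompL_apply, ContinuousLinearMap.lsmul_apply, smul_eq_mul]
      by_cases hy : y ∈ B
      · rw [indicator_of_mem hy]; ring
      · have : fderiv ℝ f (z - y) = 0 := by
          by_contra hc
          exact hy (hz (hz1 y hc))
        simp [this]
    · intro y hy
      have : fderiv ℝ f (z - y) = 0 := by
        by_contra hc
        exact hy (hsub (hz (hz1 y hc)))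
      simp [this]
  have hweak : ∫ y in Ω, u y * fderiv ℝ f (z - y) v = ∫ y in Ω, f (z - y) * inner ℝ (Du y) v := by
    have hψs : ContDiff ℝ ((⊤ : ℕ∞) : WithTop ℕ∞) (fun y => f (z - y)) :=
      hfs.comp (contDiff_const.sub contDiff_id)
    have hsupp : tsupport (fun y => f (z - y)) ⊆ Metric.closedBall z ε :=
      closure_minimal (fun y hy => hz0 y hy) Metric.isClosed_closedBall
    have hψc : HasCompactSupport (fun y => f (z - y)) :=
      (isCompact_closedBall z ε).of_isClosed_subset (isClosed_tsupport _) hsupp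
    have := h.integral_eq _ hψs hψc (hsupp.trans (hz.trans hsub)) v
    have hfd : ∀ y, fderiv ℝ (fun y => f (z - y)) y v = - fderiv ℝ f (z - y) v := by
      intro y
      have h1 : HasFDerivAt f (fderiv ℝ f (z - y)) (z - y) :=
        (hfs.differentiable (by simp) _).hasFDerivAt
      have h2 := h1.comp y ((hasFDerivAt_id y).const_sub z)
      have h3 : fderiv ℝ (fun y => f (z - y)) y = (fderiv ℝ f (z - y)).comp
        (-ContinuousLinearMap.id ℝ (EuclideanSpace ℝ (Fin n))) := h2.fderiv
      rw [h3]; simp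
    simp_rw [hfd, mul_neg, integral_neg, neg_inj] at this
    exact this
  rw [hval, hweak]
  -- As the outer radius is at most twice the inner one, the normalised bump is at most `2^n` over
  -- the volume of its supporting ball.
  have hM : ∀ x, f x ≤ 2 ^ n / (ε ^ n * unitBallVolume n) := by
    intro x
    have := φ.normed_le_div_measure_closedBall_rOut volume 2 hφ x
    rwa [finrank_euclideanSpace_fin, measureReal_def, volume_closedBall_eq _ φ.rOut_pos.le,
      ENNReal.toReal_ofReal (mul_nonneg (pow_nonneg φ.rOut_pos.le _) unitBallVolume_pos.le)] at this
  calc ‖∫ y in Ω, f (z - y) * inner ℝ (Du y) v‖ₑ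
      ≤ ∫⁻ y in Ω, ‖f (z - y) * inner ℝ (Du y) v‖ₑ := enorm_integral_le_lintegral_enorm _
    _ ≤ ∫⁻ y in Ω, (Metric.closedBall z ε).indicator (fun y =>
          ENNReal.ofReal (2 ^ n / (ε ^ n * unitBallVolume n)) * ‖v‖ₑ * ‖Du y‖ₑ) y := by
        refine lintegral_mono fun y => ?_
        by_cases hy : f (z - y) = 0
        · simp [hy]
        rw [indicator_of_mem (hz0 y hy), enorm_mul, mul_assoc]
        gcongr
        · rw [Real.enorm_eq_ofReal (φ.nonneg_normed _)]
          exact ENNReal.ofReal_le_ofReal (hM _)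
        · rw [← ofReal_norm, ← ofReal_norm, ← ofReal_norm, ← ENNReal.ofReal_mul (norm_nonneg _)]
          refine ENNReal.ofReal_le_ofReal ((norm_inner_le_norm _ _).trans (mul_comm _ _).le)
    _ ≤ ∫⁻ y, (Metric.closedBall z ε).indicator (fun y =>
          ENNReal.ofReal (2 ^ n / (ε ^ n * unitBallVolume n)) * ‖v‖ₑ * ‖Du y‖ₑ) y :=
        setLIntegral_le_lintegral _ _
    _ = _ := by
        rw [lintegral_indicator Metric.isClosed_closedBall.measurableSet, lintegral_const_mul'
          _ _ (ENNReal.mul_ne_top ENNReal.ofReal_ne_top enorm_ne_top)]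
        ring

/-- Averaging a density over small balls before integrating it against `|x - ·|^{-β}` costs only a
constant. -/
lemma exists_lintegral_averages_mul_powerKernel_le (hn : 1 ≤ n) {β : ℝ} (hβ : 0 ≤ β)
    (hβn : β < n) :
    ∃ C : ℝ, 1 ≤ C ∧ ∀ (f : EuclideanSpace ℝ (Fin n) → ℝ≥0∞)
      (A B : Set (EuclideanSpace ℝ (Fin n))) (x : EuclideanSpace ℝ (Fin n)) (ε : ℝ),
      0 < ε → MeasurableSet A → MeasurableSet B → AEMeasurable f (volume.restrict B) →
      (∀ z ∈ A, Metric.closedBall z ε ⊆ B) →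
      ∫⁻ z in A, (∫⁻ y in Metric.closedBall z ε, f y) * powerKernel β (x - z) ≤
        ENNReal.ofReal (C * ε ^ n) * ∫⁻ y in B, f y * powerKernel β (x - y) := by
  obtain ⟨C, hC, hker⟩ := exists_lintegral_powerKernel_translate_le hn hβ hβn
  refine ⟨C, hC, fun f A B x ε hε hA hB hf hAB => ?_⟩
  have : Nonempty (Fin n) := ⟨⟨0, hn⟩⟩
  set D : Set (EuclideanSpace ℝ (Fin n) × EuclideanSpace ℝ (Fin n)) := {p | dist p.2 p.1 ≤ ε}
    with hD
  have hDm : MeasurableSet D :=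
    (isClosed_le (continuous_snd.dist continuous_fst) continuous_const).measurableSet
  have hk : Measurable fun z : EuclideanSpace ℝ (Fin n) => powerKernel β (x - z) :=
    (measurable_powerKernel β).comp (measurable_const.sub measurable_id)
  calc ∫⁻ z in A, (∫⁻ y in Metric.closedBall z ε, f y) * powerKernel β (x - z)
      ≤ ∫⁻ z in A, ∫⁻ y in B, f y * (D.indicator (fun p => powerKernel β (x - p.1)) (z, y)) := by
        refine setLIntegral_mono' hA fun z hz => ?_
        have hkz : powerKernel β (x - z) ≠ ∞ := ENNReal.ofReal_ne_top
        rw [← lintegral_mul_const' _ _ hkz,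
          ← lintegral_indicator Metric.isClosed_closedBall.measurableSet]
        calc _ = ∫⁻ y in B, (Metric.closedBall z ε).indicator
              (fun y => f y * powerKernel β (x - z)) y := by
              rw [← lintegral_indicator hB]
              congr 1; ext y
              by_cases hy : y ∈ Metric.closedBall z ε
              · simp [hy, hAB z hz hy]
              · by_cases hyB : y ∈ B <;> simp [hy, hyB]
          _ ≤ _ := by
              refine lintegral_mono fun y => ?_
              by_cases hy : y ∈ Metric.closedBall z ε
              · have : (z, y) ∈ D := hy
                rw [indicator_of_mem hy, indicator_of_mem this]
              · simp [hy]
    -- Tonelli moves the average from `f` to the kernel: the inner integral becomes that of the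
    -- kernel over the `ε`-ball about `x - y`.
    _ = ∫⁻ y in B, ∫⁻ z in A, f y * (D.indicator (fun p => powerKernel β (x - p.1)) (z, y)) := by
        refine lintegral_lintegral_swap ?_
        have h1 : Measurable fun p : EuclideanSpace ℝ (Fin n) × EuclideanSpace ℝ (Fin n) =>
            D.indicator (fun p => powerKernel β (x - p.1)) p :=
          (hk.comp measurable_fst).indicator hDm
        exact (hf.comp_snd).mul h1.aemeasurable
    _ ≤ ∫⁻ y in B, ENNReal.ofReal (C * ε ^ n) * (f y * powerKernel β (x - y)) := by
        refine lintegral_mono_ae ?_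
        -- For `β > 0` the kernel takes the value `0` at the origin, so the translate bound is
        -- meaningless at `y = x`; a single point is negligible.
        have hne : ∀ᵐ y ∂(volume.restrict B), y ≠ x :=
          ae_restrict_of_ae (by simp [ae_iff, measure_singleton])
        filter_upwards [hne] with y hy
        have h1 : Measurable fun z => D.indicator (fun p => powerKernel β (x - p.1)) (z, y) := by
          have h1 : Measurable fun p : EuclideanSpace ℝ (Fin n) × EuclideanSpace ℝ (Fin n) =>
            D.indicator (fun p => powerKernel β (x - p.1)) p :=
            (hk.comp measurable_fst).indicator hDm
          exact h1.comp measurable_prodMk_right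
        rw [lintegral_const_mul _ h1, mul_left_comm]
        gcongr
        calc ∫⁻ z in A, D.indicator (fun p => powerKernel β (x - p.1)) (z, y)
            ≤ ∫⁻ z, D.indicator (fun p => powerKernel β (x - p.1)) (z, y) :=
              setLIntegral_le_lintegral _ _
          _ = ∫⁻ z, (Metric.closedBall (x - y) ε).indicator (powerKernel β) (x - z) := by
              congr 1; ext z
              have : (z, y) ∈ D ↔ x - z ∈ Metric.closedBall (x - y) ε := by
                simp only [hD, mem_ofPred_eq, Metric.mem_closedBall, dist_eq_norm]
                rw [sub_sub_sub_cancel_left]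
              by_cases hy : (z, y) ∈ D
              · rw [indicator_of_mem hy, indicator_of_mem (this.1 hy)]
              · rw [indicator_of_notMem hy, indicator_of_notMem (fun h => hy (this.2 h))]
          _ = ∫⁻ z, (Metric.closedBall (x - y) ε).indicator (powerKernel β) z :=
              lintegral_sub_left_eq_self (μ := volume) _ x
          _ = ∫⁻ z in Metric.closedBall (x - y) ε, powerKernel β z :=
              lintegral_indicator Metric.isClosed_closedBall.measurableSet _
          _ ≤ _ := hker (x - y) ε hε (sub_ne_zero.2 hy.symm)
    _ = _ := lintegral_const_mul' _ _ ENNReal.ofReal_ne_top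

/-- The Riesz potential estimate for oscillations of a weakly differentiable function. -/
lemma exists_potential_estimate (hn : 1 ≤ n) :
    ∃ C : ℝ, 1 ≤ C ∧ ∀ (Ω : Set (EuclideanSpace ℝ (Fin n))) (u : EuclideanSpace ℝ (Fin n) → ℝ)
      (Du : EuclideanSpace ℝ (Fin n) → EuclideanSpace ℝ (Fin n)) (x₀ : EuclideanSpace ℝ (Fin n))
      (R R' : ℝ), HasWeakGradient Ω u Du → 0 < R → R < R' → Metric.closedBall x₀ R' ⊆ Ω →
      ∀ᵐ x ∂(volume.restrict (Metric.closedBall x₀ R)),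
        ∫⁻ y in Metric.closedBall x₀ R, ‖u x - u y‖ₑ ≤ ENNReal.ofReal (C * R ^ n) *
          ∫⁻ z in Metric.closedBall x₀ R', ‖Du z‖ₑ * powerKernel (n - 1) (x - z) := by
  have hn' : (1 : ℝ) ≤ n := by exact_mod_cast hn
  obtain ⟨C, hC, hker⟩ := exists_lintegral_averages_mul_powerKernel_le (n := n) hn
    (β := (n : ℝ) - 1) (by linarith) (by linarith)
  have hV := unitBallVolume_pos (n := n)
  refine ⟨1 + 2 ^ n * (2 ^ n * C / unitBallVolume n), by
    have : 0 ≤ 2 ^ n * (2 ^ n * C / unitBallVolume n) := by positivity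
    linarith, fun Ω u Du x₀ R R' h hR hRR' hsub => ?_⟩
  set B := Metric.closedBall x₀ R with hB
  set B' := Metric.closedBall x₀ R' with hB'
  have hBm : MeasurableSet B := Metric.isClosed_closedBall.measurableSet
  have hBm' : MeasurableSet B' := Metric.isClosed_closedBall.measurableSet
  have hBB' : B ⊆ B' := Metric.closedBall_subset_closedBall hRR'.le
  have hui : Integrable (B'.indicator u) volume :=
    (integrable_indicator_iff hBm').2
      (h.locallyIntegrable.integrableOn_compact_subset hsub (isCompact_closedBall _ _))
  have hDum : AEMeasurable (fun y => ‖Du y‖ₑ) (volume.restrict B') :=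
    (h.grad_locallyIntegrable.integrableOn_compact_subset hsub
      (isCompact_closedBall _ _)).aestronglyMeasurable.enorm
  -- The outer radii are at most `R' - R`, so that mollifying on `B` only sees `B'`; the ratio `2`
  -- of the radii gives the uniform bound on the bumps.
  set φ : ℕ → ContDiffBump (0 : EuclideanSpace ℝ (Fin n)) := fun k =>
    { rIn := (R' - R) / (k + 1) / 2
      rOut := (R' - R) / (k + 1)
      rIn_pos := by
        have : 0 < R' - R := by linarith
        positivity
      rIn_lt_rOut := by
        have : 0 < R' - R := by linarith
        have : 0 < (R' - R) / (k + 1) := by positivity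
        linarith } with hφ
  have hrOut : ∀ k, (φ k).rOut ≤ R' - R := fun k => by
    refine div_le_self (by linarith) ?_
    have : (0 : ℝ) ≤ k := Nat.cast_nonneg k
    linarith
  have hrr : ∀ k, (φ k).rOut ≤ 2 * (φ k).rIn := fun k => by simp only [hφ]; linarith
  have hlim : Tendsto (fun k => (φ k).rOut) atTop (𝓝 0) := by
    have := (tendsto_one_div_add_atTop_nhds_zero_nat (𝕜 := ℝ)).const_mul (R' - R)
    simpa [hφ, div_eq_mul_inv] using this
  set w : ℕ → EuclideanSpace ℝ (Fin n) → ℝ := fun k =>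
    ((φ k).normed volume ⋆[ContinuousLinearMap.lsmul ℝ ℝ, volume] (B'.indicator u)) with hw
  have hws : ∀ k, ContDiff ℝ 1 (w k) := fun k =>
    (φ k).hasCompactSupport_normed.contDiff_convolution_left _ (φ k).contDiff_normed
      hui.locallyIntegrable
  have hconv : ∀ᵐ x, Tendsto (fun k => w k x) atTop (𝓝 (B'.indicator u x)) :=
    ContDiffBump.ae_convolution_tendsto_right_of_locallyIntegrable hlim
      (Eventually.of_forall hrr) hui.locallyIntegrable
  -- The right side is independent of `k`, because the averages of `|Du|` are moved onto the kernel.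
  -- Almost everywhere convergence and Fatou then suffice; convergence of the gradients is never
  -- needed.
  have hbound : ∀ k, ∀ x ∈ B, ∫⁻ y in B, ‖w k x - w k y‖ₑ ≤
      ENNReal.ofReal ((1 + 2 ^ n * (2 ^ n * C / unitBallVolume n)) * R ^ n) *
          ∫⁻ z in B', ‖Du z‖ₑ * powerKernel (n - 1) (x - z) := by
    intro k x hx
    have hε := (φ k).rOut_pos
    have hball : ∀ z ∈ B, Metric.closedBall z (φ k).rOut ⊆ B' := by
      intro z hz
      refine Metric.closedBall_subset_closedBall' ?_
      have := hrOut k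
      have := Metric.mem_closedBall.1 hz
      linarith
    set M := ENNReal.ofReal (2 ^ n / ((φ k).rOut ^ n * unitBallVolume n)) with hM
    calc ∫⁻ y in B, ‖w k x - w k y‖ₑ
        ≤ ENNReal.ofReal ((2 * R) ^ n) *
          ∫⁻ z in B, ‖fderiv ℝ (w k) z‖ₑ * powerKernel (n - 1) (x - z) :=
          lintegral_enorm_sub_le_of_contDiff hn (hws k) hR hx
      _ ≤ ENNReal.ofReal ((2 * R) ^ n) *
          ∫⁻ z in B, M * ((∫⁻ y in Metric.closedBall z (φ k).rOut, ‖Du y‖ₑ) *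
            powerKernel (n - 1) (x - z)) := by
          refine mul_le_mul_right (setLIntegral_mono' hBm fun z hz => ?_) _
          rw [← mul_assoc]
          gcongr
          exact enorm_fderiv_mollification_le h hsub (φ k) (hrr k) (hball z hz)
      _ = ENNReal.ofReal ((2 * R) ^ n) * (M *
          ∫⁻ z in B, (∫⁻ y in Metric.closedBall z (φ k).rOut, ‖Du y‖ₑ) *
            powerKernel (n - 1) (x - z)) := by
          rw [lintegral_const_mul' _ _ ENNReal.ofReal_ne_top]
      _ ≤ ENNReal.ofReal ((2 * R) ^ n) * (M * (ENNReal.ofReal (C * (φ k).rOut ^ n) *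
          ∫⁻ z in B', ‖Du z‖ₑ * powerKernel (n - 1) (x - z))) := by
          gcongr
          exact hker _ B B' x _ hε hBm hBm' hDum hball
      _ = ENNReal.ofReal (2 ^ n * (2 ^ n * C / unitBallVolume n) * R ^ n) *
          ∫⁻ z in B', ‖Du z‖ₑ * powerKernel (n - 1) (x - z) := by
          rw [hM, ← mul_assoc, ← mul_assoc, ← ENNReal.ofReal_mul (by positivity),
            ← ENNReal.ofReal_mul (by positivity)]
          congr 2
          have : (φ k).rOut ^ n ≠ 0 := (pow_pos hε n).ne'
          rw [mul_pow]
          field_simp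
      _ ≤ _ := by
          gcongr
          linarith
  filter_upwards [ae_restrict_of_ae hconv, ae_restrict_mem hBm] with x hx hxB
  calc ∫⁻ y in B, ‖u x - u y‖ₑ
      = ∫⁻ y in B, liminf (fun k => ‖w k x - w k y‖ₑ) atTop := by
        refine lintegral_congr_ae ?_
        filter_upwards [ae_restrict_of_ae hconv, ae_restrict_mem hBm] with y hy hyB
        rw [indicator_of_mem (hBB' hxB)] at hx
        rw [indicator_of_mem (hBB' hyB)] at hy
        exact ((hx.sub hy).enorm).liminf_eq.symm
    _ ≤ liminf (fun k => ∫⁻ y in B, ‖w k x - w k y‖ₑ) atTop :=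
        lintegral_liminf_le fun k =>
          (continuous_const.sub (hws k).continuous).enorm.measurable
    _ ≤ _ := by
        refine liminf_le_of_frequently_le' (Eventually.frequently (Eventually.of_forall
          fun k => hbound k x hxB))

end WeakPotential

/-! ### Competitors and cutoff functions. -/

section WeakCutoff

variable {n : ℕ} {Ω : Set (EuclideanSpace ℝ (Fin n))} {u : EuclideanSpace ℝ (Fin n) → ℝ}
  {Du : EuclideanSpace ℝ (Fin n) → EuclideanSpace ℝ (Fin n)}

lemma MeasureTheory.LocallyIntegrableOn.integrableOn_mul_test {f g : EuclideanSpace ℝ (Fin n) → ℝ}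
    (hf : LocallyIntegrableOn f Ω volume) (hg : Continuous g) (hgc : HasCompactSupport g)
    (hgs : tsupport g ⊆ Ω) : IntegrableOn (fun x => f x * g x) Ω volume := by
  have h1 : IntegrableOn (fun x => f x * g x) (tsupport g) volume :=
    (hf.integrableOn_compact_subset hgs hgc).mul_continuousOn hg.continuousOn hgc
  have h2 : Integrable (fun x => f x * g x) volume :=
    (integrableOn_iff_integrable_of_support_subset (fun x hx => by
      refine subset_tsupport g ?_
      intro h0
      exact hx (by simp [h0]))).1 h1
  exact h2.integrableOn

/-- The gradient vector of a real function on Euclidean space. -/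
noncomputable def gradVec (η : EuclideanSpace ℝ (Fin n) → ℝ) (x : EuclideanSpace ℝ (Fin n)) :
    EuclideanSpace ℝ (Fin n) :=
  (InnerProductSpace.toDual ℝ (EuclideanSpace ℝ (Fin n))).symm (fderiv ℝ η x)

lemma inner_gradVec (η : EuclideanSpace ℝ (Fin n) → ℝ) (x w : EuclideanSpace ℝ (Fin n)) :
    inner ℝ (gradVec η x) w = fderiv ℝ η x w := InnerProductSpace.toDual_symm_apply

lemma norm_gradVec (η : EuclideanSpace ℝ (Fin n) → ℝ) (x : EuclideanSpace ℝ (Fin n)) :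
    ‖gradVec η x‖ = ‖fderiv ℝ η x‖ := LinearIsometryEquiv.norm_map _ _

/-- Allows a competitor to be changed on a null set in order to prescribe the closure of the set
where it differs from `u`. -/
lemma OrliczMultiPhase.HasWeakGradient.congr_ae (h : HasWeakGradient Ω u Du)
    {v : EuclideanSpace ℝ (Fin n) → ℝ} (huv : u =ᵐ[volume.restrict Ω] v) :
    HasWeakGradient Ω v Du where
  locallyIntegrable := h.locallyIntegrable.congr huv
  grad_locallyIntegrable := h.grad_locallyIntegrable
  integral_eq := fun φ h1 h2 h3 w => by
    rw [← h.integral_eq φ h1 h2 h3 w]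
    refine integral_congr_ae ?_
    filter_upwards [huv] with x hx
    rw [hx]

/-- The weak gradient of `u - η (u - k)`. -/
lemma OrliczMultiPhase.HasWeakGradient.cutoff (hΩ : IsOpen Ω) (h : HasWeakGradient Ω u Du)
    {η : EuclideanSpace ℝ (Fin n) → ℝ} (hη : ContDiff ℝ ((⊤ : ℕ∞) : WithTop ℕ∞) η) (k : ℝ) :
    HasWeakGradient Ω (fun x => u x - η x * (u x - k))
      (fun x => (1 - η x) • Du x - (u x - k) • gradVec η x) := by
  have hlc : IsLocallyClosed Ω := hΩ.isLocallyClosed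
  have hk : LocallyIntegrableOn (fun x => u x - k) Ω volume :=
    h.locallyIntegrable.sub
      ((continuous_const (y := k)).locallyIntegrable.locallyIntegrableOn Ω)
  have hηd : Differentiable ℝ η := hη.differentiable (by simp)
  have hDη : Continuous (fderiv ℝ η) := hη.continuous_fderiv (by simp)
  have hg : Continuous (gradVec η) :=
    (InnerProductSpace.toDual ℝ (EuclideanSpace ℝ (Fin n))).symm.continuous.comp hDη
  refine ⟨?_, ?_, ?_⟩
  · exact h.locallyIntegrable.sub (hk.continuousOn_mul hη.continuous.continuousOn hlc)
  · exact (h.grad_locallyIntegrable.continuousOn_smul hlc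
      (continuous_const.sub hη.continuous).continuousOn).sub
      (hk.smul_continuousOn hlc hg.continuousOn)
  · intro φ hφ hφc hφs w
    have hφd : Differentiable ℝ φ := hφ.differentiable (by simp)
    have hDφ : Continuous (fderiv ℝ φ) := hφ.continuous_fderiv (by simp)
    set ψ : EuclideanSpace ℝ (Fin n) → ℝ := fun x => (1 - η x) * φ x with hψdef
    have hψ : ContDiff ℝ ((⊤ : ℕ∞) : WithTop ℕ∞) ψ := (contDiff_const.sub hη).mul hφ
    have hψc : HasCompactSupport ψ := hφc.mul_left
    have hψs : tsupport ψ ⊆ Ω := (tsupport_mul_subset_right).trans hφs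
    set χ : EuclideanSpace ℝ (Fin n) → ℝ := fun x => η x * φ x with hχdef
    have hχ : ContDiff ℝ ((⊤ : ℕ∞) : WithTop ℕ∞) χ := hη.mul hφ
    have hχc : HasCompactSupport χ := hφc.mul_left
    have hχs : tsupport χ ⊆ Ω := (tsupport_mul_subset_right).trans hφs
    have hDψ : ∀ x, fderiv ℝ ψ x w = (1 - η x) * fderiv ℝ φ x w - φ x * fderiv ℝ η x w := by
      intro x
      have h1 := ((hηd x).hasFDerivAt.const_sub 1).mul (hφd x).hasFDerivAt
      have h2 : fderiv ℝ ψ x = (1 - η x) • fderiv ℝ φ x + φ x • (-fderiv ℝ η x) := h1.fderiv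
      rw [h2]
      simp; ring
    have hDχ : ∀ x, fderiv ℝ χ x w = η x * fderiv ℝ φ x w + φ x * fderiv ℝ η x w := by
      intro x
      have h1 := (hηd x).hasFDerivAt.mul (hφd x).hasFDerivAt
      have h2 : fderiv ℝ χ x = η x • fderiv ℝ φ x + φ x • (fderiv ℝ η x) := h1.fderiv
      rw [h2]
      simp
    have hint1 : IntegrableOn (fun x => u x * fderiv ℝ ψ x w) Ω volume :=
      LocallyIntegrableOn.integrableOn_mul_test h.locallyIntegrable
        ((hψ.continuous_fderiv (by simp)).clm_apply continuous_const)
        (hψc.fderiv_apply ℝ w) ((tsupport_fderiv_apply_subset ℝ w).trans hψs)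
    have hint2 : IntegrableOn (fun x => (u x - k) * (φ x * fderiv ℝ η x w)) Ω volume :=
      LocallyIntegrableOn.integrableOn_mul_test hk
        (hφ.continuous.mul (hDη.clm_apply continuous_const)) hφc.mul_right
        ((tsupport_mul_subset_left).trans hφs)
    have hint3' : Integrable (fun x => fderiv ℝ χ x w) volume :=
      ((hχ.continuous_fderiv (by simp)).clm_apply continuous_const).integrable_of_hasCompactSupport
        (hχc.fderiv_apply ℝ w)
    have hinn : LocallyIntegrableOn (fun x => inner ℝ (Du x) w) Ω volume := by
      rw [locallyIntegrableOn_iff hlc]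
      intro K hK hKc
      exact (h.grad_locallyIntegrable.integrableOn_compact_subset hK hKc).inner_const w
    have hint4 : IntegrableOn (fun x => inner ℝ (Du x) w * ψ x) Ω volume :=
      LocallyIntegrableOn.integrableOn_mul_test hinn hψ.continuous hψc hψs
    have hzero : ∫ x in Ω, fderiv ℝ χ x w = 0 := by
      rw [setIntegral_eq_integral_of_forall_compl_eq_zero]
      · have := integral_mul_fderiv_eq_neg_fderiv_mul_of_integrable (μ := volume)
          (f := fun _ : EuclideanSpace ℝ (Fin n) => (1 : ℝ)) (g := χ) (v := w) (by simp)
          (by simpa using hint3')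
          (by simpa using hχ.continuous.integrable_of_hasCompactSupport hχc)
          (fun x _ => by fun_prop) (fun x _ => hχ.differentiable (by simp) x)
        simpa using this
      · intro x hx
        by_contra hc
        exact hx (hχs (tsupport_fderiv_apply_subset ℝ w (subset_tsupport _ hc)))
    -- Since `u - η (u - k) = (1 - η) u + k η`, moving the cutoff onto the test function leaves `u
    -- ∂ψ`, the wanted correction, and `k ∂χ`, whose integral vanishes as `χ` has compact support.
    have e1 : ∀ x, (u x - η x * (u x - k)) * fderiv ℝ φ x w =
        u x * fderiv ℝ ψ x w + (u x - k) * (φ x * fderiv ℝ η x w) + k * fderiv ℝ χ x w := by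
      intro x; rw [hDψ, hDχ]; ring
    have e2 : ∀ x, φ x * inner ℝ ((1 - η x) • Du x - (u x - k) • gradVec η x) w =
        inner ℝ (Du x) w * ψ x - (u x - k) * (φ x * fderiv ℝ η x w) := by
      intro x
      rw [inner_sub_left, real_inner_smul_left, real_inner_smul_left, inner_gradVec]
      ring
    simp_rw [e1, e2]
    have hint12 : IntegrableOn (fun x => u x * fderiv ℝ ψ x w +
        (u x - k) * (φ x * fderiv ℝ η x w)) Ω volume := hint1.add hint2
    rw [integral_add hint12 (hint3'.integrableOn.const_mul k),
      integral_add hint1 hint2, integral_sub hint4 hint2, integral_const_mul, hzero,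
      h.integral_eq ψ hψ hψc hψs w]
    simp_rw [mul_comm (ψ _)]
    ring

lemma exists_norm_deriv_smoothTransition_le :
    ∃ C : ℝ, 1 ≤ C ∧ ∀ x, |deriv Real.smoothTransition x| ≤ C := by
  have hc : ContDiff ℝ 1 Real.smoothTransition := Real.smoothTransition.contDiff
  have hs : HasCompactSupport (deriv Real.smoothTransition) := by
    refine HasCompactSupport.of_support_subset_isCompact (isCompact_Icc (a := (0 : ℝ)) (b := 1)) ?_
    intro x hx
    by_contra hc
    rw [mem_Icc, not_and_or, not_le, not_le] at hc
    refine hx ?_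
    rcases hc with hc | hc
    · have : Real.smoothTransition =ᶠ[𝓝 x] fun _ => 0 := by
        filter_upwards [Iio_mem_nhds hc] with y hy
        exact Real.smoothTransition.zero_of_nonpos (le_of_lt hy)
      rw [this.deriv_eq]; simp
    · have : Real.smoothTransition =ᶠ[𝓝 x] fun _ => 1 := by
        filter_upwards [Ioi_mem_nhds hc] with y hy
        exact Real.smoothTransition.one_of_one_le (le_of_lt hy)
      rw [this.deriv_eq]; simp
  obtain ⟨C, hC⟩ := (hc.continuous_deriv (by norm_num)).bounded_above_of_compact_support hs
  exact ⟨max 1 C, le_max_left _ _, fun x => (hC x).trans (le_max_right _ _)⟩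

/-- Smooth cutoff functions between concentric balls with the natural gradient bound. -/
lemma exists_cutoff : ∃ C : ℝ, 1 ≤ C ∧ ∀ (n : ℕ) (x₀ : EuclideanSpace ℝ (Fin n)) (s t : ℝ),
    0 ≤ s → s < t → ∃ η : EuclideanSpace ℝ (Fin n) → ℝ,
      ContDiff ℝ ((⊤ : ℕ∞) : WithTop ℕ∞) η ∧ (∀ x, 0 ≤ η x) ∧ (∀ x, η x ≤ 1) ∧
      (∀ x ∈ Metric.closedBall x₀ s, η x = 1) ∧ (∀ x, x ∉ Metric.ball x₀ t → η x = 0) ∧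
      ∀ x, ‖fderiv ℝ η x‖ ≤ C / (t - s) := by
  obtain ⟨C, hC, hd⟩ := exists_norm_deriv_smoothTransition_le
  refine ⟨2 * C, by linarith, fun n x₀ s t hs hst => ?_⟩
  have hden : 0 < t ^ 2 - s ^ 2 := by nlinarith
  -- The squared distance keeps the cutoff smooth at the centre; inside the ball of radius `t` its
  -- slope is at most `2t / (t² - s²) ≤ 2 / (t - s)`.
  set p : EuclideanSpace ℝ (Fin n) → ℝ := fun x => (t ^ 2 - ‖x - x₀‖ ^ 2) * (t ^ 2 - s ^ 2)⁻¹
    with hp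
  have hpd : ∀ x, HasFDerivAt p ((t ^ 2 - s ^ 2)⁻¹ •
      -((2 : ℕ) • (innerSL ℝ (x - x₀) : EuclideanSpace ℝ (Fin n) →L[ℝ] ℝ))) x := by
    intro x
    have h1 := ((hasFDerivAt_id x).sub_const x₀).norm_sq
    have h2 := (h1.const_sub (t ^ 2)).mul_const ((t ^ 2 - s ^ 2)⁻¹)
    exact h2
  have hps : ContDiff ℝ ((⊤ : ℕ∞) : WithTop ℕ∞) p :=
    (contDiff_const.sub ((contDiff_id.sub contDiff_const).norm_sq ℝ)).mul contDiff_const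
  have hzero : ∀ x, x ∉ Metric.ball x₀ t → Real.smoothTransition (p x) = 0 := by
    intro x hx
    refine Real.smoothTransition.zero_of_nonpos ?_
    rw [Metric.mem_ball, dist_eq_norm, not_lt] at hx
    refine mul_nonpos_of_nonpos_of_nonneg ?_ (by positivity)
    nlinarith
  refine ⟨fun x => Real.smoothTransition (p x), Real.smoothTransition.contDiff.comp hps,
    fun x => Real.smoothTransition.nonneg _, fun x => Real.smoothTransition.le_one _, ?_, hzero, ?_⟩
  · intro x hx
    refine Real.smoothTransition.one_of_one_le ?_
    rw [Metric.mem_closedBall, dist_eq_norm] at hx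
    rw [hp]
    simp only
    rw [← div_eq_mul_inv, one_le_div hden]
    have := norm_nonneg (x - x₀)
    nlinarith
  · intro x
    by_cases hx : ‖x - x₀‖ ≤ t
    · have h1 : HasDerivAt Real.smoothTransition (deriv Real.smoothTransition (p x)) (p x) :=
        ((Real.smoothTransition.contDiff (n := 1)).differentiable (by norm_num) _).hasDerivAt
      have h2 := h1.comp_hasFDerivAt x (hpd x)
      have h3 : fderiv ℝ (fun x => Real.smoothTransition (p x)) x =
        deriv Real.smoothTransition (p x) • ((t ^ 2 - s ^ 2)⁻¹ •
      -((2 : ℕ) • (innerSL ℝ (x - x₀) : EuclideanSpace ℝ (Fin n) →L[ℝ] ℝ))) :=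
        h2.fderiv
      rw [h3, norm_smul, norm_smul, norm_neg, Real.norm_eq_abs, Real.norm_eq_abs,
        abs_of_pos (inv_pos.2 hden)]
      have h4 : ‖(2 : ℕ) • (innerSL ℝ (x - x₀) : EuclideanSpace ℝ (Fin n) →L[ℝ] ℝ)‖ ≤ 2 * t := by
        refine (norm_nsmul_le).trans ?_
        rw [innerSL_apply_norm]
        simpa using hx
      have h5 : 0 < t - s := by linarith
      calc |deriv Real.smoothTransition (p x)| * ((t ^ 2 - s ^ 2)⁻¹ * _)
          ≤ C * ((t ^ 2 - s ^ 2)⁻¹ * (2 * t)) :=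
            mul_le_mul (hd _) (mul_le_mul_of_nonneg_left h4 (inv_pos.2 hden).le)
              (mul_nonneg (inv_pos.2 hden).le (norm_nonneg _)) (by linarith)
        _ ≤ 2 * C / (t - s) := by
            rw [le_div_iff₀ h5, show t ^ 2 - s ^ 2 = (t - s) * (t + s) by ring]
            have h6 : 0 < t + s := by linarith
            have : C * (((t - s) * (t + s))⁻¹ * (2 * t)) * (t - s) = 2 * C * (t / (t + s)) := by
              field_simp
            rw [this]
            have : t / (t + s) ≤ 1 := (div_le_one h6).2 (by linarith)
            nlinarith
    · have : (fun x => Real.smoothTransition (p x)) =ᶠ[𝓝 x] fun _ => 0 := by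
        have hopen : IsOpen {x : EuclideanSpace ℝ (Fin n) | t < ‖x - x₀‖} :=
          isOpen_lt continuous_const (continuous_id.sub continuous_const).norm
        filter_upwards [hopen.mem_nhds (not_le.1 hx)] with y hy
        refine hzero y ?_
        rw [Metric.mem_ball, dist_eq_norm, not_lt]
        exact (le_of_lt hy)
      rw [this.fderiv_eq]
      simp only [fderiv_fun_const, Pi.zero_apply, norm_zero]
      have : 0 < t - s := by linarith
      positivity

end WeakCutoff

/-! ### Measurability, hole filling and the Caccioppoli inequality. -/

namespace OrliczMultiPhase.Setting

variable {n : ℕ} (S : Setting n)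

lemma aemeasurable_comp_of_continuousOn {α : Type*} [MeasurableSpace α] {μ : Measure α} {A : ℝ → ℝ}
    (hA : ContinuousOn A (Ici 0)) {f : α → ℝ} (hf : AEMeasurable f μ) (h0 : ∀ x, 0 ≤ f x) :
    AEMeasurable (fun x => A (f x)) μ := by
  have h1 : Continuous (fun t => A (max t 0)) :=
    hA.comp_continuous (continuous_id.max continuous_const) (fun t => mem_Ici.2 (le_max_right _ _))
  refine (h1.measurable.comp_aemeasurable hf).congr (Eventually.of_forall fun x => ?_)
  simp [max_eq_left (h0 x)]

lemma aemeasurable_Psi {f : EuclideanSpace ℝ (Fin n) → ℝ}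
    (hf : AEMeasurable f (volume.restrict S.Ω)) (h0 : ∀ x, 0 ≤ f x) :
    AEMeasurable (fun x => S.Psi x (f x)) (volume.restrict S.Ω) := by
  have ha := S.a_uniformContinuous.continuousOn.aemeasurable S.isOpen.measurableSet (μ := volume)
  have hb := S.b_uniformContinuous.continuousOn.aemeasurable S.isOpen.measurableSet (μ := volume)
  exact ((aemeasurable_comp_of_continuousOn S.hG.continuousOn hf h0).add
    (ha.mul (aemeasurable_comp_of_continuousOn S.hHa.continuousOn hf h0))).add
    (hb.mul (aemeasurable_comp_of_continuousOn S.hHb.continuousOn hf h0))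

lemma aemeasurable_norm_grad {u : EuclideanSpace ℝ (Fin n) → ℝ}
    {Du : EuclideanSpace ℝ (Fin n) → EuclideanSpace ℝ (Fin n)} (h : HasWeakGradient S.Ω u Du) :
    AEMeasurable (fun x => ‖Du x‖) (volume.restrict S.Ω) :=
  h.grad_locallyIntegrable.aestronglyMeasurable.norm.aemeasurable

end OrliczMultiPhase.Setting

/-- The hole-filling iteration lemma. -/
lemma exists_iteration_bound {θ P : ℝ} (hθ0 : 0 ≤ θ) (hθ1 : θ < 1) (hP : 0 < P) :
    ∃ C : ℝ, 1 ≤ C ∧ ∀ (Z : ℝ → ℝ) (R₁ R₂ A M : ℝ), R₁ < R₂ → 0 ≤ A →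
      (∀ t ∈ Icc R₁ R₂, Z t ≤ M) →
      (∀ s t, R₁ ≤ s → s < t → t ≤ R₂ → Z s ≤ θ * Z t + A * ((R₂ - R₁) / (t - s)) ^ P) →
      Z R₁ ≤ C * A := by
  -- The radii approach `R₂` geometrically with ratio `τ`. As `τ^P = (1 + θ) / 2 > θ`, the blow-up
  -- `τ^(-iP)` of the error is beaten by `θ^i`, leaving a series of ratio `q < 1`.
  set τ : ℝ := ((1 + θ) / 2) ^ (1 / P) with hτ
  have hb0 : 0 < (1 + θ) / 2 := by linarith
  have hb1 : (1 + θ) / 2 < 1 := by linarith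
  have hτ0 : 0 < τ := by positivity
  have hτ1 : τ < 1 := Real.rpow_lt_one hb0.le hb1 (by positivity)
  have hτP : τ ^ P = (1 + θ) / 2 := by
    rw [hτ, ← Real.rpow_mul hb0.le, one_div_mul_cancel hP.ne', Real.rpow_one]
  set q : ℝ := θ / ((1 + θ) / 2) with hq
  have hq0 : 0 ≤ q := by positivity
  have hq1 : q < 1 := by rw [hq, div_lt_one hb0]; linarith
  set K : ℝ := (1 / (1 - τ)) ^ P with hK
  have h1τ : 0 < 1 - τ := by linarith
  have hK1 : 1 ≤ K := by
    refine Real.one_le_rpow ?_ hP.le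
    rw [one_le_div h1τ]; linarith
  have h1q : 0 < 1 - q := by linarith
  refine ⟨K * (1 / (1 - q)), ?_, fun Z R₁ R₂ A M hR hA hM hstep => ?_⟩
  · have : 1 ≤ 1 / (1 - q) := by rw [one_le_div h1q]; linarith
    nlinarith
  set T : ℕ → ℝ := fun i => R₂ - τ ^ i * (R₂ - R₁) with hT
  have hTmem : ∀ i, T i ∈ Icc R₁ R₂ := by
    intro i
    have h1 : τ ^ i ≤ 1 := pow_le_one₀ hτ0.le hτ1.le
    have h2 : 0 ≤ τ ^ i := by positivity
    constructor <;> simp only [hT] <;> nlinarith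
  have hTlt : ∀ i, T i < T (i + 1) := by
    intro i
    have h2 : 0 < τ ^ i := by positivity
    simp only [hT, pow_succ]
    nlinarith [mul_pos h2 (sub_pos.2 hR)]
  have hone : ∀ i, Z (T i) ≤ θ * Z (T (i + 1)) + A * (K * (1 / ((1 + θ) / 2)) ^ i) := by
    intro i
    have := hstep (T i) (T (i + 1)) (hTmem i).1 (hTlt i) (hTmem (i + 1)).2
    refine this.trans (le_of_eq ?_)
    have e : (R₂ - R₁) / (T (i + 1) - T i) = (1 / (1 - τ)) * (1 / τ ^ i) := by
      have h2 : 0 < τ ^ i := by positivity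
      have h3 : R₂ - R₁ ≠ 0 := by linarith
      have e1 : T (i + 1) - T i = (1 - τ) * τ ^ i * (R₂ - R₁) := by
        simp only [hT, pow_succ]; ring
      rw [e1]
      field_simp
    have e2 : (1 / τ ^ i) ^ P = (1 / ((1 + θ) / 2)) ^ i := by
      rw [← hτP, one_div, one_div, ← inv_pow, ← Real.rpow_natCast, ← Real.rpow_natCast,
        ← Real.rpow_mul (inv_pos.2 hτ0).le, ← Real.inv_rpow hτ0.le,
        ← Real.rpow_mul (inv_pos.2 hτ0).le, mul_comm]
    rw [e, Real.mul_rpow (by positivity) (by positivity), e2]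
  have hsum : ∀ i : ℕ, Z R₁ ≤ θ ^ i * Z (T i) + A * K * ∑ j ∈ Finset.range i, q ^ j := by
    intro i
    induction i with
    | zero => simp [hT]
    | succ i ih =>
      have h1 := mul_le_mul_of_nonneg_left (hone i) (pow_nonneg hθ0 i)
      rw [Finset.sum_range_succ, pow_succ]
      have e : θ ^ i * (A * (K * (1 / ((1 + θ) / 2)) ^ i)) = A * K * q ^ i := by
        rw [hq, one_div, inv_pow, div_pow θ]
        generalize ((1 + θ) / 2) ^ i = b
        ring
      nlinarith
  have hlim : Tendsto (fun i : ℕ => θ ^ i * M + A * K * (1 / (1 - q))) atTop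
      (𝓝 (0 * M + A * K * (1 / (1 - q)))) :=
    ((tendsto_pow_atTop_nhds_zero_of_lt_one hθ0 hθ1).mul_const M).add_const _
  have hfin : Z R₁ ≤ 0 * M + A * K * (1 / (1 - q)) := by
    refine ge_of_tendsto hlim (Eventually.of_forall fun i => (hsum i).trans ?_)
    refine add_le_add (mul_le_mul_of_nonneg_left (hM _ (hTmem i)) (pow_nonneg hθ0 i)) ?_
    refine mul_le_mul_of_nonneg_left ?_ (by positivity)
    rw [one_div, ← tsum_geometric_of_lt_one hq0 hq1]
    exact (summable_geometric_of_lt_one hq0 hq1).sum_le_tsum _ (fun j _ => by positivity)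
  linarith

namespace OrliczMultiPhase.Setting

variable {n : ℕ} (S : Setting n)

/-- `Ψ(x, t)` as an extended nonnegative real. -/
noncomputable def ePsi (x : EuclideanSpace ℝ (Fin n)) (t : ℝ) : ℝ≥0∞ := ENNReal.ofReal (S.Psi x t)

lemma aemeasurable_ePsi_grad {u : EuclideanSpace ℝ (Fin n) → ℝ}
    {Du : EuclideanSpace ℝ (Fin n) → EuclideanSpace ℝ (Fin n)} (h : HasWeakGradient S.Ω u Du) :
    AEMeasurable (fun x => S.ePsi x ‖Du x‖) (volume.restrict S.Ω) :=
  (S.aemeasurable_Psi (S.aemeasurable_norm_grad h) (fun _ => norm_nonneg _)).ennreal_ofReal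

/-- Comparison with the competitor `u - η (u - k)` on a ball. -/
lemma lintegral_ePsi_le_competitor {ν L : ℝ}
    {F : EuclideanSpace ℝ (Fin n) → ℝ → EuclideanSpace ℝ (Fin n) → ℝ}
    {u : EuclideanSpace ℝ (Fin n) → ℝ}
    {Du : EuclideanSpace ℝ (Fin n) → EuclideanSpace ℝ (Fin n)} (hn : 1 ≤ n)
    (hF : S.IsIntegrand ν L F) (hu : S.IsLocalMinimizer F u Du) {x₀ : EuclideanSpace ℝ (Fin n)}
    {t : ℝ} (ht : 0 < t) (hsub : Metric.closedBall x₀ t ⊆ S.Ω) {η : EuclideanSpace ℝ (Fin n) → ℝ}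
    (hη : ContDiff ℝ ((⊤ : ℕ∞) : WithTop ℕ∞) η) (hη0 : ∀ x, x ∉ Metric.ball x₀ t → η x = 0)
    (k : ℝ) :
    ENNReal.ofReal ν * ∫⁻ x in Metric.closedBall x₀ t, S.ePsi x ‖Du x‖ ≤
      ENNReal.ofReal L * ∫⁻ x in Metric.closedBall x₀ t,
        S.ePsi x ‖(1 - η x) • Du x - (u x - k) • gradVec η x‖ := by
  classical
  have : Nonempty (Fin n) := ⟨⟨0, hn⟩⟩
  set B := Metric.closedBall x₀ t with hB
  have hBm : MeasurableSet B := Metric.isClosed_closedBall.measurableSet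
  obtain ⟨D, hDc, hDd⟩ := TopologicalSpace.exists_countable_dense (EuclideanSpace ℝ (Fin n))
  set v₀ : EuclideanSpace ℝ (Fin n) → ℝ := fun x => u x - η x * (u x - k) with hv₀
  -- Minimality compares energies exactly on the closure of `{u ≠ v}`, and `v₀` might agree with `u`
  -- on a large set. Setting `v = u + 1` on a countable dense subset of the ball, a null set, makes
  -- that closure the whole closed ball without affecting the weak gradient.
  set v : EuclideanSpace ℝ (Fin n) → ℝ := fun x =>
    if x ∈ Metric.ball x₀ t ∩ D then u x + 1 else v₀ x with hv
  have hvv : v₀ =ᵐ[volume.restrict S.Ω] v := by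
    refine ae_restrict_of_ae ?_
    have : ∀ᵐ x, x ∉ D := hDc.ae_notMem volume
    filter_upwards [this] with x hx
    have : x ∉ Metric.ball x₀ t ∩ D := fun h => hx h.2
    simp only [hv, if_neg this]
  have hwg := (HasWeakGradient.cutoff S.isOpen hu.hasWeakGradient hη k).congr_ae hvv
  have hsupp : diffSupport S.Ω u v = B := by
    refine subset_antisymm (closure_minimal ?_ Metric.isClosed_closedBall) ?_
    · rintro x ⟨-, hx⟩
      by_contra hc
      have hxb : x ∉ Metric.ball x₀ t := fun h => hc (Metric.ball_subset_closedBall h)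
      have h2 : x ∉ Metric.ball x₀ t ∩ D := fun h => hxb h.1
      refine hx ?_
      simp only [hv, if_neg h2, hv₀, hη0 x hxb]
      ring
    · rw [hB, ← closure_ball x₀ ht.ne']
      refine closure_minimal ?_ isClosed_closure
      refine (hDd.open_subset_closure_inter Metric.isOpen_ball).trans (closure_mono ?_)
      intro x hx
      refine ⟨hsub (Metric.ball_subset_closedBall hx.1), ?_⟩
      simp only [hv, if_pos hx]
      linarith
  have hmin := hu.minimal v _ hwg (by rw [hsupp]; exact isCompact_closedBall _ _)
    (by rw [hsupp]; exact hsub)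
  rw [hsupp] at hmin
  calc ENNReal.ofReal ν * ∫⁻ x in B, S.ePsi x ‖Du x‖
      = ∫⁻ x in B, ENNReal.ofReal ν * S.ePsi x ‖Du x‖ :=
        (lintegral_const_mul' _ _ ENNReal.ofReal_ne_top).symm
    _ ≤ functional F u Du B := by
        refine setLIntegral_mono' hBm fun x hx => ?_
        rw [ePsi, ← ENNReal.ofReal_mul hF.ν_pos.le]
        exact ENNReal.ofReal_le_ofReal (hF.lower x (hsub hx) _ _)
    _ ≤ _ := hmin
    _ ≤ ∫⁻ x in B, ENNReal.ofReal L *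
          S.ePsi x ‖(1 - η x) • Du x - (u x - k) • gradVec η x‖ := by
        refine setLIntegral_mono' hBm fun x hx => ?_
        rw [ePsi, ← ENNReal.ofReal_mul (hF.ν_pos.le.trans hF.ν_le_L)]
        exact ENNReal.ofReal_le_ofReal (hF.upper x (hsub hx) _ _)
    _ = _ := lintegral_const_mul' _ _ ENNReal.ofReal_ne_top

/-- One hole-filling step. -/
lemma exists_hole_filling (hn : 1 ≤ n) {s Q : ℝ} (hs : 1 ≤ s) (hQ : 1 ≤ Q) :
    ∃ C : ℝ, 1 ≤ C ∧ ∀ (S : Setting n) (ν L : ℝ)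
      (F : EuclideanSpace ℝ (Fin n) → ℝ → EuclideanSpace ℝ (Fin n) → ℝ)
      (u : EuclideanSpace ℝ (Fin n) → ℝ)
      (Du : EuclideanSpace ℝ (Fin n) → EuclideanSpace ℝ (Fin n)) (x₀ : EuclideanSpace ℝ (Fin n))
      (r t k : ℝ), S.index ≤ s → L ≤ Q * ν → S.IsIntegrand ν L F → S.IsLocalMinimizer F u Du →
      0 ≤ r → r < t → Metric.closedBall x₀ t ⊆ S.Ω →
      ∫⁻ x in Metric.closedBall x₀ t, S.ePsi x ‖Du x‖ ≤
        ENNReal.ofReal C * (∫⁻ x in Metric.closedBall x₀ t \ Metric.closedBall x₀ r,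
          S.ePsi x ‖Du x‖) +
        ENNReal.ofReal C * ∫⁻ x in Metric.closedBall x₀ t, S.ePsi x (|u x - k| / (t - r)) := by
  obtain ⟨c, hc, hcut⟩ := exists_cutoff
  have h2 : (1 : ℝ) ≤ 2 ^ (1 + s) := Real.one_le_rpow one_le_two (by linarith)
  have hcs : 1 ≤ c ^ (1 + s) := Real.one_le_rpow hc (by linarith)
  have hC1 : 1 ≤ Q * 2 ^ (1 + s) := by nlinarith
  refine ⟨Q * 2 ^ (1 + s) * c ^ (1 + s), by nlinarith,
    fun S ν L F u Du x₀ r t k hSs hLν hF hu hr hrt hsub => ?_⟩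
  obtain ⟨η, hη, hη0, hη1, hηr, hηt, hηd⟩ := hcut n x₀ r t hr hrt
  have key := S.lintegral_ePsi_le_competitor hn hF hu (by linarith) hsub hη hηt k
  set B := Metric.closedBall x₀ t with hB
  have hBm : MeasurableSet B := Metric.isClosed_closedBall.measurableSet
  set I := ∫⁻ x in B, S.ePsi x ‖Du x‖ with hI
  set V := ∫⁻ x in B, S.ePsi x ‖(1 - η x) • Du x - (u x - k) • gradVec η x‖ with hV
  have h1 : I ≤ ENNReal.ofReal Q * V := by
    have h3 : ENNReal.ofReal ν * I ≤ ENNReal.ofReal ν * (ENNReal.ofReal Q * V) := by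
      refine key.trans ?_
      rw [← mul_assoc, ← ENNReal.ofReal_mul hF.ν_pos.le]
      gcongr
      linarith
    exact (ENNReal.mul_le_mul_iff_right (by simpa using hF.ν_pos) ENNReal.ofReal_ne_top).1 h3
  have hpt : ∀ x ∈ B, S.ePsi x ‖(1 - η x) • Du x - (u x - k) • gradVec η x‖ ≤
      (B \ Metric.closedBall x₀ r).indicator
        (fun x => ENNReal.ofReal (2 ^ (1 + s)) * S.ePsi x ‖Du x‖) x +
      ENNReal.ofReal (2 ^ (1 + s) * c ^ (1 + s)) * S.ePsi x (|u x - k| / (t - r)) := by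
    intro x hx
    have hG := (S.powerGrowth_Psi (hsub hx)).of_le hSs
    have htr : 0 < t - r := by linarith
    have hn1 : ‖(1 - η x) • Du x - (u x - k) • gradVec η x‖ ≤
        (1 - η x) * ‖Du x‖ + c * (|u x - k| / (t - r)) := by
      refine (norm_sub_le _ _).trans (add_le_add ?_ ?_)
      · rw [norm_smul, Real.norm_eq_abs, abs_of_nonneg (by linarith [hη1 x])]
      · rw [norm_smul, norm_gradVec, Real.norm_eq_abs]
        calc _ ≤ |u x - k| * (c / (t - r)) := by gcongr; exact hηd x
          _ = _ := by ring
    have hnn : 0 ≤ (1 - η x) * ‖Du x‖ := mul_nonneg (by linarith [hη1 x]) (norm_nonneg _)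
    have hq : 0 ≤ |u x - k| / (t - r) := by positivity
    have hle : S.Psi x ‖(1 - η x) • Du x - (u x - k) • gradVec η x‖ ≤
        2 ^ (1 + s) * S.Psi x ((1 - η x) * ‖Du x‖) +
          2 ^ (1 + s) * c ^ (1 + s) * S.Psi x (|u x - k| / (t - r)) := by
      refine (hG.le_of_le (norm_nonneg _) hn1).trans ?_
      refine (hG.add_le hnn (by positivity)).trans ?_
      have := hG.upper c _ hc hq
      have h5 : (0 : ℝ) ≤ 2 ^ (1 + s) := by positivity
      nlinarith
    -- On the inner ball `η = 1` removes `Du` altogether, so the gradient term survives only on the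
    -- annulus.
    have hstep : ENNReal.ofReal (2 ^ (1 + s) * S.Psi x ((1 - η x) * ‖Du x‖)) ≤
        (B \ Metric.closedBall x₀ r).indicator
        (fun x => ENNReal.ofReal (2 ^ (1 + s)) * S.ePsi x ‖Du x‖) x := by
      by_cases hxr : x ∈ Metric.closedBall x₀ r
      · rw [hηr x hxr]
        simp [hG.zero]
      · rw [indicator_of_mem (show x ∈ B \ Metric.closedBall x₀ r from ⟨hx, hxr⟩), ENNReal.ofReal_mul (by positivity), ePsi]
        gcongr
        refine hG.le_of_le hnn ?_
        nlinarith [hη0 x, norm_nonneg (Du x)]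
    calc _ ≤ ENNReal.ofReal (2 ^ (1 + s) * S.Psi x ((1 - η x) * ‖Du x‖) +
          2 ^ (1 + s) * c ^ (1 + s) * S.Psi x (|u x - k| / (t - r))) := ENNReal.ofReal_le_ofReal hle
      _ = ENNReal.ofReal (2 ^ (1 + s) * S.Psi x ((1 - η x) * ‖Du x‖)) +
          ENNReal.ofReal (2 ^ (1 + s) * c ^ (1 + s)) * S.ePsi x (|u x - k| / (t - r)) := by
          rw [ENNReal.ofReal_add (mul_nonneg (by positivity) (hG.nonneg hnn))
            (mul_nonneg (by positivity) (hG.nonneg hq)), ePsi, ← ENNReal.ofReal_mul (by positivity)]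
      _ ≤ _ := by gcongr
  have hmeas : AEMeasurable (fun x => (B \ Metric.closedBall x₀ r).indicator
      (fun x => ENNReal.ofReal (2 ^ (1 + s)) * S.ePsi x ‖Du x‖) x) (volume.restrict B) := by
    refine AEMeasurable.indicator ?_ (hBm.diff Metric.isClosed_closedBall.measurableSet)
    exact (((S.aemeasurable_ePsi_grad hu.hasWeakGradient).mono_measure
      (Measure.restrict_mono hsub le_rfl))).const_mul _
  have h3 : V ≤ ENNReal.ofReal (2 ^ (1 + s)) *
      (∫⁻ x in B \ Metric.closedBall x₀ r, S.ePsi x ‖Du x‖) +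
      ENNReal.ofReal (2 ^ (1 + s) * c ^ (1 + s)) *
        ∫⁻ x in B, S.ePsi x (|u x - k| / (t - r)) := by
    refine (setLIntegral_mono' hBm hpt).trans ?_
    rw [lintegral_add_left' hmeas, lintegral_const_mul' _ _ ENNReal.ofReal_ne_top,
      setLIntegral_indicator (hBm.diff Metric.isClosed_closedBall.measurableSet),
      inter_eq_left.2 sdiff_subset, lintegral_const_mul' _ _ ENNReal.ofReal_ne_top]
  refine h1.trans ((mul_le_mul_right h3 _).trans ?_)
  rw [mul_add, ← mul_assoc, ← mul_assoc, ← ENNReal.ofReal_mul (by positivity),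
    ← ENNReal.ofReal_mul (by positivity), ← mul_assoc]
  refine add_le_add (mul_le_mul_left (ENNReal.ofReal_le_ofReal ?_) _) le_rfl
  exact le_mul_of_one_le_right (by linarith) hcs

/-- The Caccioppoli inequality. -/
lemma exists_caccioppoli (hn : 1 ≤ n) {s Q : ℝ} (hs : 1 ≤ s) (hQ : 1 ≤ Q) :
    ∃ C : ℝ, 1 ≤ C ∧ ∀ (S : Setting n) (ν L : ℝ)
      (F : EuclideanSpace ℝ (Fin n) → ℝ → EuclideanSpace ℝ (Fin n) → ℝ)
      (u : EuclideanSpace ℝ (Fin n) → ℝ)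
      (Du : EuclideanSpace ℝ (Fin n) → EuclideanSpace ℝ (Fin n)) (x₀ : EuclideanSpace ℝ (Fin n))
      (R₁ R₂ k : ℝ), S.index ≤ s → L ≤ Q * ν → S.IsIntegrand ν L F → S.IsLocalMinimizer F u Du →
      0 ≤ R₁ → R₁ < R₂ → Metric.closedBall x₀ R₂ ⊆ S.Ω →
      ∫⁻ x in Metric.closedBall x₀ R₁, S.ePsi x ‖Du x‖ ≤
        ENNReal.ofReal C * ∫⁻ x in Metric.closedBall x₀ R₂, S.ePsi x (|u x - k| / (R₂ - R₁)) := by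
  obtain ⟨C₁, hC₁, hfill⟩ := exists_hole_filling hn hs hQ
  have h1C : 0 < C₁ := by linarith
  -- The hole-filling step reads `Z(t) ≤ C₁ (Z(t) - Z(r)) + C₁ (error)`; dividing by `C₁` gives
  -- `Z(r) ≤ (1 - 1/C₁) Z(t) + (error)`. The exponent `1 + s` comes from rescaling the argument of
  -- `Ψ`.
  obtain ⟨C, hC, hit⟩ := exists_iteration_bound (θ := 1 - 1 / C₁) (P := 1 + s)
    (sub_nonneg.2 ((div_le_one h1C).2 hC₁)) (by linarith [one_div_pos.2 h1C]) (by linarith)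
  refine ⟨C, hC, fun S ν L F u Du x₀ R₁ R₂ k hSs hLν hF hu hR₁ hR hsub => ?_⟩
  set W := ∫⁻ x in Metric.closedBall x₀ R₂, S.ePsi x (|u x - k| / (R₂ - R₁)) with hW
  by_cases hWt : W = ∞
  · rw [hWt, ENNReal.mul_top (by simp; linarith)]
    exact le_top
  set Z : ℝ → ℝ≥0∞ := fun t => ∫⁻ x in Metric.closedBall x₀ t, S.ePsi x ‖Du x‖ with hZ
  have hsubt : ∀ t, t ≤ R₂ → Metric.closedBall x₀ t ⊆ S.Ω := fun t ht =>
    (Metric.closedBall_subset_closedBall ht).trans hsub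
  have hZfin : ∀ t, t ≤ R₂ → Z t ≠ ∞ := fun t ht =>
    ((lintegral_mono_set (hsubt t ht)).trans_lt hu.energy_finite).ne
  have hmain := hit (fun t => (Z t).toReal) R₁ R₂ W.toReal (Z R₂).toReal hR ENNReal.toReal_nonneg
    (fun t ht => ENNReal.toReal_mono (hZfin R₂ le_rfl)
      (lintegral_mono_set (Metric.closedBall_subset_closedBall ht.2))) ?_
  · change Z R₁ ≤ _
    rw [← ENNReal.ofReal_toReal (hZfin R₁ hR.le), ← ENNReal.ofReal_toReal hWt,
      ← ENNReal.ofReal_mul (by linarith)]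
    exact ENNReal.ofReal_le_ofReal hmain
  · intro r t hr hrt ht
    have h1 := hfill S ν L F u Du x₀ r t k hSs hLν hF hu (hR₁.trans hr) hrt (hsubt t ht)
    set Dd := ∫⁻ x in Metric.closedBall x₀ t \ Metric.closedBall x₀ r, S.ePsi x ‖Du x‖ with hDd
    have hsplit : Z t = Z r + Dd := by
      have := lintegral_inter_add_sdiff (μ := volume) (fun x => S.ePsi x ‖Du x‖)
        (Metric.closedBall x₀ t) (B := Metric.closedBall x₀ r)
        Metric.isClosed_closedBall.measurableSet
      rw [inter_eq_right.2 (Metric.closedBall_subset_closedBall hrt.le)] at this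
      exact this.symm
    have hDfin : Dd ≠ ∞ := ((lintegral_mono_set sdiff_subset).trans_lt (hZfin t ht).lt_top).ne
    have htr : 0 < t - r := by linarith
    set l := (R₂ - R₁) / (t - r) with hl
    have hl1 : 1 ≤ l := by rw [hl, one_le_div htr]; linarith
    have hWle : ∫⁻ x in Metric.closedBall x₀ t, S.ePsi x (|u x - k| / (t - r)) ≤
        ENNReal.ofReal (l ^ (1 + s)) * W := by
      rw [hW, ← lintegral_const_mul' _ _ ENNReal.ofReal_ne_top]
      refine (lintegral_mono_set (Metric.closedBall_subset_closedBall ht)).trans ?_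
      refine setLIntegral_mono' Metric.isClosed_closedBall.measurableSet fun x hx => ?_
      have hG := (S.powerGrowth_Psi (hsub hx)).of_le hSs
      have hRR : 0 < R₂ - R₁ := by linarith
      have := hG.upper l (|u x - k| / (R₂ - R₁)) hl1 (by positivity)
      rw [ePsi, ePsi, ← ENNReal.ofReal_mul (by positivity)]
      refine ENNReal.ofReal_le_ofReal ?_
      have e : l * (|u x - k| / (R₂ - R₁)) = |u x - k| / (t - r) := by
        rw [hl]; field_simp
      rwa [e] at this
    have h2 := h1.trans (add_le_add_right (mul_le_mul_right hWle _) _)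
    have h3 : (Z t).toReal ≤ C₁ * Dd.toReal + C₁ * (l ^ (1 + s) * W.toReal) := by
      have h4 := ENNReal.toReal_mono (by finiteness) h2
      rwa [ENNReal.toReal_add (by finiteness) (by finiteness), ENNReal.toReal_mul,
        ENNReal.toReal_mul, ENNReal.toReal_mul, ENNReal.toReal_ofReal h1C.le,
        ENNReal.toReal_ofReal (by positivity)] at h4
    have h5 : (Z t).toReal = (Z r).toReal + Dd.toReal := by
      rw [hsplit, ENNReal.toReal_add (hZfin r (by linarith)) hDfin]
    have h6 : (Z t).toReal / C₁ ≤ Dd.toReal + l ^ (1 + s) * W.toReal := by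
      rw [div_le_iff₀ h1C]; linarith
    have h7 : (1 - 1 / C₁) * (Z t).toReal = (Z t).toReal - (Z t).toReal / C₁ := by ring
    rw [h7]
    linarith

end OrliczMultiPhase.Setting

/-! ### The Sobolev–Poincaré inequality. -/

section SobolevPoincare

variable {n : ℕ}

lemma enorm_sub_average_le {α : Type*} [MeasurableSpace α] {μ : Measure α} {B : Set α}
    (hB0 : μ B ≠ 0) (hBt : μ B ≠ ∞) {u : α → ℝ} (hu : IntegrableOn u B μ) (c : ℝ) :
    ‖c - ⨍ y in B, u y ∂μ‖ₑ ≤ (μ B)⁻¹ * ∫⁻ y in B, ‖c - u y‖ₑ ∂μ := by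
  have hpos : 0 < μ.real B := ENNReal.toReal_pos hB0 hBt
  have hci : IntegrableOn (fun _ => c) B μ := integrableOn_const hBt
  have e : c - ⨍ y in B, u y ∂μ = (μ.real B)⁻¹ * ∫ y in B, (c - u y) ∂μ := by
    rw [integral_sub hci hu, setIntegral_const, setAverage_eq, smul_eq_mul, smul_eq_mul]
    field_simp
  rw [e, enorm_mul, measureReal_def, ← ENNReal.toReal_inv,
    Real.enorm_eq_ofReal ENNReal.toReal_nonneg,
    ENNReal.ofReal_toReal (ENNReal.inv_ne_top.2 hB0)]
  gcongr
  exact enorm_integral_le_lintegral_enorm _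

lemma enorm_sub_average_le_of_ae_le {α : Type*} [MeasurableSpace α] {μ : Measure α} {B : Set α}
    (hB0 : μ B ≠ 0) (hBt : μ B ≠ ∞) {u : α → ℝ} (hu : IntegrableOn u B μ) {c : ℝ} {M : ℝ≥0∞}
    (h : ∀ᵐ y ∂(μ.restrict B), ‖c - u y‖ₑ ≤ M) : ‖c - ⨍ y in B, u y ∂μ‖ₑ ≤ M := by
  refine (enorm_sub_average_le hB0 hBt hu c).trans ?_
  calc (μ B)⁻¹ * ∫⁻ y in B, ‖c - u y‖ₑ ∂μ ≤ (μ B)⁻¹ * ∫⁻ y in B, M ∂μ := by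
        gcongr 1; exact lintegral_mono_ae h
    _ = M := by
        rw [setLIntegral_const, mul_comm M, ← mul_assoc, ENNReal.inv_mul_cancel hB0 hBt, one_mul]

/-- Hölder's inequality with respect to the measure `g dμ`. -/
lemma lintegral_mul_rpow_le {α : Type*} [MeasurableSpace α] {μ : Measure α} {g κ : α → ℝ≥0∞}
    (hg : AEMeasurable g μ) (hκ : AEMeasurable κ μ) {q : ℝ} (hq : 1 ≤ q) :
    (∫⁻ x, g x * κ x ∂μ) ^ q ≤ (∫⁻ x, g x ∂μ) ^ (q - 1) * ∫⁻ x, g x * κ x ^ q ∂μ := by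
  have hq0 : 0 < q := by linarith
  have h1 : 1 / q ≤ 1 := (div_le_one hq0).2 hq
  have key := ENNReal.lintegral_mul_norm_pow_le (μ := μ) hg (hg.mul (hκ.pow_const q))
    (p := 1 - 1 / q) (q := 1 / q) (by linarith) (by positivity) (by ring)
  have e : ∀ x, g x ^ (1 - 1 / q) * ((g * fun x => κ x ^ q) x) ^ (1 / q) = g x * κ x := by
    intro x
    rw [Pi.mul_apply, ENNReal.mul_rpow_of_nonneg _ _ (by positivity), ← mul_assoc,
      ← ENNReal.rpow_add_of_nonneg _ _ (by linarith) (by positivity), ← ENNReal.rpow_mul,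
      mul_one_div_cancel hq0.ne']
    simp
  simp_rw [e] at key
  have h2 := ENNReal.rpow_le_rpow key hq0.le
  rw [ENNReal.mul_rpow_of_nonneg _ _ hq0.le, ← ENNReal.rpow_mul, ← ENNReal.rpow_mul,
    one_div_mul_cancel hq0.ne', ENNReal.rpow_one] at h2
  have e2 : (1 - 1 / q) * q = q - 1 := by field_simp
  rw [e2] at h2
  exact h2

/-- The Sobolev-Poincaré inequality for functions of power growth. -/
lemma exists_sobolev_poincare (hn : 1 ≤ n) {s θ q : ℝ} (hθ : 1 ≤ θ * (1 + 1 / s))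
    (hθ1 : θ ≤ 1) (hq : 1 ≤ q) (hqn : (n - 1) * q < n) :
    ∃ C : ℝ, 1 ≤ C ∧ ∀ (Ω : Set (EuclideanSpace ℝ (Fin n))) (u : EuclideanSpace ℝ (Fin n) → ℝ)
      (Du : EuclideanSpace ℝ (Fin n) → EuclideanSpace ℝ (Fin n)) (A : ℝ → ℝ)
      (x₀ : EuclideanSpace ℝ (Fin n)) (r : ℝ), PowerGrowth A s → HasWeakGradient Ω u Du → 0 < r →
      Metric.closedBall x₀ (2 * r) ⊆ Ω →
      ∫⁻ x in Metric.closedBall x₀ (3 / 2 * r), ENNReal.ofReal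
          (A (|u x - ⨍ y in Metric.closedBall x₀ (3 / 2 * r), u y| / r) ^ (θ * q)) ≤
        ENNReal.ofReal (C * r ^ (n - n * q)) *
          (∫⁻ x in Metric.closedBall x₀ (2 * r), ENNReal.ofReal (A ‖Du x‖ ^ θ)) ^ q := by
  have hn' : (1 : ℝ) ≤ n := by exact_mod_cast hn
  have hV := unitBallVolume_pos (n := n)
  obtain ⟨C₀, hC₀, hpot⟩ := exists_potential_estimate (n := n) hn
  obtain ⟨C₁, hC₁, hk1⟩ := exists_lintegral_powerKernel_le (n := n) hn (β := (n : ℝ) - 1)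
    (by linarith) (by linarith)
  obtain ⟨C₂, hC₂, hk2⟩ := exists_lintegral_powerKernel_le (n := n) hn (β := ((n : ℝ) - 1) * q)
    (mul_nonneg (by linarith) (by linarith)) hqn
  set c : ℝ := max 1 (C₀ / unitBallVolume n) with hc
  have hc1 : 1 ≤ c := le_max_left _ _
  -- Bounds the mass of `r⁻¹ |x - z|^(1-n) dz` on the ball of radius `2r`: the kernel integrates to
  -- at most `C₁ * 2r`.
  set M : ℝ := 2 * C₁ with hM
  have hM1 : 1 ≤ M := by linarith
  set K : ℝ := (2 * c * M) ^ (1 + s) with hK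
  have hK0 : 0 < K := by positivity
  refine ⟨max 1 (K ^ q * (C₂ * (3 / 2) ^ (n - (n - 1) * q))), le_max_left _ _,
    fun Ω u Du A x₀ r hA h hr hsub => ?_⟩
  have hs := hA.one_le
  set B := Metric.closedBall x₀ (3 / 2 * r) with hB
  set B' := Metric.closedBall x₀ (2 * r) with hB'
  have hBm : MeasurableSet B := Metric.isClosed_closedBall.measurableSet
  have hBm' : MeasurableSet B' := Metric.isClosed_closedBall.measurableSet
  have hBB' : B ⊆ B' := Metric.closedBall_subset_closedBall (by linarith)
  set k := ⨍ y in B, u y with hk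
  have hui : IntegrableOn u B volume :=
    h.locallyIntegrable.integrableOn_compact_subset (hBB'.trans hsub) (isCompact_closedBall _ _)
  have hDum : AEMeasurable (fun x => ‖Du x‖) (volume.restrict B') :=
    (h.grad_locallyIntegrable.integrableOn_compact_subset hsub
      (isCompact_closedBall _ _)).aestronglyMeasurable.norm.aemeasurable
  have hvol : volume B = ENNReal.ofReal ((3 / 2 * r) ^ n * unitBallVolume n) :=
    volume_closedBall_eq x₀ (by positivity)
  have hV0 : 0 < (3 / 2 * r) ^ n * unitBallVolume n := by positivity
  set g : EuclideanSpace ℝ (Fin n) → ℝ≥0∞ := fun x => ENNReal.ofReal (A ‖Du x‖ ^ θ) with hg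
  have hgm : AEMeasurable g (volume.restrict B') :=
    ((Setting.aemeasurable_comp_of_continuousOn hA.cont hDum
      (fun _ => norm_nonneg _)).pow_const θ).ennreal_ofReal
  set κ : EuclideanSpace ℝ (Fin n) → EuclideanSpace ℝ (Fin n) → ℝ≥0∞ := fun x z =>
    powerKernel (n - 1) (x - z) with hκ
  have hκm : ∀ x, Measurable (κ x) := fun x =>
    (measurable_powerKernel _).comp (measurable_const.sub measurable_id)
  -- pointwise bound by the potential
  have hpt : ∀ᵐ x ∂(volume.restrict B), ENNReal.ofReal (A (|u x - k| / r) ^ θ) ≤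
      ENNReal.ofReal (K * r⁻¹) * ∫⁻ z in B', g z * κ x z := by
    filter_upwards [hpot Ω u Du x₀ (3 / 2 * r) (2 * r) h (by positivity) (by linarith) hsub]
      with x hx
    -- With this measure, of mass bounded independently of `r`, the potential estimate says `|u - k|
    -- / r ≤ c ∫ |Du| dμ`, and Jensen takes `A^θ` inside.
    set μ := (volume.restrict B').withDensity (fun z => ENNReal.ofReal r⁻¹ * κ x z) with hμ
    have hdens : Measurable (fun z => ENNReal.ofReal r⁻¹ * κ x z) := (hκm x).const_mul _
    have hmass : μ univ ≤ ENNReal.ofReal M := by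
      rw [hμ, withDensity_apply _ MeasurableSet.univ, Measure.restrict_univ,
        lintegral_const_mul _ (hκm x)]
      have h1 : ∫⁻ z in B', κ x z ≤ ENNReal.ofReal (C₁ * (2 * r) ^ ((n : ℝ) - (n - 1))) := by
        refine le_trans (le_of_eq ?_) (hk1 x₀ x (2 * r) (by positivity))
        refine lintegral_congr fun z => ?_
        rw [hκ, ← powerKernel_neg, neg_sub]
      refine (mul_le_mul_right h1 _).trans ?_
      rw [← ENNReal.ofReal_mul (by positivity)]
      refine ENNReal.ofReal_le_ofReal (le_of_eq ?_)
      rw [sub_sub_cancel, Real.rpow_one, hM]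
      field_simp
    refine (hA.jensen (μ := μ) hM1 hmass hc1 hθ hθ1 (f := fun z => ‖Du z‖)
      (fun _ => norm_nonneg _) (by positivity) ?_).trans (le_of_eq ?_)
    · have h1 := enorm_sub_average_le (by rw [hvol]; simpa using hV0)
        (by rw [hvol]; exact ENNReal.ofReal_ne_top) hui (u x)
      have h2 : ENNReal.ofReal (|u x - k| / r) ≤ ENNReal.ofReal r⁻¹ * ((volume B)⁻¹ *
          (ENNReal.ofReal (C₀ * (3 / 2 * r) ^ n) * ∫⁻ z in B', ‖Du z‖ₑ * κ x z)) := by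
        rw [div_eq_mul_inv, mul_comm, ENNReal.ofReal_mul (by positivity), ← Real.norm_eq_abs,
          ofReal_norm]
        gcongr
        refine h1.trans ?_
        gcongr
      refine h2.trans ?_
      have h3 : (∫⁻ z, ENNReal.ofReal ‖Du z‖ ∂μ) =
          ENNReal.ofReal r⁻¹ * ∫⁻ z in B', ‖Du z‖ₑ * κ x z := by
        rw [hμ, lintegral_withDensity_eq_lintegral_mul₀ hdens.aemeasurable hDum.ennreal_ofReal,
          ← lintegral_const_mul' _ _ ENNReal.ofReal_ne_top]
        refine lintegral_congr fun z => ?_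
        rw [Pi.mul_apply, ofReal_norm]; ring
      rw [h3, hvol, ← ENNReal.ofReal_inv_of_pos hV0]
      have e1 : ∀ I : ℝ≥0∞, ENNReal.ofReal r⁻¹ * (ENNReal.ofReal
          ((3 / 2 * r) ^ n * unitBallVolume n)⁻¹ * (ENNReal.ofReal (C₀ * (3 / 2 * r) ^ n) * I)) =
          ENNReal.ofReal (C₀ / unitBallVolume n) * (ENNReal.ofReal r⁻¹ * I) := by
        intro I
        have : C₀ / unitBallVolume n = ((3 / 2 * r) ^ n * unitBallVolume n)⁻¹ *
            (C₀ * (3 / 2 * r) ^ n) := by field_simp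
        rw [this, ENNReal.ofReal_mul (p := ((3 / 2 * r) ^ n * unitBallVolume n)⁻¹) (by positivity)]
        generalize ENNReal.ofReal ((3 / 2 * r) ^ n * unitBallVolume n)⁻¹ = x1
        generalize ENNReal.ofReal (C₀ * (3 / 2 * r) ^ n) = x2
        ring
      rw [e1]
      exact mul_le_mul_left (ENNReal.ofReal_le_ofReal (le_max_right _ _)) _
    · rw [hμ, lintegral_withDensity_eq_lintegral_mul₀ hdens.aemeasurable, ← hK,
        ENNReal.ofReal_mul hK0.le, mul_assoc]
      · congr 1
        rw [← lintegral_const_mul' _ _ ENNReal.ofReal_ne_top]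
        refine lintegral_congr fun z => ?_
        simp only [Pi.mul_apply, hg]; ring
      · exact hgm
  have hκq : ∀ x z, κ x z ^ q = powerKernel (((n : ℝ) - 1) * q) (x - z) := by
    intro x z
    rw [hκ]
    simp only [powerKernel]
    rw [ENNReal.ofReal_rpow_of_nonneg (by positivity) (by linarith),
      ← Real.rpow_mul (norm_nonneg _), neg_mul]
  have hq0 : 0 < q := by linarith
  set Y := ∫⁻ z in B', g z with hY
  -- The pointwise bound is raised to the power `q`, using Hölder for the measure `g dz`; Tonelli
  -- then integrates `κ^q` in `x`, which is finite because `(n - 1) q < n`. The powers of `r`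
  -- combine as `-q + n - (n - 1) q = n - n q`.
  calc ∫⁻ x in B, ENNReal.ofReal (A (|u x - k| / r) ^ (θ * q))
      ≤ ∫⁻ x in B, ENNReal.ofReal ((K * r⁻¹) ^ q) *
          (Y ^ (q - 1) * ∫⁻ z in B', g z * powerKernel (((n : ℝ) - 1) * q) (x - z)) := by
        refine lintegral_mono_ae ?_
        filter_upwards [hpt] with x hx
        have hAn := hA.nonneg (t := |u x - k| / r) (by positivity)
        rw [Real.rpow_mul hAn, ← ENNReal.ofReal_rpow_of_nonneg (by positivity) hq0.le,
          ← ENNReal.ofReal_rpow_of_nonneg (by positivity) hq0.le]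
        refine (ENNReal.rpow_le_rpow hx hq0.le).trans ?_
        rw [ENNReal.mul_rpow_of_nonneg _ _ hq0.le]
        gcongr
        refine (lintegral_mul_rpow_le hgm (hκm x).aemeasurable hq).trans (le_of_eq ?_)
        simp_rw [hκq]
        rfl
    _ ≤ ENNReal.ofReal ((K * r⁻¹) ^ q) * (Y ^ (q - 1) *
          (ENNReal.ofReal (C₂ * (3 / 2 * r) ^ (n - ((n : ℝ) - 1) * q)) * Y)) := by
        have hJm : AEMeasurable (Function.uncurry fun (x z : EuclideanSpace ℝ (Fin n)) =>
            g z * powerKernel (((n : ℝ) - 1) * q) (x - z))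
            ((volume.restrict B).prod (volume.restrict B')) :=
          (hgm.comp_snd).mul ((measurable_powerKernel _).comp
            (measurable_fst.sub measurable_snd)).aemeasurable
        have hJ : AEMeasurable (fun x => ∫⁻ z in B', g z *
            powerKernel (((n : ℝ) - 1) * q) (x - z)) (volume.restrict B) :=
          hJm.lintegral_prod_right'
        rw [lintegral_const_mul' _ _ ENNReal.ofReal_ne_top, lintegral_const_mul'' _ hJ,
          lintegral_lintegral_swap hJm]
        gcongr
        rw [← lintegral_const_mul' _ _ ENNReal.ofReal_ne_top]
        refine lintegral_mono fun z => ?_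
        rw [lintegral_const_mul' _ _ (by simp only [hg]; exact ENNReal.ofReal_ne_top), mul_comm]
        gcongr
        exact hk2 x₀ z (3 / 2 * r) (by positivity)
    _ = ENNReal.ofReal ((K * r⁻¹) ^ q * (C₂ * (3 / 2 * r) ^ (n - ((n : ℝ) - 1) * q))) * Y ^ q := by
        have e : Y ^ q = Y ^ (q - 1) * Y := by
          conv_rhs => rw [← ENNReal.rpow_one Y, ← ENNReal.rpow_mul, one_mul,
            ← ENNReal.rpow_add_of_nonneg _ _ (by linarith) zero_le_one]
          rw [sub_add_cancel]
        rw [ENNReal.ofReal_mul (p := (K * r⁻¹) ^ q) (by positivity), e]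
        generalize ENNReal.ofReal ((K * r⁻¹) ^ q) = x1
        generalize ENNReal.ofReal (C₂ * (3 / 2 * r) ^ (n - ((n : ℝ) - 1) * q)) = x2
        ring
    _ ≤ _ := by
        refine mul_le_mul_left (ENNReal.ofReal_le_ofReal ?_) _
        calc (K * r⁻¹) ^ q * (C₂ * (3 / 2 * r) ^ (n - ((n : ℝ) - 1) * q))
            = (K ^ q * (C₂ * (3 / 2) ^ (n - ((n : ℝ) - 1) * q))) * r ^ (n - n * q) := by
              rw [Real.mul_rpow hK0.le (by positivity), Real.mul_rpow (by norm_num) hr.le,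
                Real.inv_rpow hr.le, ← Real.rpow_neg hr.le]
              have : r ^ ((n : ℝ) - n * q) = r ^ (-q) * r ^ (n - ((n : ℝ) - 1) * q) := by
                rw [← Real.rpow_add hr]; congr 1; ring
              rw [this]; ring
          _ ≤ _ := mul_le_mul_of_nonneg_right (le_max_right _ _) (by positivity)

/-- Jensen's inequality in the form used to lower the exponent of an integral mean. -/
lemma lintegral_rpow_le_mul_measure {α : Type*} [MeasurableSpace α] {μ : Measure α}
    {f : α → ℝ≥0∞} (hf : AEMeasurable f μ) {θ : ℝ} (hθ0 : 0 ≤ θ) (hθ1 : θ ≤ 1) :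
    ∫⁻ x, f x ^ θ ∂μ ≤ (∫⁻ x, f x ∂μ) ^ θ * μ univ ^ (1 - θ) := by
  have := ENNReal.lintegral_mul_norm_pow_le (μ := μ) hf (aemeasurable_const (b := (1 : ℝ≥0∞)))
    (p := θ) (q := 1 - θ) hθ0 (by linarith) (by ring)
  simpa using this

end SobolevPoincare

/-! ### The reverse Hölder inequality. -/

/-- An exponent below one that is admissible in both the Jensen and the Sobolev inequalities. -/
lemma exists_reverseHolder_exponent {n : ℕ} (hn : 2 ≤ n) {s : ℝ} (hs : 1 ≤ s) :
    ∃ θ : ℝ, 0 < θ ∧ θ < 1 ∧ 1 ≤ θ * (1 + 1 / s) ∧ ((n : ℝ) - 1) * ((1 + 1 / n) / θ) < n := by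
  have hn' : (2 : ℝ) ≤ n := by exact_mod_cast hn
  have hs0 : 0 < s := by linarith
  have h1 : 0 < s / (1 + s) := by positivity
  have hn2 : 0 < 1 / (2 * (n : ℝ) ^ 2) := by positivity
  -- The first entry is the Jensen threshold. For the second, `(n - 1)(1 + 1/n) = n (1 - 1/n²)`, so
  -- the Sobolev condition is `θ > 1 - 1/n²`.
  refine ⟨max (s / (1 + s)) (1 - 1 / (2 * (n : ℝ) ^ 2)), lt_max_of_lt_left h1,
    max_lt ((div_lt_one (by linarith)).2 (by linarith)) (by linarith), ?_, ?_⟩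
  · calc (1 : ℝ) = s / (1 + s) * (1 + 1 / s) := by field_simp; ring
      _ ≤ _ := by gcongr; exact le_max_left _ _
  · rw [← mul_div_assoc, div_lt_iff₀ (lt_max_of_lt_left h1)]
    have e : ((n : ℝ) - 1) * (1 + 1 / n) = n * (1 - 2 * (1 / (2 * (n : ℝ) ^ 2))) := by
      field_simp; ring
    rw [e]
    have : 1 - 2 * (1 / (2 * (n : ℝ) ^ 2)) < max (s / (1 + s)) (1 - 1 / (2 * (n : ℝ) ^ 2)) :=
      lt_of_lt_of_le (by linarith) (le_max_right _ _)
    have hn0 : (0 : ℝ) < n := by linarith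
    exact mul_lt_mul_of_pos_left this hn0

namespace OrliczMultiPhase.Setting

variable {n : ℕ}

/-- The reverse Hölder inequality under a comparison of `Ψ(x, ·)` with a frozen function. -/
lemma exists_reverseHolder (hn : 2 ≤ n) {s Q θ K₁ K₂ N : ℝ} (hs : 1 ≤ s) (hQ : 1 ≤ Q)
    (hθ0 : 0 < θ) (hθ1 : θ < 1) (hθs : 1 ≤ θ * (1 + 1 / s))
    (hθn : ((n : ℝ) - 1) * ((1 + 1 / n) / θ) < n) (hK₁ : 0 ≤ K₁) (hK₂ : 0 ≤ K₂) (hN : 0 ≤ N) :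
    ∃ C : ℝ, 1 ≤ C ∧ ∀ (S : Setting n) (ν L : ℝ)
      (F : EuclideanSpace ℝ (Fin n) → ℝ → EuclideanSpace ℝ (Fin n) → ℝ)
      (u : EuclideanSpace ℝ (Fin n) → ℝ)
      (Du : EuclideanSpace ℝ (Fin n) → EuclideanSpace ℝ (Fin n)) (x₀ : EuclideanSpace ℝ (Fin n))
      (r α β : ℝ), S.index ≤ s → L ≤ Q * ν → S.IsIntegrand ν L F → S.IsLocalMinimizer F u Du →
      0 < r → Metric.closedBall x₀ (2 * r) ⊆ S.Ω → 0 ≤ α → 0 ≤ β →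
      (∀ x ∈ Metric.closedBall x₀ (2 * r), α ≤ S.a x ∧ β ≤ S.b x) →
      (∀ᵐ x ∂(volume.restrict (Metric.closedBall x₀ (3 / 2 * r))),
        ∀ U, U = |u x - ⨍ y in Metric.closedBall x₀ (3 / 2 * r), u y| / r →
        S.Psi x U ≤ K₁ * S.frozenPsi α β U + K₂ * r * S.frozenPsi α β U ^ (1 + 1 / (n : ℝ))) →
      ENNReal.ofReal K₂ * (∫⁻ x in S.Ω, S.ePsi x ‖Du x‖) ^ (1 / (n : ℝ)) ≤ ENNReal.ofReal N →
      ∫⁻ x in Metric.closedBall x₀ r, S.ePsi x ‖Du x‖ ≤ ENNReal.ofReal (C * r ^ (n - n * (1 / θ))) *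
        (∫⁻ x in Metric.closedBall x₀ (2 * r), S.ePsi x ‖Du x‖ ^ θ) ^ (1 / θ) := by
  have hn' : (2 : ℝ) ≤ n := by exact_mod_cast hn
  have hn0 : (0 : ℝ) < n := by linarith
  have hV := unitBallVolume_pos (n := n)
  have hθi : 1 < 1 / θ := (one_lt_div hθ0).2 hθ1
  have hθi0 : 0 < 1 / θ := by linarith
  have hq2 : 1 / θ ≤ (1 + 1 / n) / θ := by gcongr; linarith [one_div_pos.2 hn0]
  obtain ⟨C₀, hC₀, hcacc⟩ := exists_caccioppoli (n := n) (by omega) hs hQ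
  obtain ⟨C₁, hC₁, hsp1⟩ := exists_sobolev_poincare (n := n) (by omega) hθs hθ1.le hθi.le
    (lt_of_le_of_lt (mul_le_mul_of_nonneg_left hq2 (by linarith)) hθn)
  obtain ⟨C₂, hC₂, hsp2⟩ := exists_sobolev_poincare (n := n) (by omega) hθs hθ1.le
    (hθi.le.trans hq2) hθn
  set W : ℝ := (2 ^ n * unitBallVolume n) ^ ((1 - θ) * (1 / (n * θ))) with hW
  have hW0 : 0 < W := by positivity
  refine ⟨max 1 (C₀ * 2 ^ (1 + s) * (K₁ * C₁ + N * W * C₂)), le_max_left _ _,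
    fun S ν L F u Du x₀ r α β hSs hLν hF hu hr hsub hα hβ hαβ hcomp hKN => ?_⟩
  set B := Metric.closedBall x₀ (3 / 2 * r) with hB
  set B' := Metric.closedBall x₀ (2 * r) with hB'
  have hBm : MeasurableSet B := Metric.isClosed_closedBall.measurableSet
  have hBm' : MeasurableSet B' := Metric.isClosed_closedBall.measurableSet
  have hBB' : B ⊆ B' := Metric.closedBall_subset_closedBall (by linarith)
  set k := ⨍ y in B, u y with hk
  have hw := hu.hasWeakGradient
  have hA : PowerGrowth (S.frozenPsi α β) s := (S.powerGrowth_frozenPsi hα hβ).of_le hSs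
  set A := S.frozenPsi α β with hAdef
  set Y := ∫⁻ x in B', S.ePsi x ‖Du x‖ ^ θ with hY
  have hAΨ : ∀ x ∈ B', ∀ t, 0 ≤ t → A t ≤ S.Psi x t := by
    intro x hx t ht
    have := hαβ x hx
    have h1 := S.hHa.nonneg ht
    have h2 := S.hHb.nonneg ht
    rw [hAdef, frozenPsi, Psi]
    gcongr
    · exact this.1
    · exact this.2
  have hYA : ∫⁻ x in B', ENNReal.ofReal (A ‖Du x‖ ^ θ) ≤ Y := by
    refine setLIntegral_mono' hBm' fun x hx => ?_
    rw [← ENNReal.ofReal_rpow_of_nonneg (hA.nonneg (norm_nonneg _)) hθ0.le]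
    exact ENNReal.rpow_le_rpow (ENNReal.ofReal_le_ofReal (hAΨ x hx _ (norm_nonneg _))) hθ0.le
  have hmu : AEMeasurable (fun x => |u x - k| / r) (volume.restrict B) := by
    have h1 : AEMeasurable u (volume.restrict B) :=
      (hw.locallyIntegrable.integrableOn_compact_subset (hBB'.trans hsub)
        (isCompact_closedBall _ _)).aestronglyMeasurable.aemeasurable
    exact ((continuous_abs.measurable.comp_aemeasurable (h1.sub_const k))).div_const r
  -- The exponent `q = 1/θ` recovers `A` itself; `q = (1 + 1/n)/θ` below recovers `A^(1 + 1/n)`.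
  have hI1 : ∫⁻ x in B, ENNReal.ofReal (A (|u x - k| / r)) ≤
      ENNReal.ofReal (C₁ * r ^ (n - n * (1 / θ))) * Y ^ (1 / θ) := by
    have h1 := hsp1 S.Ω u Du A x₀ r hA hw hr hsub
    rw [mul_one_div_cancel hθ0.ne'] at h1
    simp_rw [Real.rpow_one] at h1
    refine h1.trans ?_
    gcongr
  have hI2 : ∫⁻ x in B, ENNReal.ofReal (A (|u x - k| / r) ^ (1 + 1 / (n : ℝ))) ≤
      ENNReal.ofReal (C₂ * r ^ (n - n * ((1 + 1 / n) / θ))) * Y ^ ((1 + 1 / n) / θ) := by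
    have h1 := hsp2 S.Ω u Du A x₀ r hA hw hr hsub
    rw [mul_div_cancel₀ _ hθ0.ne'] at h1
    refine h1.trans ?_
    gcongr
  have hYE : Y ≤ (∫⁻ x in S.Ω, S.ePsi x ‖Du x‖) ^ θ *
      ENNReal.ofReal ((2 * r) ^ n * unitBallVolume n) ^ (1 - θ) := by
    have h1 := lintegral_rpow_le_mul_measure (μ := volume.restrict B')
      ((S.aemeasurable_ePsi_grad hw).mono_measure (Measure.restrict_mono hsub le_rfl))
      hθ0.le hθ1.le
    rw [Measure.restrict_apply_univ, volume_closedBall_eq x₀ (by positivity)] at h1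
    refine h1.trans ?_
    gcongr
  -- The second estimate carries a surplus `Y^(1/(nθ))`. Lowering the exponent by Hölder bounds it
  -- by the `1/n`-th power of the energy times `W r^(1/θ - 1)`, and all powers of `r` cancel,
  -- including the factor `r` of the comparison.
  have hY2 : ENNReal.ofReal (K₂ * r * r ^ (-(1 / θ))) * Y ^ (1 / (n * θ)) ≤
      ENNReal.ofReal (N * W) := by
    have h1 : Y ^ (1 / (n * θ)) ≤ (∫⁻ x in S.Ω, S.ePsi x ‖Du x‖) ^ (1 / (n : ℝ)) *
        ENNReal.ofReal (W * r ^ (1 / θ - 1)) := by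
      refine (ENNReal.rpow_le_rpow hYE (by positivity)).trans (le_of_eq ?_)
      rw [ENNReal.mul_rpow_of_nonneg _ _ (by positivity), ← ENNReal.rpow_mul, ← ENNReal.rpow_mul,
        ENNReal.ofReal_rpow_of_nonneg (by positivity) (mul_nonneg (by linarith) (by positivity))]
      congr 2
      · field_simp
      · rw [hW, mul_pow, mul_right_comm, Real.mul_rpow (by positivity) (by positivity),
          ← Real.rpow_natCast r n, ← Real.rpow_mul hr.le]
        congr 2
        field_simp
    calc ENNReal.ofReal (K₂ * r * r ^ (-(1 / θ))) * Y ^ (1 / (n * θ))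
        ≤ ENNReal.ofReal (K₂ * r * r ^ (-(1 / θ))) *
          ((∫⁻ x in S.Ω, S.ePsi x ‖Du x‖) ^ (1 / (n : ℝ)) * ENNReal.ofReal (W * r ^ (1 / θ - 1))) :=
          by gcongr
      _ = (ENNReal.ofReal K₂ * (∫⁻ x in S.Ω, S.ePsi x ‖Du x‖) ^ (1 / (n : ℝ))) *
          (ENNReal.ofReal (r * r ^ (-(1 / θ))) * ENNReal.ofReal (W * r ^ (1 / θ - 1))) := by
          rw [mul_assoc K₂, ENNReal.ofReal_mul hK₂]
          ring
      _ ≤ ENNReal.ofReal N * ENNReal.ofReal W := by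
          rw [← ENNReal.ofReal_mul (by positivity)]
          gcongr
          refine le_of_eq ?_
          have : r * r ^ (-(1 / θ)) * r ^ (1 / θ - 1) = 1 := by
            nth_rewrite 1 [← Real.rpow_one r]
            rw [← Real.rpow_add hr, ← Real.rpow_add hr,
              show (1 : ℝ) + -(1 / θ) + (1 / θ - 1) = 0 by ring, Real.rpow_zero]
          linear_combination W * this
      _ = _ := (ENNReal.ofReal_mul hN).symm
  have hΨ : ∀ᵐ x ∂(volume.restrict B), S.ePsi x (|u x - k| / (3 / 2 * r - r)) ≤
      ENNReal.ofReal (2 ^ (1 + s)) * (ENNReal.ofReal K₁ * ENNReal.ofReal (A (|u x - k| / r)) +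
        ENNReal.ofReal (K₂ * r) * ENNReal.ofReal (A (|u x - k| / r) ^ (1 + 1 / (n : ℝ)))) := by
    filter_upwards [hcomp, ae_restrict_mem hBm] with x hx hxB
    have hA0 := hA.nonneg (t := |u x - k| / r) (by positivity)
    rw [← ENNReal.ofReal_mul hK₁, ← ENNReal.ofReal_mul (by positivity),
      ← ENNReal.ofReal_add (by positivity) (by positivity), ← ENNReal.ofReal_mul (by positivity)]
    refine ENNReal.ofReal_le_ofReal ?_
    have e : |u x - k| / (3 / 2 * r - r) = 2 * (|u x - k| / r) := by
      rw [show 3 / 2 * r - r = r / 2 by ring]; field_simp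
    rw [e]
    refine (((S.powerGrowth_Psi (hsub (hBB' hxB))).of_le hSs).upper 2 _ (by norm_num)
      (by positivity)).trans ?_
    gcongr
    exact hx _ rfl
  calc ∫⁻ x in Metric.closedBall x₀ r, S.ePsi x ‖Du x‖
      ≤ ENNReal.ofReal C₀ * ∫⁻ x in B, S.ePsi x (|u x - k| / (3 / 2 * r - r)) :=
        hcacc S ν L F u Du x₀ r (3 / 2 * r) k hSs hLν hF hu hr.le (by linarith) (hBB'.trans hsub)
    _ ≤ ENNReal.ofReal C₀ * (ENNReal.ofReal (2 ^ (1 + s)) *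
          (ENNReal.ofReal K₁ * (∫⁻ x in B, ENNReal.ofReal (A (|u x - k| / r))) +
            ENNReal.ofReal (K₂ * r) *
              ∫⁻ x in B, ENNReal.ofReal (A (|u x - k| / r) ^ (1 + 1 / (n : ℝ))))) := by
        gcongr
        refine (lintegral_mono_ae hΨ).trans (le_of_eq ?_)
        have hm := (aemeasurable_comp_of_continuousOn hA.cont hmu
          (fun _ => by positivity)).ennreal_ofReal
        rw [lintegral_const_mul' _ _ ENNReal.ofReal_ne_top, lintegral_add_left' (hm.const_mul _),
          lintegral_const_mul' _ _ ENNReal.ofReal_ne_top,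
          lintegral_const_mul' _ _ ENNReal.ofReal_ne_top]
    _ ≤ ENNReal.ofReal C₀ * (ENNReal.ofReal (2 ^ (1 + s)) *
          (ENNReal.ofReal K₁ * (ENNReal.ofReal (C₁ * r ^ (n - n * (1 / θ))) * Y ^ (1 / θ)) +
            ENNReal.ofReal (N * W) *
              (ENNReal.ofReal (C₂ * r ^ (n - n * (1 / θ))) * Y ^ (1 / θ)))) := by
        gcongr _ * (_ * (_ * ?_ + ?_))
        refine (mul_le_mul_right hI2 _).trans ?_
        have e1 : Y ^ ((1 + 1 / n) / θ) = Y ^ (1 / (n * θ)) * Y ^ (1 / θ) := by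
          rw [← ENNReal.rpow_add_of_nonneg _ _ (by positivity) (by positivity)]
          congr 1; field_simp; ring
        have e2 : r ^ ((n : ℝ) - n * ((1 + 1 / n) / θ)) =
            r ^ (-(1 / θ)) * r ^ ((n : ℝ) - n * (1 / θ)) := by
          rw [← Real.rpow_add hr]; congr 1; field_simp; ring
        calc ENNReal.ofReal (K₂ * r) *
              (ENNReal.ofReal (C₂ * r ^ (n - n * ((1 + 1 / n) / θ))) * Y ^ ((1 + 1 / n) / θ))
            = (ENNReal.ofReal (K₂ * r * r ^ (-(1 / θ))) * Y ^ (1 / (n * θ))) *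
              (ENNReal.ofReal (C₂ * r ^ (n - n * (1 / θ))) * Y ^ (1 / θ)) := by
              rw [e1, e2, mul_left_comm C₂, ENNReal.ofReal_mul (p := r ^ (-(1 / θ))) (by positivity),
                ENNReal.ofReal_mul (p := K₂ * r) (by positivity)]
              generalize ENNReal.ofReal (C₂ * r ^ (n - n * (1 / θ))) = x1
              generalize ENNReal.ofReal (K₂ * r) = x2
              ring
          _ ≤ _ := by gcongr
    _ = ENNReal.ofReal (C₀ * 2 ^ (1 + s) * (K₁ * C₁ + N * W * C₂) * r ^ (n - n * (1 / θ))) *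
          Y ^ (1 / θ) := by
        have hrp : 0 ≤ r ^ (n - n * (1 / θ)) := by positivity
        generalize r ^ (n - n * (1 / θ)) = ρ at hrp
        have : C₀ * 2 ^ (1 + s) * (K₁ * C₁ + N * W * C₂) * ρ =
            C₀ * (2 ^ (1 + s) * (K₁ * (C₁ * ρ) + N * W * (C₂ * ρ))) := by ring
        rw [this]
        have h1 : 0 ≤ C₁ * ρ := by positivity
        have h2 : 0 ≤ C₂ * ρ := by positivity
        have h3 : 0 ≤ N * W := by positivity
        generalize C₁ * ρ = x1 at h1
        generalize C₂ * ρ = x2 at h2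
        generalize N * W = x3 at h3
        rw [ENNReal.ofReal_mul (p := C₀) (by linarith),
          ENNReal.ofReal_mul (p := 2 ^ (1 + s)) (by positivity),
          ENNReal.ofReal_add (by positivity) (by positivity), ENNReal.ofReal_mul hK₁,
          ENNReal.ofReal_mul h3]
        ring
    _ ≤ _ := by
        refine mul_le_mul_left (ENNReal.ofReal_le_ofReal ?_) _
        exact mul_le_mul_of_nonneg_right (le_max_right _ _) (by positivity)

end OrliczMultiPhase.Setting

/-! ### Comparison of `Ψ` with a frozen Young function. -/

namespace OrliczMultiPhase.IsConcaveModulus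

variable {σ : ℝ → ℝ} (h : IsConcaveModulus σ)
include h

/-- Were `σ` to decrease somewhere, concavity would keep it below a line of negative slope from
there on and make it negative eventually. -/
lemma mono {x y : ℝ} (hx : 0 ≤ x) (hxy : x ≤ y) : σ x ≤ σ y := by
  rcases hxy.eq_or_lt with rfl | hxy
  · exact le_rfl
  by_contra! hlt
  set m := (σ x - σ y) / (y - x) with hm
  have hm0 : 0 < m := div_pos (by linarith) (by linarith)
  set z := y + (σ y + 1) / m with hz
  have hy0 := h.nonneg y (by linarith)
  have hyz : y < z := by
    have : 0 < (σ y + 1) / m := by positivity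
    linarith
  have h1 := h.concave.slope_anti_adjacent (mem_Ici.2 hx) (mem_Ici.2 (by linarith : 0 ≤ z)) hxy hyz
  have h2 : (σ y - σ x) / (y - x) = -m := by rw [hm]; ring
  rw [h2, div_le_iff₀ (by linarith)] at h1
  have h3 : m * (z - y) = σ y + 1 := by rw [hz]; field_simp; ring
  have h4 := h.nonneg z (by linarith)
  linarith

lemma le_mul {l t : ℝ} (hl : 1 ≤ l) (ht : 0 ≤ t) : σ (l * t) ≤ l * σ t := by
  have hl0 : 0 < l := by linarith
  have h1 := h.concave.2 (mem_Ici.2 (by positivity : 0 ≤ l * t)) (mem_Ici.2 le_rfl)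
    (inv_nonneg.2 hl0.le) (sub_nonneg.2 (inv_le_one_of_one_le₀ hl)) (add_sub_cancel _ _)
  simp only [smul_eq_mul, h.zero, mul_zero, add_zero] at h1
  rw [inv_mul_cancel_left₀ hl0.ne', inv_mul_le_iff₀ hl0] at h1
  exact h1

lemma le_one_add_div_mul {r t : ℝ} (hr : 0 ≤ r) (ht : 0 < t) : σ r ≤ (1 + r / t) * σ t := by
  have hrt : 0 ≤ r / t := by positivity
  refine le_trans (h.mono hr ?_) (h.le_mul (by linarith) ht.le)
  rw [add_mul, div_mul_cancel₀ _ ht.ne']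
  linarith

/-- The interplay of a modulus with a ratio of Young functions. -/
lemma mul_le_of_ratio_le {r t H G l : ℝ} (hr : 0 ≤ r) (hr1 : r ≤ 1) (ht : 0 < t)
    (hH : 0 ≤ H) (hG : 0 < G) (hl : σ t / (1 + σ t) * (H / G) ≤ l) :
    σ r * H ≤ l * (σ 1 + 1 + r / t) * G := by
  have h1 := h.le_one_add_div_mul hr ht
  have h2 := h.mono hr hr1
  have hw := h.nonneg t ht.le
  have hσr := h.nonneg r hr
  set w := σ t
  -- After multiplication by `1 + w`, the term `σ(r)` is at most `(1 + r/t) w` by concavity, and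
  -- `σ(r) w ≤ σ(1) w` because `r ≤ 1`.
  have h3 : σ r ≤ (σ 1 + 1 + r / t) * (w / (1 + w)) := by
    rw [mul_div_assoc', le_div_iff₀ (by linarith)]
    nlinarith
  have hq : 0 ≤ σ 1 + 1 + r / t := by
    have : 0 ≤ r / t := by positivity
    linarith
  calc σ r * H ≤ (σ 1 + 1 + r / t) * (w / (1 + w)) * H := by gcongr
    _ = (σ 1 + 1 + r / t) * (w / (1 + w) * (H / G)) * G := by field_simp
    _ ≤ (σ 1 + 1 + r / t) * l * G := by gcongr
    _ = _ := by ring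

end OrliczMultiPhase.IsConcaveModulus

namespace OrliczMultiPhase

variable {n : ℕ}

lemma abs_sub_le_of_modulusSeminorm {Ω : Set (EuclideanSpace ℝ (Fin n))} {σ : ℝ → ℝ}
    {f : EuclideanSpace ℝ (Fin n) → ℝ} (hf : modulusSeminorm Ω σ f ≠ ∞)
    (hσ : ∀ t, 0 ≤ t → 0 ≤ σ t) {x y : EuclideanSpace ℝ (Fin n)} (hx : x ∈ Ω) (hy : y ∈ Ω) :
    |f x - f y| ≤ (modulusSeminorm Ω σ f).toReal * σ (dist x y) := by
  have h1 : ENNReal.ofReal |f x - f y| / ENNReal.ofReal (σ (dist x y)) ≤ modulusSeminorm Ω σ f :=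
    le_iSup₂_of_le x hx (le_iSup₂_of_le y hy le_rfl)
  rw [ENNReal.div_le_iff_le_mul (Or.inr hf) (Or.inl ENNReal.ofReal_ne_top)] at h1
  have h2 := ENNReal.toReal_mono (ENNReal.mul_ne_top hf ENNReal.ofReal_ne_top) h1
  rwa [ENNReal.toReal_ofReal (abs_nonneg _), ENNReal.toReal_mul,
    ENNReal.toReal_ofReal (hσ _ dist_nonneg)] at h2

lemma abs_sub_le_of_modulusNorm {Ω : Set (EuclideanSpace ℝ (Fin n))} {σ : ℝ → ℝ}
    {f : EuclideanSpace ℝ (Fin n) → ℝ} (hf : modulusNorm Ω σ f < ∞)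
    (hσ : IsConcaveModulus σ) {x y : EuclideanSpace ℝ (Fin n)} (hx : x ∈ Ω) (hy : y ∈ Ω) :
    |f x - f y| ≤ (modulusNorm Ω σ f).toReal * σ (dist x y) := by
  have hle : modulusSeminorm Ω σ f ≤ modulusNorm Ω σ f := le_add_self
  refine (abs_sub_le_of_modulusSeminorm (hle.trans_lt hf).ne hσ.nonneg hx hy).trans ?_
  exact mul_le_mul_of_nonneg_right (ENNReal.toReal_mono hf.ne hle) (hσ.nonneg _ dist_nonneg)

namespace Setting

variable (S : Setting n)

/-- Replacing the coefficients at `x` by their values at `xa`, `xb` costs `ω(4r) ≤ 4 ω(r)` times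
`H(U)`, and the bound on `Λ(t, U)` converts this into `G(U)`. The scale `t` stays free, because each
regime links it to `U` in its own way. -/
lemma Psi_le_frozenPsi_of_Lam_le {x xa xb : EuclideanSpace ℝ (Fin n)} {r t U l : ℝ}
    (hx : x ∈ S.Ω) (hxa : xa ∈ S.Ω) (hxb : xb ∈ S.Ω) (hda : dist x xa ≤ 4 * r)
    (hdb : dist x xb ≤ 4 * r) (hr : 0 ≤ r) (hr1 : r ≤ 1) (hU : 0 < U) (ht : 0 < t)
    (hl : S.Lam t U ≤ l) :
    S.Psi x U ≤ S.frozenPsi (S.a xa) (S.b xb) U +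
      4 * ((modulusNorm S.Ω S.ωa S.a).toReal + (modulusNorm S.Ω S.ωb S.b).toReal) * l *
        (S.ωa 1 + S.ωb 1 + 1 + r / t) * S.G U := by
  have hG := S.hG.powerGrowth.pos U hU
  have hHa := S.hHa.nonneg hU.le
  have hHb := S.hHb.nonneg hU.le
  have hnA : 0 ≤ (modulusNorm S.Ω S.ωa S.a).toReal := ENNReal.toReal_nonneg
  have hnB : 0 ≤ (modulusNorm S.Ω S.ωb S.b).toReal := ENNReal.toReal_nonneg
  set NA := (modulusNorm S.Ω S.ωa S.a).toReal with hNA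
  set NB := (modulusNorm S.Ω S.ωb S.b).toReal with hNB
  have hωat := S.hωa.nonneg t ht.le
  have hωbt := S.hωb.nonneg t ht.le
  have hωa1 := S.hωa.nonneg 1 zero_le_one
  have hωb1 := S.hωb.nonneg 1 zero_le_one
  have hta : 0 ≤ S.ωa t / (1 + S.ωa t) * (S.Ha U / S.G U) := by positivity
  have htb : 0 ≤ S.ωb t / (1 + S.ωb t) * (S.Hb U / S.G U) := by positivity
  rw [Lam] at hl
  have h1 := S.hωa.mul_le_of_ratio_le hr hr1 ht hHa hG (l := l) (by linarith)
  have h2 := S.hωb.mul_le_of_ratio_le hr hr1 ht hHb hG (l := l) (by linarith)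
  have hrt : 0 ≤ r / t := by positivity
  have hl0 : 0 ≤ l := by linarith
  have ha : S.a x ≤ S.a xa + NA * (4 * S.ωa r) := by
    have h3 := (le_abs_self _).trans (abs_sub_le_of_modulusNorm S.a_norm_finite S.hωa hx hxa)
    have h4 := (S.hωa.mono dist_nonneg hda).trans (S.hωa.le_mul (by norm_num) hr)
    have h5 := mul_le_mul_of_nonneg_left h4 hnA
    linarith
  have hb : S.b x ≤ S.b xb + NB * (4 * S.ωb r) := by
    have h3 := (le_abs_self _).trans (abs_sub_le_of_modulusNorm S.b_norm_finite S.hωb hx hxb)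
    have h4 := (S.hωb.mono dist_nonneg hdb).trans (S.hωb.le_mul (by norm_num) hr)
    have h5 := mul_le_mul_of_nonneg_left h4 hnB
    linarith
  have h6 : S.ωa r * S.Ha U ≤ l * (S.ωa 1 + S.ωb 1 + 1 + r / t) * S.G U := by
    refine h1.trans ?_
    gcongr
    linarith
  have h7 : S.ωb r * S.Hb U ≤ l * (S.ωa 1 + S.ωb 1 + 1 + r / t) * S.G U := by
    refine h2.trans ?_
    gcongr
    linarith
  have h8 := mul_le_mul_of_nonneg_right ha hHa
  have h9 := mul_le_mul_of_nonneg_right hb hHb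
  have h10 := mul_le_mul_of_nonneg_left h6 hnA
  have h11 := mul_le_mul_of_nonneg_left h7 hnB
  rw [Psi, frozenPsi]
  linarith

lemma Psi_zero (x : EuclideanSpace ℝ (Fin n)) : S.Psi x 0 = 0 := by
  simp [Psi, S.hG.zero, S.hHa.zero, S.hHb.zero]

lemma G_le_frozenPsi {α β : ℝ} (hα : 0 ≤ α) (hβ : 0 ≤ β) {U : ℝ} (hU : 0 ≤ U) :
    S.G U ≤ S.frozenPsi α β U := by
  have h1 := mul_nonneg hα (S.hHa.nonneg hU)
  have h2 := mul_nonneg hβ (S.hHb.nonneg hU)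
  rw [frozenPsi]; linarith

lemma Lam_le_of_iSup {f : ℝ → ℝ} {g : ℝ → ℝ}
    (h : (⨆ t ∈ Ioi (0 : ℝ), ENNReal.ofReal (S.Lam (f t) (g t))) < ∞) {t : ℝ} (ht : 0 < t) :
    S.Lam (f t) (g t) ≤ (⨆ t ∈ Ioi (0 : ℝ), ENNReal.ofReal (S.Lam (f t) (g t))).toReal :=
  (ENNReal.ofReal_le_iff_le_toReal h.ne).1 (le_iSup₂_of_le t (mem_Ioi.2 ht) le_rfl)

lemma Ginv_G {U : ℝ} (hU : 0 ≤ U) : S.Ginv (S.G U) = U := by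
  have hinj : InjOn S.G (Ici 0) := by
    have hP := S.hG.powerGrowth
    have : StrictMonoOn S.G (Ici 0) := by
      intro x hx y hy hxy
      have hx : 0 ≤ x := hx
      rcases hx.eq_or_lt with rfl | hx0
      · rw [hP.zero]; exact hP.pos y hxy
      · have h1 := hP.lower (y / x) x ((one_le_div hx0).2 hxy.le) hx
        rw [div_mul_cancel₀ _ hx0.ne'] at h1
        have h2 : 1 < (y / x) ^ (1 + 1 / S.sG) :=
          Real.one_lt_rpow ((one_lt_div hx0).2 hxy) (by have := hP.one_le; positivity)
        have h3 := hP.pos x hx0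
        nlinarith
    exact this.injOn
  have hex : ∃ a ∈ Ici (0 : ℝ), S.G a = S.G U := ⟨U, hU, rfl⟩
  exact hinj (Function.invFunOn_mem hex) hU (Function.invFunOn_eq hex)

/-- Minimal values of the coefficients on a compact ball. -/
lemma exists_coefficients_min {x₀ : EuclideanSpace ℝ (Fin n)} {r : ℝ} (hr : 0 ≤ r)
    (hsub : Metric.closedBall x₀ r ⊆ S.Ω) :
    ∃ xa ∈ Metric.closedBall x₀ r, ∃ xb ∈ Metric.closedBall x₀ r,
      ∀ x ∈ Metric.closedBall x₀ r, S.a xa ≤ S.a x ∧ S.b xb ≤ S.b x := by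
  have hne : (Metric.closedBall x₀ r).Nonempty := Metric.nonempty_closedBall.2 hr
  obtain ⟨xa, hxa, ha⟩ := (isCompact_closedBall x₀ r).exists_isMinOn hne
    (S.a_uniformContinuous.continuousOn.mono hsub)
  obtain ⟨xb, hxb, hb⟩ := (isCompact_closedBall x₀ r).exists_isMinOn hne
    (S.b_uniformContinuous.continuousOn.mono hsub)
  exact ⟨xa, hxa, xb, hxb, fun x hx => ⟨ha hx, hb hx⟩⟩

end Setting

/-- The parameter `4 (‖a‖ + ‖b‖)`. -/
noncomputable def BaseData.coeff (B : BaseData) : ℝ := 4 * (B.normA + B.normB)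

/-- The parameter `ω_a(1) + ω_b(1) + 1`. -/
noncomputable def BaseData.omega (B : BaseData) : ℝ := B.ωa_one + B.ωb_one + 1

/-- The factor of the linear term in the comparison of `Ψ` with a frozen Young function. -/
noncomputable def Data.linearFactor : Data → ℝ
  | .sobolev B l _ _ => |1 + B.coeff * l * B.omega|
  | .bounded B l M => |1 + B.coeff * l * (B.omega + 2 * M)|
  | .holder B γ l M => |1 + B.coeff * l * (B.omega + (3 * M) ^ (1 / (1 - γ)))|

/-- The factor of the superlinear term in the comparison of `Ψ` with a frozen Young function. -/
noncomputable def Data.superlinearFactor : Data → ℝ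
  | .sobolev B l _ _ => |B.coeff * l|
  | .bounded _ _ _ => 0
  | .holder _ _ _ _ => 0

/-- The constants must exist for an arbitrary value of the data, whatever the signs of its entries;
this is why the factor is defined with an absolute value. -/
lemma Data.linearFactor_nonneg (D : Data) : 0 ≤ D.linearFactor := by
  cases D <;> exact abs_nonneg _

lemma Data.superlinearFactor_nonneg (D : Data) : 0 ≤ D.superlinearFactor := by
  cases D
  · exact abs_nonneg _
  · exact le_rfl
  · exact le_rfl

namespace Setting

variable (S : Setting n)

/-- The comparison of `Ψ(x, |u - k| / r)` with a frozen Young function, in all three regimes. -/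
lemma ae_Psi_le_frozenPsi (hn : 1 ≤ n) {ν L : ℝ} {u : EuclideanSpace ℝ (Fin n) → ℝ}
    {Du : EuclideanSpace ℝ (Fin n) → EuclideanSpace ℝ (Fin n)} {R : Regime}
    (hu : S.Assumption u Du R) {x₀ : EuclideanSpace ℝ (Fin n)} {r : ℝ} (hr : 0 < r) (hr1 : r ≤ 1)
    (hsub : Metric.closedBall x₀ (2 * r) ⊆ S.Ω) {xa xb : EuclideanSpace ℝ (Fin n)}
    (hxa : xa ∈ Metric.closedBall x₀ (2 * r)) (hxb : xb ∈ Metric.closedBall x₀ (2 * r)) :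
    ∀ᵐ x ∂(volume.restrict (Metric.closedBall x₀ (3 / 2 * r))),
      ∀ U, U = |u x - ⨍ y in Metric.closedBall x₀ (3 / 2 * r), u y| / r →
      S.Psi x U ≤ (S.data ν L u Du R).linearFactor * S.frozenPsi (S.a xa) (S.b xb) U +
        (S.data ν L u Du R).superlinearFactor * r *
          S.frozenPsi (S.a xa) (S.b xb) U ^ (1 + 1 / (n : ℝ)) := by
  have hBB' : Metric.closedBall x₀ (3 / 2 * r) ⊆ Metric.closedBall x₀ (2 * r) :=
    Metric.closedBall_subset_closedBall (by linarith)
  set B := Metric.closedBall x₀ (3 / 2 * r) with hB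
  have hBm : MeasurableSet B := Metric.isClosed_closedBall.measurableSet
  set k := ⨍ y in B, u y with hk
  have hα := S.a_nonneg xa (hsub hxa)
  have hβ := S.b_nonneg xb (hsub hxb)
  have hB0 : volume B ≠ 0 := by
    rw [hB, volume_closedBall_eq x₀ (by positivity)]
    have := unitBallVolume_pos (n := n)
    simp only [ne_eq, ENNReal.ofReal_eq_zero, not_le]
    positivity
  have hBt : volume B ≠ ∞ := by
    rw [hB, volume_closedBall_eq x₀ (by positivity)]; exact ENNReal.ofReal_ne_top
  have hint : HasWeakGradient S.Ω u Du → IntegrableOn u B volume := fun hw =>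
    hw.locallyIntegrable.integrableOn_compact_subset (hBB'.trans hsub) (isCompact_closedBall _ _)
  have hdist : ∀ x ∈ B, ∀ y ∈ Metric.closedBall x₀ (2 * r), dist x y ≤ 4 * r := by
    intro x hx y hy
    have h1 := dist_triangle_right x y x₀
    have h2 : dist x x₀ ≤ 3 / 2 * r := hx
    have h3 : dist y x₀ ≤ 2 * r := hy
    linarith
  have hnA : 0 ≤ (modulusNorm S.Ω S.ωa S.a).toReal := ENNReal.toReal_nonneg
  have hnB : 0 ≤ (modulusNorm S.Ω S.ωb S.b).toReal := ENNReal.toReal_nonneg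
  have hωa1 := S.hωa.nonneg 1 zero_le_one
  have hωb1 := S.hωb.nonneg 1 zero_le_one
  have hlin : ∀ (l m : ℝ) (x : EuclideanSpace ℝ (Fin n)) (t U : ℝ), x ∈ B → 0 < U → 0 < t → 0 ≤ l →
      S.Lam t U ≤ l → r / t ≤ m →
      S.Psi x U ≤ |1 + (S.baseData ν L).coeff * l * ((S.baseData ν L).omega + m)| *
        S.frozenPsi (S.a xa) (S.b xb) U := by
    intro l m x t U hx hU ht hl0 hl hm
    have h1 := S.Psi_le_frozenPsi_of_Lam_le (hsub (hBB' hx)) (hsub hxa) (hsub hxb)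
      (hdist x hx xa hxa) (hdist x hx xb hxb) hr.le hr1 hU ht hl
    have h2 := S.G_le_frozenPsi hα hβ hU.le
    have hG := S.hG.nonneg hU.le
    have hrt : 0 ≤ r / t := by positivity
    refine h1.trans (le_trans ?_ (mul_le_mul_of_nonneg_right (le_abs_self _) (hG.trans h2)))
    rw [add_mul, one_mul, BaseData.coeff, BaseData.omega]
    simp only [baseData]
    have hm0 : 0 ≤ m := hrt.trans hm
    gcongr
  cases R with
  | sobolev =>
    obtain ⟨hw, hlam⟩ := hu
    filter_upwards [ae_restrict_mem hBm] with x hx U hU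
    have hU0 : 0 ≤ U := by rw [hU]; positivity
    rcases hU0.eq_or_lt with h0 | hUpos
    · rw [← h0, Psi_zero]
      have := (S.powerGrowth_frozenPsi hα hβ).nonneg le_rfl
      have h2 := (S.data ν L u Du .sobolev).linearFactor_nonneg
      have h3 := (S.data ν L u Du .sobolev).superlinearFactor_nonneg
      positivity
    have hG := S.hG.powerGrowth.pos U hUpos
    have hGA := S.G_le_frozenPsi hα hβ hU0
    have hn0 : (0 : ℝ) < n := by exact_mod_cast hn
    -- The scale with `G⁻¹(t⁻ⁿ) = U`; then `(r / t) G(U) = r G(U)^(1 + 1/n)`, the superlinear term.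
    have ht : 0 < S.G U ^ (-(1 / (n : ℝ))) := by positivity
    have hinv : S.Ginv (((S.G U ^ (-(1 / (n : ℝ)))) ^ n)⁻¹) = U := by
      rw [← Real.rpow_natCast, ← Real.rpow_mul hG.le, ← Real.rpow_neg hG.le]
      have : -(-(1 / (n : ℝ)) * n) = 1 := by field_simp
      rw [this, Real.rpow_one, S.Ginv_G hU0]
    have hl := S.Lam_le_of_iSup (f := fun t => t) (g := fun t => S.Ginv ((t ^ n)⁻¹)) hlam ht
    simp only [hinv] at hl
    have hl0 : 0 ≤ S.lam₁.toReal := ENNReal.toReal_nonneg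
    have h1 := S.Psi_le_frozenPsi_of_Lam_le (hsub (hBB' hx)) (hsub hxa) (hsub hxb)
      (hdist x hx xa hxa) (hdist x hx xb hxb) hr.le hr1 hUpos ht hl
    change S.Psi x U ≤ S.frozenPsi (S.a xa) (S.b xb) U +
      4 * ((modulusNorm S.Ω S.ωa S.a).toReal + (modulusNorm S.Ω S.ωb S.b).toReal) * S.lam₁.toReal *
        (S.ωa 1 + S.ωb 1 + 1 + r / S.G U ^ (-(1 / (n : ℝ)))) * S.G U at h1
    have e : r / S.G U ^ (-(1 / (n : ℝ))) * S.G U = r * S.G U ^ (1 + 1 / (n : ℝ)) := by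
      rw [Real.rpow_neg hG.le, Real.rpow_add hG, Real.rpow_one]
      field_simp
    have h2 : S.G U ^ (1 + 1 / (n : ℝ)) ≤ S.frozenPsi (S.a xa) (S.b xb) U ^ (1 + 1 / (n : ℝ)) := by
      gcongr
    simp only [data, Data.linearFactor, Data.superlinearFactor, BaseData.coeff, BaseData.omega,
      baseData]
    set N := 4 * ((modulusNorm S.Ω S.ωa S.a).toReal + (modulusNorm S.Ω S.ωb S.b).toReal) *
      S.lam₁.toReal with hN
    have hN0 : 0 ≤ N := by positivity
    set A := S.frozenPsi (S.a xa) (S.b xb) U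
    rw [abs_of_nonneg (by positivity : 0 ≤ 1 + N * (S.ωa 1 + S.ωb 1 + 1)), abs_of_nonneg hN0]
    calc S.Psi x U ≤ A + N * (S.ωa 1 + S.ωb 1 + 1 + r / S.G U ^ (-(1 / (n : ℝ)))) * S.G U := h1
      _ = A + N * (S.ωa 1 + S.ωb 1 + 1) * S.G U + N * (r * S.G U ^ (1 + 1 / (n : ℝ))) := by
          rw [← e]; ring
      _ ≤ A + N * (S.ωa 1 + S.ωb 1 + 1) * A + N * (r * A ^ (1 + 1 / (n : ℝ))) := by gcongr
      _ = _ := by ring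
  | bounded =>
    obtain ⟨hw, hub, hlam⟩ := hu
    have hM : ∀ᵐ x ∂(volume.restrict B), ‖u x‖ₑ ≤ eLpNorm u ∞ (volume.restrict S.Ω) := by
      rw [eLpNorm_exponent_top]
      exact ae_mono (Measure.restrict_mono (hBB'.trans hsub) le_rfl) (ae_le_eLpNormEssSup)
    set M := eLpNorm u ∞ (volume.restrict S.Ω) with hMdef
    have hMt : M ≠ ∞ := hub.eLpNorm_ne_top
    filter_upwards [ae_restrict_mem hBm, hM] with x hx hMx U hU
    have hU0 : 0 ≤ U := by rw [hU]; positivity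
    simp only [data, Data.linearFactor, Data.superlinearFactor, zero_mul, add_zero]
    rcases hU0.eq_or_lt with h0 | hUpos
    · rw [← h0, Psi_zero]
      have := (S.powerGrowth_frozenPsi hα hβ).nonneg le_rfl
      positivity
    -- At `t = 1 / U` the ratio `r / t = r U` is `|u - k|`, hence at most twice the supremum norm.
    have hl := S.Lam_le_of_iSup (f := fun t => t) (g := fun t => 1 / t) hlam
      (one_div_pos.2 hUpos)
    simp only [one_div_one_div] at hl
    refine hlin _ _ x _ U hx hUpos (one_div_pos.2 hUpos) ENNReal.toReal_nonneg hl ?_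
    rw [div_div_eq_mul_div, div_one, hU, mul_div_cancel₀ _ hr.ne']
    have h1 := enorm_sub_average_le_of_ae_le hB0 hBt (hint hw.hasWeakGradient) (c := u x)
      (M := 2 * M) (by
        filter_upwards [hM] with y hy
        calc ‖u x - u y‖ₑ ≤ ‖u x‖ₑ + ‖u y‖ₑ := enorm_sub_le
          _ ≤ M + M := add_le_add hMx hy
          _ = 2 * M := (two_mul M).symm)
    have h2 := ENNReal.toReal_mono (ENNReal.mul_ne_top (by simp) hMt) h1
    simpa [hMdef] using h2
  | holder γ =>
    obtain ⟨hw, hγ0, hγ1, hsem, hlam⟩ := hu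
    set M := (modulusSeminorm S.Ω (fun t => t ^ γ) u).toReal with hMdef
    have hM0 : 0 ≤ M := ENNReal.toReal_nonneg
    have hγ' : 0 < 1 - γ := by linarith
    -- Points of the ball of radius `3r/2` are at distance at most `3r`, and `3^γ ≤ 3`.
    have hosc : ∀ x ∈ B, ∀ y ∈ B, |u x - u y| ≤ 3 * M * r ^ γ := by
      intro x hx y hy
      refine (abs_sub_le_of_modulusSeminorm hsem.ne (fun t ht => by positivity)
        (hsub (hBB' hx)) (hsub (hBB' hy))).trans ?_
      have h1 : dist x y ≤ 3 * r := by
        have h1 := dist_triangle_right x y x₀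
        have h2 : dist x x₀ ≤ 3 / 2 * r := hx
        have h3 : dist y x₀ ≤ 3 / 2 * r := hy
        linarith
      have h2 : (3 : ℝ) ^ γ ≤ 3 := by
        conv_rhs => rw [← Real.rpow_one 3]
        exact Real.rpow_le_rpow_of_exponent_le (by norm_num) hγ1.le
      calc M * dist x y ^ γ ≤ M * (3 * r) ^ γ := by gcongr
        _ = M * (3 ^ γ * r ^ γ) := by rw [Real.mul_rpow (by norm_num) hr.le]
        _ ≤ M * (3 * r ^ γ) := by gcongr
        _ = _ := by ring
    filter_upwards [ae_restrict_mem hBm] with x hx U hU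
    have hU0 : 0 ≤ U := by rw [hU]; positivity
    simp only [data, Data.linearFactor, Data.superlinearFactor, zero_mul, add_zero]
    rcases hU0.eq_or_lt with h0 | hUpos
    · rw [← h0, Psi_zero]
      have := (S.powerGrowth_frozenPsi hα hβ).nonneg le_rfl
      positivity
    -- Here the scale is `U^(-1/(1-γ))`. Since `U ≤ 3M r^(γ-1)`, the ratio `r U^(1/(1-γ))` is at
    -- most `(3M)^(1/(1-γ))`.
    have hl := S.Lam_le_of_iSup (f := fun t => t ^ (1 / (1 - γ))) (g := fun t => 1 / t) hlam
      (one_div_pos.2 hUpos)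
    simp only [one_div_one_div] at hl
    refine hlin _ _ x _ U hx hUpos (by positivity) ENNReal.toReal_nonneg hl ?_
    have h1 := enorm_sub_average_le_of_ae_le hB0 hBt (hint hw.hasWeakGradient) (c := u x)
      (M := ENNReal.ofReal (3 * M * r ^ γ)) (by
        filter_upwards [ae_restrict_mem hBm] with y hy
        rw [Real.enorm_eq_ofReal_abs]
        exact ENNReal.ofReal_le_ofReal (hosc x hx y hy))
    rw [Real.enorm_eq_ofReal_abs, ENNReal.ofReal_le_ofReal_iff (by positivity)] at h1
    have h2 : U ≤ 3 * M * r ^ (-(1 - γ)) := by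
      rw [hU, div_le_iff₀ hr, mul_assoc, ← Real.rpow_add_one hr.ne']
      simpa using h1
    rw [Real.div_rpow zero_le_one hU0, Real.one_rpow, div_div_eq_mul_div, div_one]
    calc r * U ^ (1 / (1 - γ)) ≤ r * (3 * M * r ^ (-(1 - γ))) ^ (1 / (1 - γ)) := by gcongr
      _ = r * ((3 * M) ^ (1 / (1 - γ)) * r ^ (-(1 : ℝ))) := by
          rw [Real.mul_rpow (by positivity) (by positivity), ← Real.rpow_mul hr.le]
          congr 3
          field_simp
      _ = (3 * M) ^ (1 / (1 - γ)) := by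
          rw [Real.rpow_neg_one]; field_simp

end Setting

end OrliczMultiPhase

/-! ### Gehring's lemma. -/

section Gehring

/-- Decay of super-level integrals self-improves to higher integrability. -/
lemma lintegral_rpow_le_of_levelSet {α : Type*} [MeasurableSpace α] {μ : Measure α}
    {h : α → ℝ≥0∞} (hm : Measurable h) (hfin : ∫⁻ x, h x ∂μ ≠ ∞) {θ K ε δ l₀ : ℝ} (hθ0 : 0 < θ)
    (hθ1 : θ < 1) (hK : 0 ≤ K) (hε0 : 0 < ε) (hε1 : ε ≤ 1) (hδ0 : 0 < δ) (hδ1 : δ ≤ 1)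
    (hδ : δ * K / ((1 - θ) * ε ^ 2) ≤ 1 / 2) (hl₀ : 0 ≤ l₀)
    (hlev : ∀ l : ℝ, 0 < l → l₀ ≤ l → ∫⁻ x in {x | ENNReal.ofReal l < h x}, h x ∂μ ≤
      ENNReal.ofReal (K * l ^ (1 - θ)) * ∫⁻ x in {x | ENNReal.ofReal (ε * l) < h x}, h x ^ θ ∂μ) :
    ∫⁻ x, h x ^ (1 + δ) ∂μ ≤ 2 * ENNReal.ofReal (l₀ ^ δ) * ∫⁻ x, h x ∂μ := by
  set p : ℝ := 1 - θ + δ with hp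
  have hp0 : 0 < p := by linarith
  -- the truncated estimate
  have key : ∀ M : ℝ, 0 < M → ∫⁻ x, h x * min (h x) (ENNReal.ofReal M) ^ δ ∂μ ≤
      2 * ENNReal.ofReal (l₀ ^ δ) * ∫⁻ x, h x ∂μ := by
    intro M hM
    set hM' : α → ℝ≥0∞ := fun x => min (h x) (ENNReal.ofReal M) with hhM
    have hM't : ∀ x, hM' x ≠ ∞ := fun x => ne_top_of_le_ne_top ENNReal.ofReal_ne_top
      (min_le_right _ _)
    have hM'm : Measurable hM' := hm.min measurable_const
    set g : α → ℝ := fun x => (hM' x).toReal with hg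
    have hgm : Measurable g := hM'm.ennreal_toReal
    have hg0 : ∀ x, 0 ≤ g x := fun x => ENNReal.toReal_nonneg
    have hgo : ∀ x, ENNReal.ofReal (g x) = hM' x := fun x => ENNReal.ofReal_toReal (hM't x)
    have hlt : ∀ t : ℝ, 0 ≤ t → ∀ x, t < g x ↔ ENNReal.ofReal t < h x ∧ t < M := by
      intro t ht x
      rw [← ENNReal.ofReal_lt_ofReal_iff_of_nonneg ht, hgo, hhM, lt_min_iff,
        ENNReal.ofReal_lt_ofReal_iff_of_nonneg ht]
    set ν := μ.withDensity h with hν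
    set ν' := μ.withDensity (fun x => h x ^ θ) with hν'
    set I := ∫⁻ x, h x * hM' x ^ δ ∂μ with hI
    have hIν : I = ∫⁻ x, ENNReal.ofReal (g x ^ δ) ∂ν := by
      rw [hν, lintegral_withDensity_eq_lintegral_mul₀ hm.aemeasurable
        (hgm.pow_const δ).ennreal_ofReal.aemeasurable]
      refine lintegral_congr fun x => ?_
      rw [Pi.mul_apply, ← ENNReal.ofReal_rpow_of_nonneg (hg0 x) hδ0.le, hgo]
    -- Finiteness of `I`, which the truncation at `M` secures, is what allows half of `I` to be
    -- absorbed later.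
    have hIfin : I ≠ ∞ := by
      refine ne_top_of_le_ne_top (ENNReal.mul_ne_top hfin
        (ENNReal.rpow_ne_top_of_nonneg hδ0.le (ENNReal.ofReal_ne_top (r := M)))) ?_
      rw [← lintegral_mul_const _ hm]
      refine lintegral_mono fun x => ?_
      gcongr
      exact min_le_right _ _
    have h1 := lintegral_rpow_eq_lintegral_meas_lt_mul ν (f := g)
      (Eventually.of_forall hg0) hgm.aemeasurable hδ0
    have h2 := lintegral_rpow_eq_lintegral_meas_lt_mul ν (f := fun _ => l₀)
      (Eventually.of_forall fun _ => hl₀) aemeasurable_const hδ0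
    have h3 := lintegral_rpow_eq_lintegral_meas_lt_mul ν' (f := fun x => g x / ε)
      (Eventually.of_forall fun x => div_nonneg (hg0 x) hε0.le) (hgm.div_const ε).aemeasurable hp0
    -- Layer-cake bound at level `t`: below `l₀` the trivial bound is kept and sums to `l₀^δ ∫ h`;
    -- above it the level-set hypothesis applies, and its factor `t^(1-θ)` turns the weight
    -- `t^(δ-1)` into `t^(p-1)`.
    have hpt : ∀ t ∈ Ioi (0 : ℝ), ν {x | t < g x} * ENNReal.ofReal (t ^ (δ - 1)) ≤
        ν {x : α | t < l₀} * ENNReal.ofReal (t ^ (δ - 1)) +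
          ENNReal.ofReal K * (ν' {x | t < g x / ε} * ENNReal.ofReal (t ^ (p - 1))) := by
      intro t ht
      have ht : 0 < t := ht
      rcases lt_or_ge t l₀ with htl | htl
      · refine le_trans ?_ le_self_add
        exact mul_le_mul_left (measure_mono fun x _ => htl) _
      refine le_trans ?_ le_add_self
      rcases le_or_gt M t with htM | htM
      · have : {x | t < g x} = ∅ := by
          ext x
          simp only [mem_ofPred_eq, mem_empty_iff_false, iff_false]
          rw [hlt t ht.le x]
          exact fun hx => absurd hx.2 htM.not_gt
        rw [this]; simp
      have hsub : {x | t < g x} ⊆ {x | ENNReal.ofReal t < h x} := fun x hx =>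
        ((hlt t ht.le x).1 hx).1
      have hsub' : {x | ENNReal.ofReal (ε * t) < h x} ⊆ {x | t < g x / ε} := by
        intro x hx
        rw [mem_ofPred_eq, lt_div_iff₀ hε0, mul_comm]
        refine (hlt _ (by positivity) x).2 ⟨hx, ?_⟩
        nlinarith
      have hms : MeasurableSet {x | ENNReal.ofReal t < h x} := measurableSet_lt measurable_const hm
      have hms' : MeasurableSet {x | ENNReal.ofReal (ε * t) < h x} :=
        measurableSet_lt measurable_const hm
      calc ν {x | t < g x} * ENNReal.ofReal (t ^ (δ - 1))
          ≤ ν {x | ENNReal.ofReal t < h x} * ENNReal.ofReal (t ^ (δ - 1)) := by gcongr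
        _ ≤ (ENNReal.ofReal (K * t ^ (1 - θ)) * ν' {x | ENNReal.ofReal (ε * t) < h x}) *
            ENNReal.ofReal (t ^ (δ - 1)) := by
            rw [hν, hν', withDensity_apply _ hms, withDensity_apply _ hms']
            gcongr
            exact hlev t ht htl
        _ ≤ (ENNReal.ofReal (K * t ^ (1 - θ)) * ν' {x | t < g x / ε}) *
            ENNReal.ofReal (t ^ (δ - 1)) := by gcongr
        _ = _ := by
            have : t ^ (p - 1) = t ^ (1 - θ) * t ^ (δ - 1) := by
              rw [← Real.rpow_add ht]; congr 1; rw [hp]; ring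
            rw [this, ENNReal.ofReal_mul hK, ENNReal.ofReal_mul (by positivity)]
            ring
    have hmon : Measurable fun t : ℝ => ν {x : α | t < l₀} * ENNReal.ofReal (t ^ (δ - 1)) := by
      have : Antitone fun t : ℝ => ν {x : α | t < l₀} := fun a b hab =>
        measure_mono fun x (hx : b < l₀) => lt_of_le_of_lt hab hx
      exact this.measurable.mul (by fun_prop)
    have h4 : I ≤ ENNReal.ofReal (l₀ ^ δ) * (∫⁻ x, h x ∂μ) + ENNReal.ofReal (δ * K / p) *
        ∫⁻ x, ENNReal.ofReal ((g x / ε) ^ p) ∂ν' := by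
      calc I = ENNReal.ofReal δ * ∫⁻ t in Ioi 0, ν {x | t < g x} * ENNReal.ofReal (t ^ (δ - 1)) := by
            rw [hIν, h1]
        _ ≤ ENNReal.ofReal δ * ∫⁻ t in Ioi 0, (ν {x : α | t < l₀} * ENNReal.ofReal (t ^ (δ - 1)) +
          ENNReal.ofReal K * (ν' {x | t < g x / ε} * ENNReal.ofReal (t ^ (p - 1)))) := by
            gcongr 1
            exact setLIntegral_mono' measurableSet_Ioi hpt
        _ = (ENNReal.ofReal δ * ∫⁻ t in Ioi 0, ν {x : α | t < l₀} * ENNReal.ofReal (t ^ (δ - 1))) +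
          ENNReal.ofReal (δ * K / p) * (ENNReal.ofReal p *
            ∫⁻ t in Ioi 0, ν' {x | t < g x / ε} * ENNReal.ofReal (t ^ (p - 1))) := by
            rw [lintegral_add_left hmon, lintegral_const_mul' _ _ ENNReal.ofReal_ne_top, mul_add,
              ← mul_assoc, ← mul_assoc, ← ENNReal.ofReal_mul hδ0.le,
              ← ENNReal.ofReal_mul (by positivity), div_mul_cancel₀ _ hp0.ne']
        _ = _ := by
            rw [← h2, ← h3, lintegral_const, hν, withDensity_apply _ MeasurableSet.univ,
              Measure.restrict_univ]
    have h5 : ∫⁻ x, ENNReal.ofReal ((g x / ε) ^ p) ∂ν' ≤ ENNReal.ofReal (ε ^ (-p)) * I := by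
      rw [hν', lintegral_withDensity_eq_lintegral_mul₀ (hm.pow_const θ).aemeasurable
        ((hgm.div_const ε).pow_const p).ennreal_ofReal.aemeasurable, hI,
        ← lintegral_const_mul' _ _ ENNReal.ofReal_ne_top]
      refine lintegral_mono fun x => ?_
      rw [Pi.mul_apply, div_eq_mul_inv, Real.mul_rpow (hg0 x) (by positivity),
        Real.inv_rpow hε0.le, ← Real.rpow_neg hε0.le, ENNReal.ofReal_mul (by positivity [hg0 x]),
        ← ENNReal.ofReal_rpow_of_nonneg (hg0 x) hp0.le, hgo, hp,
        ENNReal.rpow_add_of_nonneg _ _ (by linarith) hδ0.le]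
      have h6 : h x ^ θ * hM' x ^ (1 - θ) ≤ h x := by
        calc h x ^ θ * hM' x ^ (1 - θ) ≤ h x ^ θ * h x ^ (1 - θ) :=
              mul_le_mul_right (ENNReal.rpow_le_rpow (min_le_left _ _) (by linarith)) _
          _ = h x := by
              rw [← ENNReal.rpow_add_of_nonneg _ _ hθ0.le (by linarith), add_sub_cancel,
                ENNReal.rpow_one]
      calc h x ^ θ * (hM' x ^ (1 - θ) * hM' x ^ δ * ENNReal.ofReal (ε ^ (-(1 - θ + δ))))
          = ENNReal.ofReal (ε ^ (-(1 - θ + δ))) * ((h x ^ θ * hM' x ^ (1 - θ)) * hM' x ^ δ) := by ring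
        _ ≤ _ := by gcongr
    -- As `p ≤ 2` and `ε ≤ 1`, one has `ε^(-p) ≤ ε^(-2)`, and `p ≥ 1 - θ`; so smallness of `δ` alone
    -- makes the coefficient at most one half.
    have h6 : δ * K / p * ε ^ (-p) ≤ 1 / 2 := by
      refine le_trans ?_ hδ
      have e1 : ε ^ (-p) ≤ (ε ^ 2)⁻¹ := by
        rw [← Real.rpow_natCast ε 2, ← Real.rpow_neg hε0.le]
        exact Real.rpow_le_rpow_of_exponent_ge hε0 hε1 (by push_cast; linarith)
      have e2 : (δ * K) / p ≤ δ * K / (1 - θ) := by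
        have : 0 < 1 - θ := by linarith
        gcongr
        linarith
      have h1θ : 0 < 1 - θ := by linarith
      calc δ * K / p * ε ^ (-p) ≤ δ * K / (1 - θ) * (ε ^ 2)⁻¹ := by gcongr
        _ = _ := by field_simp
    have h7 : I ≤ ENNReal.ofReal (l₀ ^ δ) * (∫⁻ x, h x ∂μ) + ENNReal.ofReal (1 / 2) * I := by
      refine h4.trans ?_
      gcongr _ + ?_
      refine (mul_le_mul_right h5 _).trans ?_
      rw [← mul_assoc, ← ENNReal.ofReal_mul (by positivity)]
      gcongr
    have h8 : I = ENNReal.ofReal (1 / 2) * I + ENNReal.ofReal (1 / 2) * I := by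
      rw [← add_mul, ← ENNReal.ofReal_add (by norm_num) (by norm_num)]
      norm_num
    have h9 : ENNReal.ofReal (1 / 2) * I ≤ ENNReal.ofReal (l₀ ^ δ) * ∫⁻ x, h x ∂μ := by
      refine ENNReal.le_of_add_le_add_right (a := ENNReal.ofReal (1 / 2) * I)
        (ENNReal.mul_ne_top ENNReal.ofReal_ne_top hIfin) ?_
      rwa [← h8]
    calc I = 2 * (ENNReal.ofReal (1 / 2) * I) := by rw [two_mul, ← h8]
      _ ≤ 2 * (ENNReal.ofReal (l₀ ^ δ) * ∫⁻ x, h x ∂μ) := by gcongr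
      _ = _ := by rw [mul_assoc]
  -- monotone limit
  have hmono : ∀ x, Monotone fun k : ℕ => h x * min (h x) (ENNReal.ofReal (k + 1)) ^ δ := by
    intro x a b hab
    dsimp only
    gcongr
  have hsup : ∀ x, h x ^ (1 + δ) = ⨆ k : ℕ, h x * min (h x) (ENNReal.ofReal (k + 1)) ^ δ := by
    intro x
    refine (iSup_eq_of_tendsto (hmono x) ?_).symm
    rw [ENNReal.rpow_add_of_nonneg _ _ zero_le_one hδ0.le, ENNReal.rpow_one]
    have h1 : Tendsto (fun k : ℕ => min (h x) (ENNReal.ofReal (k + 1))) atTop (𝓝 (h x)) := by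
      have : Tendsto (fun k : ℕ => ENNReal.ofReal ((k : ℝ) + 1)) atTop (𝓝 ∞) :=
        ENNReal.tendsto_ofReal_atTop.comp
          (tendsto_atTop_add_const_right _ _ tendsto_natCast_atTop_atTop)
      simpa using (tendsto_const_nhds (x := h x)).min this
    refine ENNReal.Tendsto.const_mul ((ENNReal.continuous_rpow_const.tendsto _).comp h1) ?_
    by_cases h0 : h x = 0
    · right; simp [h0]
    · left; simp [ENNReal.rpow_eq_zero_iff, h0, hδ0.le, hδ0]
  simp_rw [hsup]
  have hmk : ∀ k : ℕ, Measurable fun x => h x * min (h x) (ENNReal.ofReal (k + 1)) ^ δ :=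
    fun k => hm.mul ((hm.min measurable_const).pow_const δ)
  rw [lintegral_iSup hmk (fun a b hab x => hmono x hab)]
  exact iSup_le fun k => key _ (by positivity)

end Gehring

section Gehring

variable {n : ℕ}

/-- The `n`-th power of the distance to the complement of the ball of radius `R` around `x₀`. -/
noncomputable def ballWeight (x₀ : EuclideanSpace ℝ (Fin n)) (R : ℝ)
    (x : EuclideanSpace ℝ (Fin n)) : ℝ := max 0 (R - dist x x₀) ^ n

lemma continuous_ballWeight (x₀ : EuclideanSpace ℝ (Fin n)) (R : ℝ) :
    Continuous (ballWeight x₀ R) := by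
  unfold ballWeight; fun_prop

/-- The weighted function `dist(x, ∂B)ⁿ f(x)`. -/
noncomputable def weighted (x₀ : EuclideanSpace ℝ (Fin n)) (R : ℝ)
    (f : EuclideanSpace ℝ (Fin n) → ℝ≥0∞) (x : EuclideanSpace ℝ (Fin n)) : ℝ≥0∞ :=
  ENNReal.ofReal (ballWeight x₀ R x) * f x

lemma measurable_weighted {x₀ : EuclideanSpace ℝ (Fin n)} {R : ℝ}
    {f : EuclideanSpace ℝ (Fin n) → ℝ≥0∞} (hf : Measurable f) : Measurable (weighted x₀ R f) :=
  (continuous_ballWeight x₀ R).measurable.ennreal_ofReal.mul hf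

/-- A scale-invariant reverse Hölder inequality on all balls inside a given ball. -/
def ReverseHolderOn (f : EuclideanSpace ℝ (Fin n) → ℝ≥0∞) (x₀ : EuclideanSpace ℝ (Fin n))
    (R C θ : ℝ) : Prop :=
  ∀ (y : EuclideanSpace ℝ (Fin n)) (r : ℝ), 0 < r →
    Metric.closedBall y (2 * r) ⊆ Metric.closedBall x₀ R →
    ∫⁻ x in Metric.closedBall y r, f x ≤ ENNReal.ofReal (C * r ^ (n - n * (1 / θ))) *
      (∫⁻ x in Metric.closedBall y (2 * r), f x ^ θ) ^ (1 / θ)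

/-- Estimate on one stopping ball, where `d` is the distance of `x` to the boundary. The mean of `f`
is about `l / dⁿ` both at radius `r` and at radius `16r`, and the weight is comparable to `dⁿ`
there. The reverse Hölder inequality turns the lower bound into one for `∫ f^θ` on the ball of
radius `2r`, and the part of that integral where the weighted function is at most `ε l` is
negligible. -/
lemma exists_levelSet_local {θ C : ℝ} (hθ0 : 0 < θ) (hθ1 : θ < 1) (hC : 1 ≤ C) :
    ∃ K ε : ℝ, 0 ≤ K ∧ 0 < ε ∧ ε ≤ 1 ∧ ∀ (f : EuclideanSpace ℝ (Fin n) → ℝ≥0∞)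
      (x₀ x : EuclideanSpace ℝ (Fin n)) (R d r l : ℝ), Measurable f → ReverseHolderOn f x₀ R C θ →
      d = R - dist x x₀ → 0 < d → 0 < r → r ≤ d / 32 → 0 < l →
      ENNReal.ofReal (l * unitBallVolume n * (r / d) ^ n) ≤ ∫⁻ y in Metric.closedBall x r, f y →
      ∫⁻ y in Metric.closedBall x (16 * r), f y ≤
        ENNReal.ofReal (l * unitBallVolume n * (16 * r / d) ^ n) →
      ∫⁻ y in Metric.closedBall x (16 * r), weighted x₀ R f y ≤ ENNReal.ofReal (K * l ^ (1 - θ)) *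
        ∫⁻ y in Metric.closedBall x (2 * r) ∩ {y | ENNReal.ofReal (ε * l) < weighted x₀ R f y},
          weighted x₀ R f y ^ θ := by
  have hV := unitBallVolume_pos (n := n)
  set V := unitBallVolume n with hVdef
  have hC0 : 0 < C := by linarith
  -- Chosen so that, once `ε^θ ≤ κ`, the contribution of `{h ≤ ε l}` is at most half of the lower
  -- bound for `∫ f^θ`.
  set κ : ℝ := V ^ θ / (2 * (C ^ θ * (2 ^ n) ^ θ * V * 2 ^ n)) with hκ
  have hκ0 : 0 < κ := by positivity
  obtain ⟨ε, hε0, hε1, hεκ⟩ : ∃ ε : ℝ, 0 < ε ∧ ε ≤ 1 ∧ ε ^ θ ≤ κ := by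
    refine ⟨min 1 (κ ^ (1 / θ)), lt_min one_pos (by positivity), min_le_left _ _, ?_⟩
    calc (min 1 (κ ^ (1 / θ))) ^ θ ≤ (κ ^ (1 / θ)) ^ θ :=
          Real.rpow_le_rpow (by positivity) (min_le_right _ _) hθ0.le
      _ = κ := by rw [← Real.rpow_mul hκ0.le, one_div_mul_cancel hθ0.ne', Real.rpow_one]
  refine ⟨(2 * 2 ^ n * 16 ^ n * V ^ (1 - θ)) * (C ^ θ * (2 ^ n) ^ θ), ε, by positivity, hε0, hε1,
    fun f x₀ x R d r l hf hRH hd hd0 hr hrd hl hlow hup => ?_⟩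
  set h := weighted x₀ R f with hh
  have hhm : Measurable h := measurable_weighted hf
  set B₂ := Metric.closedBall x (2 * r) with hB₂
  have hB₂m : MeasurableSet B₂ := Metric.isClosed_closedBall.measurableSet
  set T := {y | ENNReal.ofReal (ε * l) < h y} with hT
  have hTm : MeasurableSet T := measurableSet_lt measurable_const hhm
  set Z := ∫⁻ y in B₂ ∩ T, h y ^ θ with hZ
  set a := l / d ^ n with ha
  have ha0 : 0 < a := by positivity
  have hdy : ∀ s, ∀ y ∈ Metric.closedBall x s, d - s ≤ R - dist y x₀ ∧ R - dist y x₀ ≤ d + s := by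
    intro s y hy
    have h1 : dist y x ≤ s := hy
    have h2 := dist_triangle y x x₀
    have h3 := dist_triangle_left x x₀ y
    rw [hd]
    constructor <;> linarith
  have hflow : ∀ y ∈ B₂, f y ≤ ENNReal.ofReal ((2 / d) ^ n) * h y := by
    intro y hy
    rw [hh, weighted, ← mul_assoc, ← ENNReal.ofReal_mul (by positivity), ballWeight, ← mul_pow]
    have h1 : d / 2 ≤ max 0 (R - dist y x₀) :=
      le_max_of_le_right (le_trans (by linarith) (hdy _ y hy).1)
    have h2 : 1 ≤ 2 / d * max 0 (R - dist y x₀) := by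
      calc (1 : ℝ) = 2 / d * (d / 2) := by field_simp
        _ ≤ _ := by gcongr
    have h3 : 1 ≤ ENNReal.ofReal ((2 / d * max 0 (R - dist y x₀)) ^ n) := by
      rw [← ENNReal.ofReal_one]; exact ENNReal.ofReal_le_ofReal (one_le_pow₀ h2)
    calc f y = 1 * f y := (one_mul _).symm
      _ ≤ _ := by gcongr
  have hB₂R : B₂ ⊆ Metric.closedBall x₀ R := by
    intro y hy
    rw [Metric.mem_closedBall]
    have := (hdy _ y hy).1
    linarith
  -- the reverse Hölder inequality
  have h1 : ENNReal.ofReal (a ^ θ * r ^ n * V ^ θ) ≤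
      ENNReal.ofReal (C ^ θ) * ∫⁻ y in B₂, f y ^ θ := by
    have h2 := ENNReal.rpow_le_rpow (hlow.trans (hRH x r hr hB₂R)) hθ0.le
    rw [ENNReal.mul_rpow_of_nonneg _ _ hθ0.le, ← ENNReal.rpow_mul, one_div_mul_cancel hθ0.ne',
      ENNReal.rpow_one, ENNReal.ofReal_rpow_of_nonneg (by positivity) hθ0.le,
      ENNReal.ofReal_rpow_of_nonneg (by positivity) hθ0.le] at h2
    have e1 : (l * V * (r / d) ^ n) ^ θ = a ^ θ * V ^ θ * (r ^ n) ^ θ := by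
      rw [← Real.mul_rpow ha0.le hV.le, ← Real.mul_rpow (by positivity) (by positivity), ha, div_pow]
      congr 1; ring
    have e2 : (C * r ^ ((n : ℝ) - n * (1 / θ))) ^ θ = C ^ θ * ((r ^ n) ^ θ * (r ^ n)⁻¹) := by
      rw [Real.mul_rpow hC0.le (by positivity), ← Real.rpow_mul hr.le, ← Real.rpow_natCast,
        ← Real.rpow_mul hr.le, ← Real.rpow_neg hr.le, ← Real.rpow_add hr]
      congr 2; field_simp; ring
    rw [e1, e2] at h2
    have hρ : 0 < (r ^ n) ^ θ := by positivity
    calc ENNReal.ofReal (a ^ θ * r ^ n * V ^ θ)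
        = ENNReal.ofReal (r ^ n * ((r ^ n) ^ θ)⁻¹) * ENNReal.ofReal (a ^ θ * V ^ θ * (r ^ n) ^ θ) := by
          rw [← ENNReal.ofReal_mul (by positivity)]
          congr 1; field_simp
      _ ≤ ENNReal.ofReal (r ^ n * ((r ^ n) ^ θ)⁻¹) *
          (ENNReal.ofReal (C ^ θ * ((r ^ n) ^ θ * (r ^ n)⁻¹)) * ∫⁻ y in B₂, f y ^ θ) := by gcongr
      _ = _ := by
          rw [← mul_assoc, ← ENNReal.ofReal_mul (by positivity)]
          congr 2; field_simp
  have h2 : ∫⁻ y in B₂, f y ^ θ ≤ ENNReal.ofReal (((2 / d) ^ n) ^ θ) * Z +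
      ENNReal.ofReal (((2 / d) ^ n * (ε * l)) ^ θ * ((2 * r) ^ n * V)) := by
    rw [← lintegral_inter_add_sdiff (fun y => f y ^ θ) B₂ hTm]
    refine add_le_add ?_ ?_
    · rw [hZ, ← lintegral_const_mul' _ _ ENNReal.ofReal_ne_top]
      refine setLIntegral_mono' (hB₂m.inter hTm) fun y hy => ?_
      rw [← ENNReal.ofReal_rpow_of_nonneg (by positivity) hθ0.le,
        ← ENNReal.mul_rpow_of_nonneg _ _ hθ0.le]
      exact ENNReal.rpow_le_rpow (hflow y hy.1) hθ0.le
    · calc ∫⁻ y in B₂ \ T, f y ^ θ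
          ≤ ∫⁻ y in B₂ \ T, ENNReal.ofReal (((2 / d) ^ n * (ε * l)) ^ θ) := by
            refine setLIntegral_mono' (hB₂m.diff hTm) fun y hy => ?_
            rw [← ENNReal.ofReal_rpow_of_nonneg (by positivity) hθ0.le]
            refine ENNReal.rpow_le_rpow ((hflow y hy.1).trans ?_) hθ0.le
            rw [ENNReal.ofReal_mul (by positivity)]
            gcongr
            exact not_lt.1 hy.2
        _ ≤ ∫⁻ y in B₂, ENNReal.ofReal (((2 / d) ^ n * (ε * l)) ^ θ) :=
            lintegral_mono_set sdiff_subset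
        _ = _ := by
            rw [setLIntegral_const, volume_closedBall_eq x (by positivity),
              ← ENNReal.ofReal_mul (by positivity)]
  have e2d : ((2 / d) ^ n) ^ θ * l ^ θ = (2 ^ n) ^ θ * a ^ θ := by
    rw [← Real.mul_rpow (by positivity) (by positivity),
      ← Real.mul_rpow (by positivity) (by positivity), ha, div_pow]
    congr 1; ring
  have h3 : ENNReal.ofReal (a ^ θ * r ^ n * V ^ θ / 2) ≤
      ENNReal.ofReal (C ^ θ * ((2 / d) ^ n) ^ θ) * Z := by
    refine ENNReal.le_of_add_le_add_right (a := ENNReal.ofReal (a ^ θ * r ^ n * V ^ θ / 2))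
      ENNReal.ofReal_ne_top ?_
    rw [← ENNReal.ofReal_add (by positivity) (by positivity), add_halves]
    refine h1.trans ((mul_le_mul_right h2 _).trans ?_)
    rw [mul_add, ← mul_assoc, ← ENNReal.ofReal_mul (by positivity),
      ← ENNReal.ofReal_mul (by positivity)]
    gcongr
    have e : C ^ θ * (((2 / d) ^ n * (ε * l)) ^ θ * ((2 * r) ^ n * V)) =
        (C ^ θ * (2 ^ n) ^ θ * V * 2 ^ n) * (a ^ θ * r ^ n) * ε ^ θ := by
      rw [Real.mul_rpow (by positivity) (by positivity), Real.mul_rpow hε0.le hl.le, mul_pow]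
      linear_combination C ^ θ * ε ^ θ * (2 ^ n * r ^ n) * V * e2d
    rw [e]
    calc (C ^ θ * (2 ^ n) ^ θ * V * 2 ^ n) * (a ^ θ * r ^ n) * ε ^ θ
        ≤ (C ^ θ * (2 ^ n) ^ θ * V * 2 ^ n) * (a ^ θ * r ^ n) * κ := by gcongr
      _ = _ := by rw [hκ]; field_simp
  have h4 : ∫⁻ y in Metric.closedBall x (16 * r), h y ≤
      ENNReal.ofReal ((2 * d) ^ n * (l * V * (16 * r / d) ^ n)) := by
    rw [ENNReal.ofReal_mul (by positivity)]
    refine le_trans ?_ (mul_le_mul_right hup _)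
    rw [← lintegral_const_mul' _ _ ENNReal.ofReal_ne_top]
    refine setLIntegral_mono' Metric.isClosed_closedBall.measurableSet fun y hy => ?_
    rw [hh, weighted, ballWeight]
    gcongr
    exact max_le (by positivity) ((hdy _ y hy).2.trans (by linarith))
  have el : l = l ^ (1 - θ) * (d ^ n) ^ θ * a ^ θ := by
    rw [mul_assoc, ← Real.mul_rpow (by positivity) ha0.le, ha, mul_div_cancel₀ _ (by positivity),
      ← Real.rpow_add hl, sub_add_cancel, Real.rpow_one]
  have eV : V = V ^ (1 - θ) * V ^ θ := by
    rw [← Real.rpow_add hV, sub_add_cancel, Real.rpow_one]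
  have ed : (d ^ n) ^ θ * ((2 / d) ^ n) ^ θ = (2 ^ n) ^ θ := by
    rw [← Real.mul_rpow (by positivity) (by positivity), ← mul_pow, mul_div_cancel₀ _ hd0.ne']
  have e5 : (2 * d) ^ n * (l * V * (16 * r / d) ^ n) =
      (2 * 2 ^ n * 16 ^ n * V ^ (1 - θ) * l ^ (1 - θ) * (d ^ n) ^ θ) *
        (a ^ θ * r ^ n * V ^ θ / 2) := by
    calc (2 * d) ^ n * (l * V * (16 * r / d) ^ n) = 2 ^ n * 16 ^ n * r ^ n * (l * V) := by
          rw [mul_pow, div_pow, mul_pow]; field_simp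
      _ = 2 ^ n * 16 ^ n * r ^ n * ((l ^ (1 - θ) * (d ^ n) ^ θ * a ^ θ) * (V ^ (1 - θ) * V ^ θ)) := by
          rw [← el, ← eV]
      _ = _ := by ring
  rw [e5, ENNReal.ofReal_mul (by positivity)] at h4
  refine h4.trans ((mul_le_mul_right h3 _).trans (le_of_eq ?_))
  rw [← mul_assoc, ← ENNReal.ofReal_mul (by positivity)]
  congr 2
  linear_combination 2 * 2 ^ n * 16 ^ n * V ^ (1 - θ) * l ^ (1 - θ) * C ^ θ * ed

/-- Lebesgue differentiation along dyadic radii. -/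
lemma ae_exists_stopping {f : EuclideanSpace ℝ (Fin n) → ℝ≥0∞} (hf : Measurable f)
    (hfin : ∫⁻ x, f x ≠ ∞) :
    ∀ᵐ x, ∀ (d : ℝ) (m : ℝ), 0 < d → 0 ≤ m → ENNReal.ofReal m < f x →
      ∃ j : ℕ, ENNReal.ofReal (m * ((d / 2 ^ j) ^ n * unitBallVolume n)) <
        ∫⁻ y in Metric.closedBall x (d / 2 ^ j), f y := by
  filter_upwards [(Besicovitch.vitaliFamily (volume : Measure (EuclideanSpace ℝ (Fin n)))
    ).ae_tendsto_lintegral_div hf.aemeasurable hfin] with x hx d m hd hm hmx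
  have h1 : Tendsto (fun j : ℕ => d / 2 ^ j) atTop (𝓝[>] 0) := by
    refine tendsto_nhdsWithin_iff.2 ⟨?_, Eventually.of_forall fun j => mem_Ioi.2 (by positivity)⟩
    have h2 := (tendsto_pow_atTop_nhds_zero_of_lt_one (r := (1 / 2 : ℝ)) (by norm_num)
      (by norm_num)).const_mul d
    rw [mul_zero] at h2
    refine h2.congr fun j => ?_
    rw [div_pow, one_pow, mul_one_div]
  have h2 := (hx.comp (Besicovitch.tendsto_filterAt volume x)).comp h1
  obtain ⟨j, hj⟩ := (h2.eventually (lt_mem_nhds hmx)).exists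
  refine ⟨j, ?_⟩
  have hV := unitBallVolume_pos (n := n)
  simp only [Function.comp_apply] at hj
  rw [volume_closedBall_eq x (by positivity), ENNReal.lt_div_iff_mul_lt
    (Or.inr ENNReal.ofReal_ne_top) (Or.inl ENNReal.ofReal_ne_top), ← ENNReal.ofReal_mul hm] at hj
  exact hj

end Gehring

section Gehring

variable {n : ℕ}

/-- Almost every point of the super-level set is the centre of a stopping ball, by Lebesgue
differentiation. A Vitali subfamily has disjoint balls of radius `2ρ`, on which the right sides of
the local estimate live, while the enlargements to `16ρ` cover the set. -/
lemma exists_levelSet_estimate (hn : 1 ≤ n) {θ C : ℝ} (hθ0 : 0 < θ) (hθ1 : θ < 1) (hC : 1 ≤ C) :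
    ∃ K ε : ℝ, 0 ≤ K ∧ 0 < ε ∧ ε ≤ 1 ∧ ∀ (f : EuclideanSpace ℝ (Fin n) → ℝ≥0∞)
      (x₀ : EuclideanSpace ℝ (Fin n)) (R l : ℝ), Measurable f → ∫⁻ x, f x ≠ ∞ →
      ReverseHolderOn f x₀ R C θ → 0 < l →
      ∫⁻ x, f x ≤ ENNReal.ofReal (l * unitBallVolume n * ((1 / 256) ^ n)) →
      ∫⁻ x in {x | ENNReal.ofReal l < weighted x₀ R f x}, weighted x₀ R f x ≤
        ENNReal.ofReal (K * l ^ (1 - θ)) *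
          ∫⁻ x in {x | ENNReal.ofReal (ε * l) < weighted x₀ R f x}, weighted x₀ R f x ^ θ := by
  have hV := unitBallVolume_pos (n := n)
  obtain ⟨K, ε, hK, hε0, hε1, hloc⟩ := exists_levelSet_local (n := n) hθ0 hθ1 hC
  refine ⟨K, ε, hK, hε0, hε1, fun f x₀ R l hf hfin hRH hl hsmall => ?_⟩
  set V := unitBallVolume n with hVdef
  set h := weighted x₀ R f with hh
  have hhm : Measurable h := measurable_weighted hf
  set d : EuclideanSpace ℝ (Fin n) → ℝ := fun x => R - dist x x₀ with hd
  have hdpos : ∀ x, ENNReal.ofReal l < h x → 0 < d x := by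
    intro x hx
    by_contra hc
    have : h x = 0 := by
      rw [hh, weighted, ballWeight, max_eq_left (not_lt.1 hc), zero_pow (by omega)]
      simp
    rw [this] at hx
    exact not_lt_zero hx
  set T := {x | ENNReal.ofReal (ε * l) < h x} with hT
  have hTm : MeasurableSet T := measurableSet_lt measurable_const hhm
  set P : EuclideanSpace ℝ (Fin n) → ℕ → Prop := fun x j =>
    ENNReal.ofReal (l * V * (1 / 2 ^ j) ^ n) < ∫⁻ y in Metric.closedBall x (d x / 2 ^ j), f y with hP
  -- the stopping radius
  have hrad : ∀ᵐ x, ENNReal.ofReal l < h x → ∃ r : ℝ, 0 < r ∧ r ≤ d x / 32 ∧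
      ENNReal.ofReal (l * V * (r / d x) ^ n) ≤ ∫⁻ y in Metric.closedBall x r, f y ∧
      ∫⁻ y in Metric.closedBall x (16 * r), f y ≤
        ENNReal.ofReal (l * V * (16 * r / d x) ^ n) := by
    filter_upwards [ae_exists_stopping hf hfin] with x hx hxl
    have hdx := hdpos x hxl
    have hex : ∃ j, P x j := by
      obtain ⟨j, hj⟩ := hx (d x) (l / d x ^ n) hdx (by positivity) (by
        rw [hh, weighted, ballWeight, max_eq_right hdx.le] at hxl
        by_contra hc
        refine absurd hxl (not_lt.2 ?_)
        calc ENNReal.ofReal (d x ^ n) * f x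
            ≤ ENNReal.ofReal (d x ^ n) * ENNReal.ofReal (l / d x ^ n) := by
              gcongr; exact not_lt.1 hc
          _ = ENNReal.ofReal l := by
              rw [← ENNReal.ofReal_mul (by positivity), mul_div_cancel₀ _ (by positivity)])
      refine ⟨j, lt_of_eq_of_lt ?_ hj⟩
      congr 1
      rw [div_pow, div_pow]
      field_simp
      rw [one_pow, mul_one, hVdef]
    obtain ⟨J, hJP, hJmin⟩ : ∃ J, P x J ∧ ∀ j < J, ¬ P x j := by
      classical
      exact ⟨Nat.find hex, Nat.find_spec hex, fun j hj => Nat.find_min hex hj⟩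
    -- Smallness of `∫ f` at level `l` excludes stopping at radius `d / 2^j` for `j ≤ 8`, which
    -- keeps the balls well inside.
    have hJ9 : 9 ≤ J := by
      by_contra hc
      refine absurd hJP (not_lt.2 ?_)
      refine (setLIntegral_le_lintegral _ _).trans (hsmall.trans (ENNReal.ofReal_le_ofReal ?_))
      have h2 : (2 : ℝ) ^ J ≤ 2 ^ 8 := pow_le_pow_right₀ (by norm_num) (by omega)
      have h3 : (1 : ℝ) / 256 ≤ 1 / 2 ^ J := one_div_le_one_div_of_le (by positivity)
        (h2.trans (by norm_num))
      gcongr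
    -- `16 = 2^4`: enlarging the stopping ball by `16` goes back four dyadic steps, to an index
    -- below `J`, where the stopping inequality fails.
    obtain ⟨i, rfl⟩ : ∃ i, J = i + 4 := ⟨J - 4, by omega⟩
    have hi := hJmin i (by omega)
    have e1 : 16 * (d x / 2 ^ (i + 4)) = d x / 2 ^ i := by rw [pow_add]; field_simp; norm_num
    refine ⟨d x / 2 ^ (i + 4), by positivity, ?_, ?_, ?_⟩
    · have h2 : (2 : ℝ) ^ 5 ≤ 2 ^ (i + 4) := pow_le_pow_right₀ (by norm_num) (by omega)
      exact div_le_div_of_nonneg_left hdx.le (by norm_num) (le_trans (by norm_num) h2)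
    · refine le_trans (le_of_eq ?_) hJP.le
      congr 3; field_simp
    · rw [e1]
      refine (not_lt.1 hi).trans (le_of_eq ?_)
      congr 3; field_simp
  set G := {x | ENNReal.ofReal l < h x ∧ ∃ r : ℝ, 0 < r ∧ r ≤ d x / 32 ∧
      ENNReal.ofReal (l * V * (r / d x) ^ n) ≤ ∫⁻ y in Metric.closedBall x r, f y ∧
      ∫⁻ y in Metric.closedBall x (16 * r), f y ≤
        ENNReal.ofReal (l * V * (16 * r / d x) ^ n)} with hG
  have hGr : ∀ x : EuclideanSpace ℝ (Fin n), ∃ r : ℝ, x ∈ G → 0 < r ∧ r ≤ d x / 32 ∧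
      ENNReal.ofReal (l * V * (r / d x) ^ n) ≤ ∫⁻ y in Metric.closedBall x r, f y ∧
      ∫⁻ y in Metric.closedBall x (16 * r), f y ≤
        ENNReal.ofReal (l * V * (16 * r / d x) ^ n) := by
    intro x
    by_cases hx : x ∈ G
    · obtain ⟨r, hr⟩ := hx.2; exact ⟨r, fun _ => hr⟩
    · exact ⟨0, fun h => absurd h hx⟩
  choose ρ hρ using hGr
  -- The Vitali factor `5` on radii `2ρ` gives `10ρ`, which `16ρ` contains.
  obtain ⟨s, hsG, hsd, hscov⟩ := Vitali.exists_disjoint_subfamily_covering_enlargement_closedBall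
    G (fun x => x) (fun x => 2 * ρ x) R (fun x hx => by
      have h1 := (hρ x hx).2.1
      have h2 : d x ≤ R := by simp only [hd]; linarith [dist_nonneg (x := x) (y := x₀)]
      have h3 := hdpos x hx.1
      linarith) 5 (by norm_num)
  have hsc : s.Countable := hsd.countable_of_nonempty_interior fun x hx => by
    have h1 := (hρ x (hsG hx)).1
    exact (Metric.nonempty_ball.2 (by positivity : 0 < 2 * ρ x)).mono
      Metric.ball_subset_interior_closedBall
  have := hsc.to_subtype
  have hcov : {x | ENNReal.ofReal l < h x} ≤ᵐ[volume]
      ⋃ x : s, Metric.closedBall (x : EuclideanSpace ℝ (Fin n)) (16 * ρ x) := by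
    filter_upwards [hrad] with x hx hxl
    have hxG : x ∈ G := ⟨hxl, hx hxl⟩
    obtain ⟨b, hb, hsub⟩ := hscov x hxG
    refine mem_iUnion.2 ⟨⟨b, hb⟩, ?_⟩
    have h1 := (hρ x hxG).1
    have h2 := (hρ b (hsG hb)).1
    refine Metric.closedBall_subset_closedBall ?_
      (hsub (Metric.mem_closedBall_self (by positivity)))
    dsimp only
    linarith
  calc ∫⁻ x in {x | ENNReal.ofReal l < h x}, h x
      ≤ ∫⁻ x in ⋃ x : s, Metric.closedBall (x : EuclideanSpace ℝ (Fin n)) (16 * ρ x), h x :=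
        lintegral_mono' (Measure.restrict_mono' hcov le_rfl) le_rfl
    _ ≤ ∑' x : s, ∫⁻ y in Metric.closedBall (x : EuclideanSpace ℝ (Fin n)) (16 * ρ x), h y :=
        lintegral_iUnion_le _ _
    _ ≤ ∑' x : s, ENNReal.ofReal (K * l ^ (1 - θ)) *
          ∫⁻ y in Metric.closedBall (x : EuclideanSpace ℝ (Fin n)) (2 * ρ x) ∩ T, h y ^ θ := by
        refine ENNReal.tsum_le_tsum fun x => ?_
        obtain ⟨h1, h2, h3, h4⟩ := hρ x (hsG x.2)
        exact hloc f x₀ x R (d x) (ρ x) l hf hRH rfl (hdpos x (hsG x.2).1) h1 h2 hl h3 h4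
    _ = ENNReal.ofReal (K * l ^ (1 - θ)) * ∫⁻ y in ⋃ x : s,
          Metric.closedBall (x : EuclideanSpace ℝ (Fin n)) (2 * ρ x) ∩ T, h y ^ θ := by
        rw [ENNReal.tsum_mul_left, lintegral_iUnion
          (fun x => Metric.isClosed_closedBall.measurableSet.inter hTm)]
        intro x y hxy
        exact (hsd x.2 y.2 (fun h => hxy (Subtype.ext h))).mono inter_subset_left inter_subset_left
    _ ≤ _ := by
        gcongr
        exact iUnion_subset fun _ => inter_subset_right

/-- Gehring's lemma on a ball. -/
lemma exists_gehring (hn : 1 ≤ n) {θ C : ℝ} (hθ0 : 0 < θ) (hθ1 : θ < 1) (hC : 1 ≤ C) :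
    ∃ δ c : ℝ, 0 < δ ∧ δ < 1 ∧ 1 ≤ c ∧ ∀ (f : EuclideanSpace ℝ (Fin n) → ℝ≥0∞)
      (x₀ : EuclideanSpace ℝ (Fin n)) (R : ℝ),
      AEMeasurable f (volume.restrict (Metric.closedBall x₀ R)) →
      ∫⁻ x in Metric.closedBall x₀ R, f x ≠ ∞ → 0 < R → ReverseHolderOn f x₀ R C θ →
      ∫⁻ x in Metric.closedBall x₀ (R / 2), f x ^ (1 + δ) ≤
        ENNReal.ofReal (c * ((R ^ n) ^ δ)⁻¹) *
          (∫⁻ x in Metric.closedBall x₀ R, f x) ^ (1 + δ) := by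
  have hV := unitBallVolume_pos (n := n)
  obtain ⟨K, ε, hK, hε0, hε1, hlev⟩ := exists_levelSet_estimate hn hθ0 hθ1 hC
  have h1θ : 0 < 1 - θ := by linarith
  set δ : ℝ := min (1 / 2) ((1 - θ) * ε ^ 2 / (2 * (K + 1))) with hδ
  have hδ0 : 0 < δ := lt_min (by norm_num) (by positivity)
  have hδ1 : δ < 1 := (min_le_left _ _).trans_lt (by norm_num)
  have hδK : δ * K / ((1 - θ) * ε ^ 2) ≤ 1 / 2 := by
    rw [div_le_iff₀ (by positivity)]
    have h1 : δ ≤ (1 - θ) * ε ^ 2 / (2 * (K + 1)) := min_le_right _ _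
    rw [le_div_iff₀ (by positivity)] at h1
    nlinarith
  -- With this value, `l ≥ Λ ∫ f` is exactly the smallness condition of the level-set estimate.
  set Λ : ℝ := 256 ^ n / unitBallVolume n with hΛ
  have hΛ0 : 0 < Λ := by positivity
  refine ⟨δ, max 1 (2 * Λ ^ δ * (2 ^ n) ^ (1 + δ)), hδ0, hδ1, le_max_left _ _,
    fun f₀ x₀ R hf₀ hfin₀ hR hRH₀ => ?_⟩
  set B := Metric.closedBall x₀ R with hB
  have hBm : MeasurableSet B := Metric.isClosed_closedBall.measurableSet
  have hB' : Metric.closedBall x₀ (R / 2) ⊆ B := Metric.closedBall_subset_closedBall (by linarith)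
  -- A measurable representative, extended by zero: it has finite integral over the whole space and
  -- satisfies the same reverse Hölder inequality.
  set f := B.indicator (hf₀.mk f₀) with hfdef
  have hf : Measurable f := hf₀.measurable_mk.indicator hBm
  have hff : ∀ᵐ x ∂(volume.restrict B), f₀ x = f x := by
    filter_upwards [hf₀.ae_eq_mk, ae_restrict_mem hBm] with x hx hxB
    rw [hfdef, indicator_of_mem hxB, hx]
  have hffs : ∀ A ⊆ B, ∀ᵐ x ∂(volume.restrict A), f₀ x = f x := fun A hA =>
    ae_mono (Measure.restrict_mono hA le_rfl) hff
  have hint : ∫⁻ x, f x = ∫⁻ x in B, f₀ x := by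
    rw [hfdef, lintegral_indicator hBm]
    exact lintegral_congr_ae (hf₀.ae_eq_mk.symm)
  have hfin : ∫⁻ x, f x ≠ ∞ := by rwa [hint]
  have hRH : ReverseHolderOn f x₀ R C θ := by
    intro y r hr hsub
    have h1 := hRH₀ y r hr hsub
    rw [lintegral_congr_ae (hffs _ ((Metric.closedBall_subset_closedBall (by linarith)).trans hsub)),
      lintegral_congr_ae (g := fun x => f x ^ θ) ((hffs _ hsub).mono fun x hx => by simp only [hx])]
      at h1
    exact h1
  set I := ∫⁻ x, f x with hI
  set h := weighted x₀ R f with hh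
  have hhm : Measurable h := measurable_weighted hf
  have hhle : ∀ x, h x ≤ ENNReal.ofReal (R ^ n) * f x := by
    intro x
    rw [hh, weighted, ballWeight]
    gcongr
    exact max_le hR.le (by linarith [dist_nonneg (x := x) (y := x₀)])
  have hhint : ∫⁻ x, h x ≤ ENNReal.ofReal (R ^ n) * I := by
    rw [hI, ← lintegral_const_mul _ hf]
    exact lintegral_mono hhle
  have hhfin : ∫⁻ x, h x ≠ ∞ := ne_top_of_le_ne_top (ENNReal.mul_ne_top ENNReal.ofReal_ne_top hfin)
    hhint
  have hmain := lintegral_rpow_le_of_levelSet hhm hhfin hθ0 hθ1 hK hε0 hε1 hδ0 hδ1.le hδK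
    (l₀ := Λ * I.toReal) (by positivity) (fun l hl hl0 => hlev f x₀ R l hf hfin hRH hl (by
      change I ≤ _
      rw [← ENNReal.ofReal_toReal hfin]
      refine ENNReal.ofReal_le_ofReal ?_
      rw [hΛ, div_mul_eq_mul_div, div_le_iff₀ hV] at hl0
      rw [one_div, inv_pow, ← div_eq_mul_inv, le_div_iff₀ (by positivity)]
      linarith))
  have hlow : ∀ x ∈ Metric.closedBall x₀ (R / 2),
      f₀ x = f x → f₀ x ^ (1 + δ) ≤ ENNReal.ofReal (((2 / R) ^ n) ^ (1 + δ)) * h x ^ (1 + δ) := by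
    intro x hx he
    rw [← ENNReal.ofReal_rpow_of_nonneg (by positivity) (by linarith),
      ← ENNReal.mul_rpow_of_nonneg _ _ (by linarith), he]
    refine ENNReal.rpow_le_rpow ?_ (by linarith)
    rw [hh, weighted, ← mul_assoc, ← ENNReal.ofReal_mul (by positivity), ballWeight, ← mul_pow]
    have hx' : dist x x₀ ≤ R / 2 := hx
    have h1 : R / 2 ≤ max 0 (R - dist x x₀) := le_max_of_le_right (by linarith)
    have h2 : 1 ≤ 2 / R * max 0 (R - dist x x₀) := by
      calc (1 : ℝ) = 2 / R * (R / 2) := by field_simp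
        _ ≤ _ := by gcongr
    have h3 : 1 ≤ ENNReal.ofReal ((2 / R * max 0 (R - dist x x₀)) ^ n) := by
      rw [← ENNReal.ofReal_one]; exact ENNReal.ofReal_le_ofReal (one_le_pow₀ h2)
    calc f x = 1 * f x := (one_mul _).symm
      _ ≤ _ := by gcongr
  rw [← hint]
  calc ∫⁻ x in Metric.closedBall x₀ (R / 2), f₀ x ^ (1 + δ)
      ≤ ∫⁻ x in Metric.closedBall x₀ (R / 2),
          ENNReal.ofReal (((2 / R) ^ n) ^ (1 + δ)) * h x ^ (1 + δ) := by
        refine lintegral_mono_ae ?_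
        filter_upwards [hffs _ hB', ae_restrict_mem Metric.isClosed_closedBall.measurableSet]
          with x hx hxB
        exact hlow x hxB hx
    _ ≤ ENNReal.ofReal (((2 / R) ^ n) ^ (1 + δ)) * ∫⁻ x, h x ^ (1 + δ) := by
        rw [lintegral_const_mul' _ _ ENNReal.ofReal_ne_top]
        gcongr
        exact Measure.restrict_le_self
    _ ≤ ENNReal.ofReal (((2 / R) ^ n) ^ (1 + δ)) * (2 * ENNReal.ofReal ((Λ * I.toReal) ^ δ) *
          (ENNReal.ofReal (R ^ n) * I)) := by
        gcongr
        exact hmain.trans (by gcongr)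
    _ = ENNReal.ofReal (2 * Λ ^ δ * (2 ^ n) ^ (1 + δ) * ((R ^ n) ^ δ)⁻¹) * I ^ (1 + δ) := by
        rw [Real.mul_rpow hΛ0.le ENNReal.toReal_nonneg, ENNReal.ofReal_mul (by positivity),
          ← ENNReal.ofReal_rpow_of_nonneg ENNReal.toReal_nonneg hδ0.le, ENNReal.ofReal_toReal hfin,
          ENNReal.rpow_add_of_nonneg _ _ zero_le_one hδ0.le, ENNReal.rpow_one]
        have e : 2 * Λ ^ δ * (2 ^ n) ^ (1 + δ) * ((R ^ n) ^ δ)⁻¹ =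
            ((2 / R) ^ n) ^ (1 + δ) * (2 * (Λ ^ δ * R ^ n)) := by
          rw [div_pow, Real.div_rpow (by positivity : (0 : ℝ) ≤ 2 ^ n) (by positivity),
            Real.rpow_add (by positivity : 0 < R ^ n), Real.rpow_one]
          field_simp
        rw [e, ENNReal.ofReal_mul (by positivity), ENNReal.ofReal_mul (by norm_num),
          ENNReal.ofReal_mul (by positivity), ENNReal.ofReal_ofNat]
        ring
    _ ≤ _ := by
        refine mul_le_mul_left (ENNReal.ofReal_le_ofReal ?_) _
        exact mul_le_mul_of_nonneg_right (le_max_right _ _) (by positivity)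

end Gehring

/-! ### Dependence on the data and passage to interior subsets. -/

namespace OrliczMultiPhase

variable {n : ℕ}

/-- The parameters common to the three regimes. -/
def Data.base : Data → BaseData
  | .sobolev B _ _ _ => B
  | .bounded B _ _ => B
  | .holder B _ _ _ => B

/-- The bound for `‖Ψ(x, |Du|)‖_{L¹}` contained in the data, where there is one. -/
noncomputable def Data.energyBound : Data → ℝ
  | .sobolev _ _ E _ => max 1 E
  | .bounded _ _ _ => 1
  | .holder _ _ _ _ => 1

lemma Data.one_le_energyBound (D : Data) : 1 ≤ D.energyBound := by
  cases D
  · exact le_max_left _ _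
  · exact le_rfl
  · exact le_rfl

/-- A common index of the Young functions, as a function of the data. -/
noncomputable def Data.index (D : Data) : ℝ := max 1 (max D.base.sG (max D.base.sHa D.base.sHb))

/-- The ellipticity ratio, as a function of the data. -/
noncomputable def Data.ratio (D : Data) : ℝ := max 1 (D.base.L / D.base.ν)

namespace Setting

variable (S : Setting n) {ν L : ℝ} {u : EuclideanSpace ℝ (Fin n) → ℝ}
  {Du : EuclideanSpace ℝ (Fin n) → EuclideanSpace ℝ (Fin n)} {R : Regime}

lemma data_base : (S.data ν L u Du R).base = S.baseData ν L := by
  cases R <;> rfl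

/-- The energy is needed only where the superlinear factor is nonzero, and there it belongs to the
data; in the other two regimes both sides are zero. -/
lemma superlinearFactor_mul_energy_le
    (hE : ∫⁻ x in S.Ω, S.ePsi x ‖Du x‖ ≠ ∞) :
    ENNReal.ofReal (S.data ν L u Du R).superlinearFactor *
        (∫⁻ x in S.Ω, S.ePsi x ‖Du x‖) ^ (1 / (n : ℝ)) ≤
      ENNReal.ofReal ((S.data ν L u Du R).superlinearFactor *
        (S.data ν L u Du R).energyBound ^ (1 / (n : ℝ))) := by
  have h0 := (S.data ν L u Du R).superlinearFactor_nonneg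
  cases R with
  | sobolev =>
    rw [ENNReal.ofReal_mul h0, ← ENNReal.ofReal_rpow_of_nonneg
      (zero_le_one.trans (Data.one_le_energyBound _)) (by positivity)]
    gcongr
    refine (ENNReal.ofReal_toReal hE).symm.le.trans (ENNReal.ofReal_le_ofReal ?_)
    exact le_max_right _ _
  | bounded => simp [data, Data.superlinearFactor]
  | holder γ => simp [data, Data.superlinearFactor]

end Setting

/-- Higher integrability on closed balls. -/
lemma exists_higher_integrability (hn : 2 ≤ n) (D : Data) :
    ∃ δ c : ℝ, 0 < δ ∧ δ < 1 ∧ 1 ≤ c ∧ ∀ (S : Setting n) (ν L : ℝ)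
      (F : EuclideanSpace ℝ (Fin n) → ℝ → EuclideanSpace ℝ (Fin n) → ℝ)
      (u : EuclideanSpace ℝ (Fin n) → ℝ)
      (Du : EuclideanSpace ℝ (Fin n) → EuclideanSpace ℝ (Fin n)) (R : Regime),
      S.IsIntegrand ν L F → S.IsLocalMinimizer F u Du → S.Assumption u Du R →
      D = S.data ν L u Du R → ∀ (x₀ : EuclideanSpace ℝ (Fin n)) (ρ : ℝ), 0 < ρ → ρ ≤ 1 →
      Metric.closedBall x₀ ρ ⊆ S.Ω →
      ∫⁻ x in Metric.closedBall x₀ (ρ / 2), S.ePsi x ‖Du x‖ ^ (1 + δ) ≤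
        ENNReal.ofReal (c * ((ρ ^ n) ^ δ)⁻¹) *
          (∫⁻ x in Metric.closedBall x₀ ρ, S.ePsi x ‖Du x‖) ^ (1 + δ) := by
  have hV := unitBallVolume_pos (n := n)
  have hs : 1 ≤ D.index := le_max_left _ _
  have hQ : 1 ≤ D.ratio := le_max_left _ _
  have hN : 0 ≤ D.superlinearFactor * D.energyBound ^ (1 / (n : ℝ)) :=
    mul_nonneg D.superlinearFactor_nonneg
      (Real.rpow_nonneg (zero_le_one.trans D.one_le_energyBound) _)
  obtain ⟨θ, hθ0, hθ1, hθs, hθn⟩ := exists_reverseHolder_exponent hn hs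
  obtain ⟨C, hC, hRH⟩ := Setting.exists_reverseHolder hn hs hQ hθ0 hθ1 hθs hθn
    D.linearFactor_nonneg D.superlinearFactor_nonneg hN
  obtain ⟨δ, c, hδ0, hδ1, hc, hgehring⟩ := exists_gehring (n := n) (by omega) hθ0 hθ1 hC
  refine ⟨δ, c, hδ0, hδ1, hc, fun S ν L F u Du R hF hu hA hD x₀ ρ hρ hρ1 hsub => ?_⟩
  subst hD
  refine hgehring _ x₀ ρ ((S.aemeasurable_ePsi_grad hu.hasWeakGradient).mono_measure
    (Measure.restrict_mono hsub le_rfl))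
    ((lintegral_mono_set hsub).trans_lt hu.energy_finite).ne hρ ?_
  intro y r hr hyr
  -- Inclusion of the balls gives `2r ≤ ρ` by comparison of volumes.
  have hr1 : r ≤ 1 := by
    have h1 := measure_mono (μ := volume) hyr
    rw [volume_closedBall_eq y (by positivity), volume_closedBall_eq x₀ hρ.le,
      ENNReal.ofReal_le_ofReal_iff (by positivity)] at h1
    have h2 := (pow_le_pow_iff_left₀ (by positivity) hρ.le (by omega)).1
      (le_of_mul_le_mul_right h1 hV)
    linarith
  obtain ⟨xa, hxa, xb, hxb, hmin⟩ := S.exists_coefficients_min (x₀ := y) (r := 2 * r)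
    (by positivity) (hyr.trans hsub)
  refine hRH S ν L F u Du y r (S.a xa) (S.b xb) ?_ ?_ hF hu hr (hyr.trans hsub)
    (S.a_nonneg _ (hsub (hyr hxa))) (S.b_nonneg _ (hsub (hyr hxb))) hmin
    (S.ae_Psi_le_frozenPsi (by omega) hA hr hr1 (hyr.trans hsub) hxa hxb)
    (S.superlinearFactor_mul_energy_le hu.energy_finite.ne)
  · rw [Data.index, S.data_base]
    exact le_max_right _ _
  · rw [Data.ratio, S.data_base]
    calc L = L / ν * ν := by rw [div_mul_cancel₀ _ hF.ν_pos.ne']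
      _ ≤ max 1 (L / ν) * ν := mul_le_mul_of_nonneg_right (le_max_right _ _) hF.ν_pos.le

/-- Averaging over balls of a fixed radius. -/
lemma lintegral_lintegral_closedBall {g : EuclideanSpace ℝ (Fin n) → ℝ≥0∞}
    (hg : AEMeasurable g) {r : ℝ} (hr : 0 ≤ r) :
    ∫⁻ x, ∫⁻ y in Metric.closedBall x r, g y =
      ENNReal.ofReal (r ^ n * unitBallVolume n) * ∫⁻ y, g y := by
  set T : Set (EuclideanSpace ℝ (Fin n) × EuclideanSpace ℝ (Fin n)) := {p | dist p.2 p.1 ≤ r}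
    with hT
  have hTm : MeasurableSet T := measurableSet_le (by fun_prop) measurable_const
  have hm : AEMeasurable (Function.uncurry fun x y : EuclideanSpace ℝ (Fin n) =>
      T.indicator (fun p => g p.2) (x, y)) (volume.prod volume) :=
    (hg.comp_snd (μ := volume)).indicator hTm
  have h1 : ∀ x, ∫⁻ y in Metric.closedBall x r, g y =
      ∫⁻ y, T.indicator (fun p => g p.2) (x, y) := by
    intro x
    rw [← lintegral_indicator Metric.isClosed_closedBall.measurableSet]
    rfl
  simp_rw [h1]
  rw [lintegral_lintegral_swap hm, ← lintegral_const_mul'' _ hg]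
  refine lintegral_congr fun y => ?_
  have h2 : ∀ x, T.indicator (fun p => g p.2) (x, y) =
      (Metric.closedBall y r).indicator (fun _ => g y) x := by
    intro x
    simp only [indicator, hT, mem_ofPred_eq, Metric.mem_closedBall, dist_comm]
  simp_rw [h2]
  rw [lintegral_indicator Metric.isClosed_closedBall.measurableSet, setLIntegral_const,
    volume_closedBall_eq y hr, mul_comm]

/-- From estimates on balls to estimates on subsets away from the boundary. -/
lemma lintegral_rpow_le_of_forall_closedBall {Ω Ω₀ : Set (EuclideanSpace ℝ (Fin n))}
    (hΩ : MeasurableSet Ω) (hΩ₀ : MeasurableSet Ω₀) {f : EuclideanSpace ℝ (Fin n) → ℝ≥0∞}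
    (hf : AEMeasurable f (volume.restrict Ω)) {δ K ρ : ℝ} (hδ : 0 < δ) (hρ : 0 < ρ)
    (hfin : ∫⁻ x in Ω, f x ≠ ∞)
    (hsub : ∀ y ∈ Ω₀, Metric.closedBall y (3 / 2 * ρ) ⊆ Ω)
    (hball : ∀ x, Metric.closedBall x ρ ⊆ Ω → ∫⁻ y in Metric.closedBall x (ρ / 2), f y ^ (1 + δ) ≤
      ENNReal.ofReal K * (∫⁻ y in Metric.closedBall x ρ, f y) ^ (1 + δ)) :
    ∫⁻ y in Ω₀, f y ^ (1 + δ) ≤ ENNReal.ofReal (2 ^ n) * ENNReal.ofReal K *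
      (∫⁻ y in Ω, f y) ^ (1 + δ) := by
  have hV := unitBallVolume_pos (n := n)
  have hΩ₀Ω : Ω₀ ⊆ Ω := fun y hy => hsub y hy (Metric.mem_closedBall_self (by positivity))
  set E := ∫⁻ y in Ω, f y with hE
  set g₀ := Ω₀.indicator (fun y => f y ^ (1 + δ)) with hg₀
  set g := Ω.indicator f with hg
  have hgm : AEMeasurable g := (aemeasurable_indicator_iff hΩ).2 hf
  have hg₀m : AEMeasurable g₀ := (aemeasurable_indicator_iff hΩ₀).2
    ((hf.mono_measure (Measure.restrict_mono hΩ₀Ω le_rfl)).pow_const _)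
  -- Of the power `1 + δ` of the local energy, `δ` is estimated by the total energy, so that what
  -- remains is linear and can be integrated over all centres `x`.
  have hpt : ∀ x, ∫⁻ y in Metric.closedBall x (ρ / 2), g₀ y ≤
      ENNReal.ofReal K * E ^ δ * ∫⁻ y in Metric.closedBall x ρ, g y := by
    intro x
    by_cases hx : (Metric.closedBall x (ρ / 2) ∩ Ω₀).Nonempty
    · obtain ⟨z, hz1, hz2⟩ := hx
      have hxΩ : Metric.closedBall x ρ ⊆ Ω := by
        refine Subset.trans (Metric.closedBall_subset_closedBall' ?_) (hsub z hz2)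
        rw [Metric.mem_closedBall, dist_comm] at hz1
        linarith
      have e : ∫⁻ y in Metric.closedBall x ρ, g y = ∫⁻ y in Metric.closedBall x ρ, f y := by
        refine setLIntegral_congr_fun Metric.isClosed_closedBall.measurableSet fun y hy => ?_
        exact indicator_of_mem (hxΩ hy) _
      rw [e]
      calc ∫⁻ y in Metric.closedBall x (ρ / 2), g₀ y
          ≤ ∫⁻ y in Metric.closedBall x (ρ / 2), f y ^ (1 + δ) :=
            lintegral_mono fun y => indicator_le_self _ _ _
        _ ≤ ENNReal.ofReal K * (∫⁻ y in Metric.closedBall x ρ, f y) ^ (1 + δ) := hball x hxΩ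
        _ = ENNReal.ofReal K * ((∫⁻ y in Metric.closedBall x ρ, f y) ^ δ *
            ∫⁻ y in Metric.closedBall x ρ, f y) := by
            rw [add_comm, ENNReal.rpow_add_of_nonneg _ _ hδ.le zero_le_one, ENNReal.rpow_one]
        _ ≤ ENNReal.ofReal K * (E ^ δ * ∫⁻ y in Metric.closedBall x ρ, f y) := by
            gcongr
            exact lintegral_mono_set hxΩ
        _ = _ := by rw [mul_assoc]
    · have : ∫⁻ y in Metric.closedBall x (ρ / 2), g₀ y = 0 := by
        rw [setLIntegral_congr_fun (g := fun _ => 0) Metric.isClosed_closedBall.measurableSet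
          (fun y hy => indicator_of_notMem (fun hy' => hx ⟨y, hy, hy'⟩) _)]
        simp
      rw [this]
      exact zero_le
  -- Integrating in the centre replaces a covering argument: the only cost is the ratio `2^n` of the
  -- ball volumes, whatever the size of the set.
  have h1 : ENNReal.ofReal ((ρ / 2) ^ n * unitBallVolume n) * (∫⁻ y, g₀ y) ≤
      ENNReal.ofReal K * E ^ δ * (ENNReal.ofReal (ρ ^ n * unitBallVolume n) * ∫⁻ y, g y) := by
    rw [← lintegral_lintegral_closedBall hg₀m (by positivity),
      ← lintegral_lintegral_closedBall hgm hρ.le, ← lintegral_const_mul' _ _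
      (ENNReal.mul_ne_top ENNReal.ofReal_ne_top (ENNReal.rpow_ne_top_of_nonneg hδ.le hfin))]
    exact lintegral_mono hpt
  have hp : 0 < (ρ / 2) ^ n * unitBallVolume n := by positivity
  rw [hg₀, hg, lintegral_indicator hΩ₀, lintegral_indicator hΩ, ← hE] at h1
  calc ∫⁻ y in Ω₀, f y ^ (1 + δ)
      = ENNReal.ofReal ((ρ / 2) ^ n * unitBallVolume n)⁻¹ *
        (ENNReal.ofReal ((ρ / 2) ^ n * unitBallVolume n) * ∫⁻ y in Ω₀, f y ^ (1 + δ)) := by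
        rw [← mul_assoc, ← ENNReal.ofReal_mul (by positivity), inv_mul_cancel₀ hp.ne',
          ENNReal.ofReal_one, one_mul]
    _ ≤ ENNReal.ofReal ((ρ / 2) ^ n * unitBallVolume n)⁻¹ *
        (ENNReal.ofReal K * E ^ δ * (ENNReal.ofReal (ρ ^ n * unitBallVolume n) * E)) := by
        gcongr
    _ = (ENNReal.ofReal ((ρ / 2) ^ n * unitBallVolume n)⁻¹ *
          ENNReal.ofReal (ρ ^ n * unitBallVolume n)) * ENNReal.ofReal K * (E ^ δ * E) := by ring
    _ = _ := by
        rw [← ENNReal.ofReal_mul (by positivity), add_comm 1 δ,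
          ENNReal.rpow_add_of_nonneg _ _ hδ.le zero_le_one, ENNReal.rpow_one]
        congr 3
        rw [div_pow]
        field_simp

/-- A ball is connected, so one that starts in `Ω` and leaves it must meet the frontier, at distance
at most `r` from `y`. -/
lemma closedBall_subset_of_lt_setDist {Ω Ω₀ : Set (EuclideanSpace ℝ (Fin n))} (hΩ : IsOpen Ω)
    (hsub : Ω₀ ⊆ Ω) {r : ℝ} (hr : 0 ≤ r) (hrd : r < setDist Ω₀ (frontier Ω)) {y : EuclideanSpace ℝ (Fin n)}
    (hy : y ∈ Ω₀) : Metric.closedBall y r ⊆ Ω := by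
  by_contra hc
  obtain ⟨z, hz, hzΩ⟩ := not_subset.1 hc
  have hpre : IsPreconnected (Metric.closedBall y r) := (convex_closedBall y r).isPreconnected
  obtain ⟨w, hw, hwf⟩ : (Metric.closedBall y r ∩ frontier Ω).Nonempty := by
    by_contra hempty
    have hfr : ∀ w ∈ Metric.closedBall y r, w ∈ closure Ω → w ∈ Ω := fun w hw hwc => by
      by_contra hwΩ
      exact hempty ⟨w, hw, by rw [hΩ.frontier_eq]; exact ⟨hwc, hwΩ⟩⟩
    obtain ⟨w, -, hw1, hw2⟩ := hpre Ω (closure Ω)ᶜ hΩ isClosed_closure.isOpen_compl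
      (fun w hw => (em (w ∈ closure Ω)).imp (hfr w hw) id)
      ⟨y, Metric.mem_closedBall_self hr, hsub hy⟩ ⟨z, hz, fun hzc => hzΩ (hfr z hz hzc)⟩
    exact hw2 (subset_closure hw1)
  have h1 : (⨅ x ∈ Ω₀, Metric.infEDist x (frontier Ω)) ≤ ENNReal.ofReal r := by
    refine (iInf₂_le y hy).trans ((Metric.infEDist_le_edist_of_mem hwf).trans ?_)
    rw [edist_dist, dist_comm]
    exact ENNReal.ofReal_le_ofReal hw
  have h2 := ENNReal.toReal_mono ENNReal.ofReal_ne_top h1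
  rw [ENNReal.toReal_ofReal hr] at h2
  exact absurd hrd (not_lt.2 h2)

/-- Boundedness of `Ω` ensures that the frontier is nonempty; otherwise the distance would be
infinite and its real value `0`. -/
lemma setDist_frontier_pos (hn : 1 ≤ n) {Ω Ω₀ : Set (EuclideanSpace ℝ (Fin n))} (hΩ : IsOpen Ω)
    (hb : Bornology.IsBounded Ω) (hK : IsCompact (closure Ω₀)) (hsub : closure Ω₀ ⊆ Ω)
    (hne : Ω₀.Nonempty) : 0 < setDist Ω₀ (frontier Ω) := by
  obtain ⟨y, hy⟩ := hne
  have : Nonempty (Fin n) := ⟨⟨0, by omega⟩⟩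
  obtain ⟨ε, hε, hεΩ⟩ := hK.exists_thickening_subset_open hΩ hsub
  have hfr : (frontier Ω).Nonempty := by
    refine nonempty_frontier_iff.2 ⟨⟨y, hsub (subset_closure hy)⟩, fun h => ?_⟩
    rw [h] at hb
    exact NormedSpace.unbounded_univ ℝ (EuclideanSpace ℝ (Fin n)) hb
  have h1 : ENNReal.ofReal ε ≤ ⨅ x ∈ Ω₀, Metric.infEDist x (frontier Ω) := by
    refine le_iInf₂ fun x hx => Metric.le_infEDist.2 fun z hz => ?_
    by_contra hc
    have h2 : z ∈ Metric.thickening ε (closure Ω₀) := by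
      refine Metric.mem_thickening_iff.2 ⟨x, subset_closure hx, ?_⟩
      rw [not_le, edist_dist, ENNReal.ofReal_lt_ofReal_iff hε] at hc
      rwa [dist_comm]
    rw [hΩ.frontier_eq] at hz
    exact hz.2 (hεΩ h2)
  have h2 : (⨅ x ∈ Ω₀, Metric.infEDist x (frontier Ω)) ≠ ∞ :=
    ne_top_of_le_ne_top (Metric.infEDist_ne_top hfr) (iInf₂_le y hy)
  exact ENNReal.toReal_pos ((ENNReal.ofReal_pos.2 hε).trans_le h1).ne' h2

/-- The constant of the interior estimate. -/
noncomputable def interiorConstant (n : ℕ) (δ c d : ℝ) : ℝ :=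
  max 1 ((2 ^ n * (c * (((min d 1 / 2) ^ n) ^ δ)⁻¹)) ^ (1 / (1 + δ)))

end OrliczMultiPhase

theorem theorem5p9 (n : ℕ) (hn : 2 ≤ n) :
    ∃ (δ c : Data → ℝ) (C : Data → ℝ → ℝ),
      (∀ D, 0 < δ D ∧ δ D < 1 ∧ 1 ≤ c D ∧ ∀ d, 1 ≤ C D d) ∧
      ∀ (S : Setting n) (ν L : ℝ)
        (F : EuclideanSpace ℝ (Fin n) → ℝ → EuclideanSpace ℝ (Fin n) → ℝ)
        (u : EuclideanSpace ℝ (Fin n) → ℝ)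
        (Du : EuclideanSpace ℝ (Fin n) → EuclideanSpace ℝ (Fin n)) (r : Regime) (D : Data),
        S.IsIntegrand ν L F → S.IsLocalMinimizer F u Du → S.Assumption u Du r →
        D = S.data ν L u Du r →
        (∀ (x₀ : EuclideanSpace ℝ (Fin n)) (R : ℝ), 0 < R → R ≤ 1 →
          Metric.closedBall x₀ R ⊆ S.Ω →
          (⨍⁻ x in Metric.ball x₀ (R / 2),
              ENNReal.ofReal (S.Psi x ‖Du x‖) ^ (1 + δ D) ∂volume) ^ (1 / (1 + δ D)) ≤
            ENNReal.ofReal (c D) *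
              ⨍⁻ x in Metric.ball x₀ R, ENNReal.ofReal (S.Psi x ‖Du x‖) ∂volume) ∧
        ∀ Ω₀ : Set (EuclideanSpace ℝ (Fin n)), IsOpen Ω₀ → IsCompact (closure Ω₀) →
          closure Ω₀ ⊆ S.Ω →
          MemLp (fun x => S.Psi x ‖Du x‖) (ENNReal.ofReal (1 + δ D)) (volume.restrict Ω₀) ∧
          eLpNorm (fun x => S.Psi x ‖Du x‖) (ENNReal.ofReal (1 + δ D)) (volume.restrict Ω₀) ≤
            ENNReal.ofReal (C D (setDist Ω₀ (frontier S.Ω))) *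
              eLpNorm (fun x => S.Psi x ‖Du x‖) 1 (volume.restrict S.Ω) ∧
          (r = Regime.sobolev →
            eLpNorm (fun x => S.Psi x ‖Du x‖) (ENNReal.ofReal (1 + δ D))
                (volume.restrict Ω₀) ≤
              ENNReal.ofReal (C D (setDist Ω₀ (frontier S.Ω)))) := by
  have hV := unitBallVolume_pos (n := n)
  choose δ c hδ0 hδ1 hc hmain using exists_higher_integrability hn
  -- The factor `2^n c |B_1|^δ` arises on passing to means over `B_{R/2}` and `B_R`. Including the
  -- energy bound in the interior constant lets one constant serve also for the last claim in case
  -- 1.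
  refine ⟨δ, fun D => max 1 ((2 ^ n * c D * unitBallVolume n ^ δ D) ^ (1 / (1 + δ D))),
    fun D d => interiorConstant n (δ D) (c D) d * D.energyBound,
    fun D => ⟨hδ0 D, hδ1 D, le_max_left _ _, fun d =>
      one_le_mul_of_one_le_of_one_le (le_max_left _ _) D.one_le_energyBound⟩,
    fun S ν L F u Du r D hF hu hA hD => ?_⟩
  have hball := hmain D S ν L F u Du r hF hu hA hD
  have hδ0 := hδ0 D
  have hδ1 := hδ1 D
  have hc := hc D
  set δ := δ D
  set c := c D
  have hδ' : 0 < 1 + δ := by linarith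
  have hc0 : 0 < c := by linarith
  constructor
  · intro x₀ R hR hR1 hsub
    have h1 := hball x₀ R hR hR1 hsub
    have hae : Metric.ball x₀ R =ᵐ[volume] Metric.closedBall x₀ R := by
      refine ae_eq_of_subset_of_measure_ge Metric.ball_subset_closedBall ?_
        Metric.isOpen_ball.measurableSet.nullMeasurableSet ?_
      · rw [volume_closedBall_eq x₀ hR.le, volume_ball_eq x₀ hR]
      · rw [volume_closedBall_eq x₀ hR.le]; exact ENNReal.ofReal_ne_top
    rw [setLAverage_eq, setLAverage_eq, volume_ball_eq x₀ hR, volume_ball_eq x₀ (by positivity),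
      setLIntegral_congr hae]
    set E := ∫⁻ x in Metric.closedBall x₀ R, S.ePsi x ‖Du x‖ with hE
    have hX : ∫⁻ x in Metric.ball x₀ (R / 2), ENNReal.ofReal (S.Psi x ‖Du x‖) ^ (1 + δ) ≤
        ENNReal.ofReal (c * ((R ^ n) ^ δ)⁻¹) * E ^ (1 + δ) :=
      (lintegral_mono_set Metric.ball_subset_closedBall).trans h1
    have hp : 0 < (R / 2) ^ n * unitBallVolume n := by positivity
    have hq : 0 < R ^ n * unitBallVolume n := by positivity
    calc ((∫⁻ x in Metric.ball x₀ (R / 2), ENNReal.ofReal (S.Psi x ‖Du x‖) ^ (1 + δ)) /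
          ENNReal.ofReal ((R / 2) ^ n * unitBallVolume n)) ^ (1 / (1 + δ))
        ≤ (ENNReal.ofReal (c * ((R ^ n) ^ δ)⁻¹) * E ^ (1 + δ) /
          ENNReal.ofReal ((R / 2) ^ n * unitBallVolume n)) ^ (1 / (1 + δ)) := by gcongr
      _ = (ENNReal.ofReal (2 ^ n * c * unitBallVolume n ^ δ) *
          (E / ENNReal.ofReal (R ^ n * unitBallVolume n)) ^ (1 + δ)) ^ (1 / (1 + δ)) := by
          congr 1
          rw [div_eq_mul_inv (G := ℝ≥0∞), div_eq_mul_inv E, ENNReal.mul_rpow_of_nonneg _ _ hδ'.le,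
            ← ENNReal.ofReal_inv_of_pos hp, ← ENNReal.ofReal_inv_of_pos hq,
            ENNReal.ofReal_rpow_of_nonneg (by positivity) hδ'.le, mul_right_comm,
            ← ENNReal.ofReal_mul (by positivity), mul_left_comm,
            ← ENNReal.ofReal_mul (by positivity), mul_comm]
          congr 2
          rw [Real.inv_rpow hq.le, Real.mul_rpow (by positivity) hV.le,
            Real.rpow_add (by positivity), Real.rpow_add hV, Real.rpow_one, Real.rpow_one, div_pow]
          field_simp
      _ = ENNReal.ofReal ((2 ^ n * c * unitBallVolume n ^ δ) ^ (1 / (1 + δ))) *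
          (E / ENNReal.ofReal (R ^ n * unitBallVolume n)) := by
          rw [ENNReal.mul_rpow_of_nonneg _ _ (by positivity), ← ENNReal.rpow_mul,
            mul_one_div_cancel hδ'.ne', ENNReal.rpow_one,
            ENNReal.ofReal_rpow_of_nonneg (by positivity) (by positivity)]
      _ ≤ _ := mul_le_mul_left (ENNReal.ofReal_le_ofReal (le_max_right _ _)) _
  · intro Ω₀ hΩ₀ hK hKΩ
    have hsub : Ω₀ ⊆ S.Ω := subset_closure.trans hKΩ
    have hmeas : AEMeasurable (fun x => S.Psi x ‖Du x‖) (volume.restrict S.Ω) :=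
      S.aemeasurable_Psi (S.aemeasurable_norm_grad hu.hasWeakGradient) (fun _ => norm_nonneg _)
    have hnorm : ∀ x ∈ S.Ω, ‖S.Psi x ‖Du x‖‖ₑ = S.ePsi x ‖Du x‖ := by
      intro x hx
      rw [Real.enorm_eq_ofReal ((S.powerGrowth_Psi hx).nonneg (norm_nonneg _)), Setting.ePsi]
    set E := ∫⁻ x in S.Ω, S.ePsi x ‖Du x‖ with hE
    have hEfin : E ≠ ∞ := hu.energy_finite.ne
    have hL1 : eLpNorm (fun x => S.Psi x ‖Du x‖) 1 (volume.restrict S.Ω) = E := by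
      rw [eLpNorm_one_eq_lintegral_enorm]
      exact setLIntegral_congr_fun S.isOpen.measurableSet hnorm
    have hLp : eLpNorm (fun x => S.Psi x ‖Du x‖) (ENNReal.ofReal (1 + δ)) (volume.restrict Ω₀) =
        (∫⁻ x in Ω₀, S.ePsi x ‖Du x‖ ^ (1 + δ)) ^ (1 / (1 + δ)) := by
      rw [eLpNorm_eq_lintegral_rpow_enorm_toReal (by simpa using hδ') ENNReal.ofReal_ne_top,
        ENNReal.toReal_ofReal hδ'.le]
      congr 1
      exact setLIntegral_congr_fun hΩ₀.measurableSet fun x hx => by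
        simp only [hnorm x (hsub hx)]
    set d := setDist Ω₀ (frontier S.Ω) with hd
    have hest : eLpNorm (fun x => S.Psi x ‖Du x‖) (ENNReal.ofReal (1 + δ)) (volume.restrict Ω₀) ≤
        ENNReal.ofReal (interiorConstant n δ c d) * E := by
      -- For the empty set `setDist` is `0` and gives no usable radius. Otherwise `ρ = min d 1 / 2`
      -- satisfies `3ρ/2 < d`, as the averaging argument requires.
      rcases Ω₀.eq_empty_or_nonempty with rfl | hne
      · simp
      have hd0 : 0 < d := setDist_frontier_pos (by omega) S.isOpen S.isBounded hK hKΩ hne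
      set ρ := min d 1 / 2 with hρ
      have hm0 : 0 < min d 1 := lt_min hd0 one_pos
      have hρ0 : 0 < ρ := by positivity
      have hρ1 : ρ ≤ 1 := by linarith [min_le_right d 1]
      have hest := lintegral_rpow_le_of_forall_closedBall S.isOpen.measurableSet
        hΩ₀.measurableSet (S.aemeasurable_ePsi_grad hu.hasWeakGradient) hδ0 hρ0 hEfin
        (fun y hy => closedBall_subset_of_lt_setDist S.isOpen hsub (by positivity)
          (by rw [← hd]; linarith [min_le_left d 1]) hy)
        (fun x hx => hball x ρ hρ0 hρ1 hx)
      rw [hLp]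
      calc (∫⁻ x in Ω₀, S.ePsi x ‖Du x‖ ^ (1 + δ)) ^ (1 / (1 + δ))
          ≤ (ENNReal.ofReal (2 ^ n) * ENNReal.ofReal (c * ((ρ ^ n) ^ δ)⁻¹) * E ^ (1 + δ)) ^
            (1 / (1 + δ)) := by gcongr
        _ = ENNReal.ofReal ((2 ^ n * (c * ((ρ ^ n) ^ δ)⁻¹)) ^ (1 / (1 + δ))) * E := by
            rw [← ENNReal.ofReal_mul (by positivity), ENNReal.mul_rpow_of_nonneg _ _ (by positivity),
              ← ENNReal.rpow_mul, mul_one_div_cancel hδ'.ne', ENNReal.rpow_one,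
              ENNReal.ofReal_rpow_of_nonneg (by positivity) (by positivity)]
        _ ≤ _ := mul_le_mul_left (ENNReal.ofReal_le_ofReal (le_max_right _ _)) _
    have hI1 : 1 ≤ interiorConstant n δ c d := le_max_left _ _
    refine ⟨⟨(hmeas.mono_measure (Measure.restrict_mono hsub le_rfl)).aestronglyMeasurable,
      hest.trans_lt (ENNReal.mul_lt_top ENNReal.ofReal_lt_top hEfin.lt_top)⟩, ?_, ?_⟩
    · rw [hL1]
      refine hest.trans (mul_le_mul_left (ENNReal.ofReal_le_ofReal ?_) _)
      exact le_mul_of_one_le_right (by linarith) D.one_le_energyBound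
    · rintro rfl
      refine hest.trans ?_
      rw [ENNReal.ofReal_mul (by linarith)]
      gcongr
      rw [← ENNReal.ofReal_toReal hEfin, hD]
      exact ENNReal.ofReal_le_ofReal (le_max_right _ _)
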